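/- **Notation.** For $|c|<2$ put $\kappa=\frac{\sqrt{4-c^2}}{2}$ and, for $c\neq 0$, $$\mu_1=\frac{3c^2-4+2\sqrt{3c^2+4}}{\sqrt{18c^2-8+(3c^2+4)^{3/2}}},\qquad \mu_2=\frac{3c\sqrt{4-c^2}}{\sqrt{18c^2-8+(3c^2+4)^{3/2}}},\qquad \mu=\frac{\mu_1^2+\mu_2^2}{2}-1 .$$ The black soliton is $\phi_0(x)=\sqrt2\,\frac{\tanh x}{\sqrt{3-\tanh^2 x}}$, and for $0<|c|<2$ the dark profile with speed $c$ is $$\phi_c(x)=\frac{i\mu_1+\mu_2\tanh(\kappa x)}{\sqrt2\,\sqrt{1+\mu\tanh^2(\kappa x)}} .$$ Let $R_c=\operatorname{Re}\phi_c$, $\eta_c=1-|\phi_c|^4$, $\langle f,g\rangle_{\mathbb C}=\operatorname{Re}(f\bar g)$ and $\rho_c=\rho_c(\mathfrak z)=2\langle\phi_c,\mathfrak z\rangle_{\mathbb C}+|\mathfrak z|^2$. With weak derivatives, let $$\mathcal H=\mathcal H_0=\{f\in C^0(\mathbb R,\mathbb C): f'\in L^2(\mathbb R),\ \eta_0^{1/2}f\in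 L^2(\mathbb R)\},\qquad \|f\|_{\mathcal H_0}=\Big(\int_{\mathbb R}|f'|^2+\eta_0|f|^2\,dx\Big)^{1/2},$$ $$\mathcal Z=\{u\in\mathcal H: 1-|u|^4\in L^2(\mathbb R)\},\qquad E_2[u]=\int_{\mathbb R}\Big(|u'|^2+\tfrac13(1-|u|^2)^2(2+|u|^2)\Big)dx\quad(u\in\mathcal Z).$$ **Proposition (pseudo-coercivity of $E_2$ around the dark soliton).** There exist $\mathfrak c\in(0,2)$ and a constant $\Gamma_{\mathfrak c}>0$, depending only on $\mathfrak c$, such that the following holds. For all real $c$ with $|c|\le\mathfrak c$ and all $\mathfrak z\in\mathcal H$ satisfying $\phi_c+\mathfrak z\in\mathcal Z$ and the generalized orthogonality conditions $$\int_{\mathbb R}\langle\eta_c,\mathfrak z\rangle_{\mathbb C}\,dx=0,\qquad \int_{\mathbb R}\langle i\eta_c,\mathfrak z\rangle_{\mathbb C}\,dx=0,\qquad \int_{\mathbb R}\langle iR_c\eta_c,\mathfrak z\rangle_{\mathbb C}\,dx=0,$$ one has $$E_2[\phi_c+\mathfrak z]-E_2[\phi_0]\ \ge\ \Gamma_{\mathfrak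 c}\big(\|\mathfrak z\|_{\mathcal H_0}^2+\|\phi_c^3\rho_c\|_{L^2}^2\big)-\frac1{\Gamma_{\mathfrak c}}\big(c^2+\|\mathfrak z\|_{\mathcal H_0}^3\big).$$ -/

import Mathlib

open MeasureTheory
open scoped ContDiff

namespace QuinticGP

/-! ### Weak derivatives on the real line -/

/-- `g` is a weak (distributional) derivative of `f` on `ℝ`. -/
structure HasWeakDeriv (f g : ℝ → ℂ) : Prop where
  locallyIntegrable : LocallyIntegrable f volume
  locallyIntegrable_deriv : LocallyIntegrable g volume
  integral_eq : ∀ ψ : ℝ → ℝ, ContDiff ℝ ∞ ψ → HasCompactSupport ψ →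
    ∫ x, deriv ψ x • f x = - ∫ x, ψ x • g x

/-- Weak derivatives are unique up to null sets. -/
theorem HasWeakDeriv.ae_eq {f g h : ℝ → ℂ} (hg : HasWeakDeriv f g) (hh : HasWeakDeriv f h) :
    g =ᵐ[volume] h := by
  refine ae_eq_of_integral_contDiff_smul_eq hg.locallyIntegrable_deriv
    hh.locallyIntegrable_deriv fun ψ hψ hc => ?_
  have h1 := hg.integral_eq ψ hψ hc
  have h2 := hh.integral_eq ψ hψ hc
  rw [h1] at h2
  exact neg_injective h2

open Classical in
/-- The weak derivative of `f` (a representative of its a.e. class); `0` if there is none. -/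
noncomputable def weakDeriv (f : ℝ → ℂ) : ℝ → ℂ :=
  if h : ∃ g, HasWeakDeriv f g then h.choose else 0

theorem HasWeakDeriv.weakDeriv {f g : ℝ → ℂ} (hg : HasWeakDeriv f g) :
    HasWeakDeriv f (weakDeriv f) := by
  have h : ∃ g, HasWeakDeriv f g := ⟨g, hg⟩
  rw [QuinticGP.weakDeriv, dif_pos h]
  exact h.choose_spec

/-! ### The black soliton and the dark profiles -/

/-- The black soliton `φ₀`. -/
noncomputable def blackSoliton (x : ℝ) : ℝ :=
  √2 * (Real.tanh x / √(3 - Real.tanh x ^ 2))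

noncomputable def kappa (c : ℝ) : ℝ := √(4 - c ^ 2) / 2

noncomputable def mu₁ (c : ℝ) : ℝ :=
  (3 * c ^ 2 - 4 + 2 * √(3 * c ^ 2 + 4)) /
    √(18 * c ^ 2 - 8 + (3 * c ^ 2 + 4) ^ (3 / 2 : ℝ))

noncomputable def mu₂ (c : ℝ) : ℝ :=
  (3 * c * √(4 - c ^ 2)) / √(18 * c ^ 2 - 8 + (3 * c ^ 2 + 4) ^ (3 / 2 : ℝ))

/-- The solution `μ` of the relation `(μ₁² + μ₂²) / (2 + 2 μ) = 1`. -/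
noncomputable def mu (c : ℝ) : ℝ := (mu₁ c ^ 2 + mu₂ c ^ 2) / 2 - 1

open Classical in
/-- The dark profile `φ_c`, `|c| < 2`. At `c = 0`, where the fractions defining `μ₁` and `μ₂` are
`0 / 0`, it is the black soliton. -/
noncomputable def darkProfile (c x : ℝ) : ℂ :=
  if c = 0 then (blackSoliton x : ℂ)
  else (Complex.I * (mu₁ c : ℂ) + ((mu₂ c * Real.tanh (kappa c * x) : ℝ) : ℂ)) /
    ((√2 * √(1 + mu c * Real.tanh (kappa c * x) ^ 2) : ℝ) : ℂ)

/-- The weight `η_c = 1 - |φ_c|⁴`. -/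
noncomputable def eta (c x : ℝ) : ℝ := 1 - ‖darkProfile c x‖ ^ 4

/-- `R_c = Re φ_c`. -/
noncomputable def R (c x : ℝ) : ℝ := (darkProfile c x).re

/-- The real scalar product `⟨a, b⟩ = Re (a * conj b)` on `ℂ`. -/
noncomputable def cinner (a b : ℂ) : ℝ := (a * (starRingEnd ℂ) b).re

/-! ### Function spaces -/

/-- The weighted Sobolev space `ℋ_c`: continuous functions with `f' ∈ L²` and `√η_c f ∈ L²`. -/
def spaceH (c : ℝ) : Set (ℝ → ℂ) :=
  {f | Continuous f ∧ (∃ g, HasWeakDeriv f g ∧ MemLp g 2 volume) ∧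
    MemLp (fun x => (√(eta c x) : ℂ) * f x) 2 volume}

/-- The norm of `ℋ_c`. -/
noncomputable def normH (c : ℝ) (f : ℝ → ℂ) : ℝ :=
  √(∫ x, (‖weakDeriv f x‖ ^ 2 + eta c x * ‖f x‖ ^ 2))

/-- The set `𝒵 = {u ∈ ℋ : 1 - |u|⁴ ∈ L²}`, with `ℋ = ℋ_0`. -/
def spaceZ : Set (ℝ → ℂ) :=
  {u | u ∈ spaceH 0 ∧ MemLp (fun x => 1 - ‖u x‖ ^ 4) 2 volume}

/-- The `L²(ℝ)` norm. -/
noncomputable def normL2 (f : ℝ → ℂ) : ℝ := (eLpNorm f 2 volume).toReal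

/-! ### The Ginzburg-Landau energy -/

noncomputable def energyDensity (u : ℝ → ℂ) (x : ℝ) : ℝ :=
  ‖weakDeriv u x‖ ^ 2 + 1 / 3 * (1 - ‖u x‖ ^ 2) ^ 2 * (2 + ‖u x‖ ^ 2)

/-- The Ginzburg-Landau energy `E₂`. -/
noncomputable def E₂ (u : ℝ → ℂ) : ℝ := ∫ x, energyDensity u x

/-- The energy `E₂` is well defined on `𝒵`. -/
theorem integrable_energyDensity {u : ℝ → ℂ} (hu : u ∈ spaceZ) :
    Integrable (energyDensity u) volume := by
  obtain ⟨⟨hcont, ⟨g, hg, hg2⟩, -⟩, h4⟩ := hu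
  have hw : MemLp (weakDeriv u) 2 volume := (memLp_congr_ae (hg.weakDeriv.ae_eq hg)).2 hg2
  have h1 : Integrable (fun x => ‖weakDeriv u x‖ ^ 2) volume := hw.integrable_norm_pow (by simp)
  have h2 : Integrable (fun x => (1 - ‖u x‖ ^ 4) ^ 2) volume := h4.integrable_sq
  refine h1.add (h2.mono' (by fun_prop) (.of_forall fun x => ?_))
  have hr := sq_nonneg ‖u x‖
  generalize ‖u x‖ = r at *
  rw [Real.norm_of_nonneg (by positivity)]
  have key : (1 - r ^ 4) ^ 2 - 1 / 3 * (1 - r ^ 2) ^ 2 * (2 + r ^ 2) =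
      (1 - r ^ 2) ^ 2 * ((1 + 5 * r ^ 2 + 3 * (r ^ 2) ^ 2) / 3) := by ring
  have : 0 ≤ (1 - r ^ 2) ^ 2 * ((1 + 5 * r ^ 2 + 3 * (r ^ 2) ^ 2) / 3) := by positivity
  linarith

/-- `ρ_c(z) = 2 ⟨φ_c, z⟩ + |z|²`. -/
noncomputable def rho (c : ℝ) (z : ℝ → ℂ) (x : ℝ) : ℝ :=
  2 * cinner (darkProfile c x) (z x) + ‖z x‖ ^ 2

end QuinticGP

namespace QuinticGP

open Set Filter Topology

/-! ### Integrals of linear combinations and Cauchy–Schwarz -/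

/-! Since `E₂` sees only `|u|` and `|u'|`, the real part of `u = φ_c + z` may be multiplied by the
sign `s` that brings `s Re φ_c` close to `φ₀`. Write the result as `φ₀ + p + i q` and put `m = |u|²
- φ₀²`. The potential is a cubic in `|u|²`, so the energy expands exactly (`energy_sub_eq`): the
linear term vanishes because `φ₀'' = -η₀ φ₀`, leaving `∫ (p'² - η₀ p²) + ∫ (q'² - η₀ q²) + ∫ (φ₀² m²
+ m³/3)`. As `m ≥ -φ₀²`, the last integrand is at least `(2/3) φ₀² m²`.

The form `∫ f'² - η₀ f²` belongs to the weighted problem `-f'' = λ η₀ f`, with constants at `λ = 0`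
and `φ₀` at `λ = 1`; beyond them there is a gap (`exists_spectral_gap`). It is proved on the flux `F
= ∫_{-∞}^x η₀ f`, for which `φ₀' > 0` is a ground state: with `F = φ₀' v` one gets `∫ η₀ f² - ∫ F² =
∫ (φ₀'²/η₀) v'²`. Orthogonality of `F` to `φ₀'` turns this into a bound of `∫ F²` by a multiple of
the left side, and Cauchy–Schwarz in `∫ η₀ f² = -∫ F f'` yields a constant below one.

The form is thus coercive once the components along `1` and `φ₀` are controlled
(`exists_linear_coercivity`). The orthogonality conditions control both for `q`, but only the
constant one for `p`; the component `a φ₀` of `p` lies in the kernel of the form. It is recovered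
from the remainder: `m = 2 a φ₀² + ...`, so testing `m` against `η₀ φ₀²` bounds `a²` by the
remainder, the other components and a cubic error (`exists_component_bound`). This gives
`exists_coercivity`.

Finally `φ_c` is within `O(|c|)` of `s φ₀`, and the differences of the derivatives and of the
squared moduli also decay (`exists_profile_estimates`). Hence the orthogonality conditions pass to
`p`, `q` and the weights of `φ₀` with error `O(|c| (1 + ‖z‖))` (`exists_abs_integral_mul_le`); its
square costs `c²` and `c² ‖z‖²`, the latter absorbed for small `c`. The quantity `φ_c³ ρ_c` is
controlled by the remainder (`sq_mul_sub_sq_le`). -/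

theorem integral_lin2 {α : Type*} [MeasurableSpace α] {μ : Measure α} {f g : α → ℝ}
    (hf : Integrable f μ) (hg : Integrable g μ) (a b : ℝ) :
    ∫ x, (a * f x + b * g x) ∂μ = a * (∫ x, f x ∂μ) + b * ∫ x, g x ∂μ := by
  rw [integral_add (f := fun x => a * f x) (hf.const_mul a) (hg.const_mul b), integral_const_mul,
    integral_const_mul]

theorem integral_lin3 {α : Type*} [MeasurableSpace α] {μ : Measure α} {f g h : α → ℝ}
    (hf : Integrable f μ) (hg : Integrable g μ) (hh : Integrable h μ) (a b c : ℝ) :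
    ∫ x, (a * f x + b * g x + c * h x) ∂μ
      = a * (∫ x, f x ∂μ) + b * (∫ x, g x ∂μ) + c * ∫ x, h x ∂μ := by
  rw [integral_add (f := fun x => a * f x + b * g x) ((hf.const_mul a).add (hg.const_mul b))
    (hh.const_mul c), integral_lin2 hf hg, integral_const_mul]

/-- The polynomial `t ↦ ∫ (f - t g)²` is nonnegative, so its discriminant is nonpositive. -/
theorem sq_integral_mul_le {μ : Measure ℝ} {f g : ℝ → ℝ} (hf : MemLp f 2 μ) (hg : MemLp g 2 μ) :
    (∫ x, f x * g x ∂μ) ^ 2 ≤ (∫ x, f x ^ 2 ∂μ) * ∫ x, g x ^ 2 ∂μ := by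
  have hfg : Integrable (fun x => f x * g x) μ := hf.integrable_mul hg
  have hf2 : Integrable (fun x => f x ^ 2) μ := hf.integrable_sq
  have hg2 : Integrable (fun x => g x ^ 2) μ := hg.integrable_sq
  have h : ∀ t : ℝ, 0 ≤ (∫ x, g x ^ 2 ∂μ) * (t * t) + (-2 * ∫ x, f x * g x ∂μ) * t
      + ∫ x, f x ^ 2 ∂μ := by
    intro t
    have : ∫ x, (f x - t * g x) ^ 2 ∂μ = (∫ x, g x ^ 2 ∂μ) * (t * t)
        + (-2 * ∫ x, f x * g x ∂μ) * t + ∫ x, f x ^ 2 ∂μ := by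
      have e : (fun x => (f x - t * g x) ^ 2)
          = fun x => (t * t) * g x ^ 2 + (-2 * t) * (f x * g x) + f x ^ 2 := by
        funext x; ring
      have l := integral_lin3 hg2 hfg hf2 (t * t) (-2 * t) 1
      simp only [one_mul] at l
      rw [e, l]
      ring
    rw [← this]
    exact integral_nonneg fun x => sq_nonneg _
  have := discrim_le_zero h
  rw [discrim] at this
  nlinarith

/-! ### Primitives of locally integrable functions -/

/-- `f` is a primitive of the locally integrable function `g`. -/
structure IsPrimitive (f g : ℝ → ℝ) : Prop where
  locallyIntegrable : LocallyIntegrable g volume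
  integral_eq : ∀ a b, ∫ x in a..b, g x = f b - f a

namespace IsPrimitive

variable {f g f₁ g₁ f₂ g₂ : ℝ → ℝ}

theorem intervalIntegrable (h : IsPrimitive f g) (a b : ℝ) : IntervalIntegrable g volume a b :=
  (h.locallyIntegrable.integrableOn_isCompact isCompact_uIcc).intervalIntegrable

theorem eq_add (h : IsPrimitive f g) (a : ℝ) : f = fun x => f a + ∫ t in a..x, g t := by
  funext x; rw [h.integral_eq a x]; ring

theorem continuous (h : IsPrimitive f g) : Continuous f := by
  rw [h.eq_add 0]
  exact continuous_const.add
    (intervalIntegral.continuous_primitive (fun a b => h.intervalIntegrable a b) 0)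

theorem of_hasDerivAt (h : ∀ x, HasDerivAt f (g x) x) (hg : Continuous g) : IsPrimitive f g where
  locallyIntegrable := hg.locallyIntegrable
  integral_eq a b := intervalIntegral.integral_eq_sub_of_hasDerivAt (fun x _ => h x)
    (hg.intervalIntegrable a b)

theorem add (h₁ : IsPrimitive f₁ g₁) (h₂ : IsPrimitive f₂ g₂) :
    IsPrimitive (fun x => f₁ x + f₂ x) (fun x => g₁ x + g₂ x) where
  locallyIntegrable := h₁.locallyIntegrable.add h₂.locallyIntegrable
  integral_eq a b := by
    rw [intervalIntegral.integral_add (h₁.intervalIntegrable a b) (h₂.intervalIntegrable a b),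
      h₁.integral_eq, h₂.integral_eq]
    ring

theorem const_mul (h : IsPrimitive f g) (c : ℝ) :
    IsPrimitive (fun x => c * f x) (fun x => c * g x) where
  locallyIntegrable := h.locallyIntegrable.smul c
  integral_eq a b := by
    rw [intervalIntegral.integral_const_mul, h.integral_eq]; ring

theorem absolutelyContinuousOnInterval (h : IsPrimitive f g) (a b : ℝ) :
    AbsolutelyContinuousOnInterval f a b := by
  rw [h.eq_add a]
  have h1 : AbsolutelyContinuousOnInterval (fun _ : ℝ => f a) a b :=
    ContDiffOn.absolutelyContinuousOnInterval (contDiff_const.contDiffOn)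
  exact h1.fun_add ((h.intervalIntegrable a b).absolutelyContinuousOnInterval_intervalIntegral
    (by simp))

theorem ae_hasDerivAt (h : IsPrimitive f g) : ∀ᵐ x, HasDerivAt f (g x) x := by
  filter_upwards [LocallyIntegrable.ae_hasDerivAt_integral h.locallyIntegrable] with x hx
  rw [h.eq_add 0]
  exact (hx 0).const_add _

/-- Primitives are absolutely continuous and differentiable almost everywhere, which is all the
product rule needs under the integral. -/
theorem integral_mul (h₁ : IsPrimitive f₁ g₁) (h₂ : IsPrimitive f₂ g₂) (a b : ℝ) :
    ∫ x in a..b, (g₁ x * f₂ x + f₁ x * g₂ x) = f₁ b * f₂ b - f₁ a * f₂ a := by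
  rw [← (h₁.absolutelyContinuousOnInterval a b).integral_deriv_mul_eq_sub
    (h₂.absolutelyContinuousOnInterval a b)]
  apply intervalIntegral.integral_congr_ae
  filter_upwards [h₁.ae_hasDerivAt, h₂.ae_hasDerivAt] with x h1 h2 _
  rw [h1.deriv, h2.deriv]

/-- Integration by parts on the whole line. -/
theorem integral_mul_eq_zero (h₁ : IsPrimitive f₁ g₁) (h₂ : IsPrimitive f₂ g₂)
    (i₁ : Integrable (fun x => g₁ x * f₂ x)) (i₂ : Integrable (fun x => f₁ x * g₂ x))
    (hbot : Tendsto (fun x => f₁ x * f₂ x) atBot (𝓝 0))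
    (htop : Tendsto (fun x => f₁ x * f₂ x) atTop (𝓝 0)) :
    (∫ x, g₁ x * f₂ x) = - ∫ x, f₁ x * g₂ x := by
  have h1 := intervalIntegral_tendsto_integral (i₁.add i₂) tendsto_neg_atTop_atBot tendsto_id
  have h2 : Tendsto (fun n : ℝ => ∫ x in (-n)..n, (g₁ x * f₂ x + f₁ x * g₂ x)) atTop (𝓝 (0 - 0)) := by
    simp_rw [h₁.integral_mul h₂]
    exact htop.sub (hbot.comp tendsto_neg_atTop_atBot)
  have h3 := tendsto_nhds_unique h1 h2
  have h4 : (∫ x, (g₁ x * f₂ x + f₁ x * g₂ x)) = 0 := by simpa using h3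
  rw [integral_add i₁ i₂] at h4
  linarith

end IsPrimitive

/-! ### The fundamental lemma of the calculus of variations -/

/-- The du Bois-Reymond argument: test functions of mean zero are exactly the derivatives of test
functions, so `d` is orthogonal to all of them. -/
theorem exists_const_of_integral_deriv_mul_eq_zero {d : ℝ → ℝ} (hd : Continuous d)
    (h : ∀ ψ : ℝ → ℝ, ContDiff ℝ ∞ ψ → HasCompactSupport ψ → ∫ x, deriv ψ x * d x = 0) :
    ∃ C, ∀ x, d x = C := by
  let b : ContDiffBump (0 : ℝ) := ⟨1, 2, by norm_num, by norm_num⟩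
  let ψ₀ : ℝ → ℝ := b.normed volume
  have hψ₀ : ContDiff ℝ ∞ ψ₀ := b.contDiff_normed
  have hψ₀c : HasCompactSupport ψ₀ := b.hasCompactSupport_normed
  have hψ₀i : ∫ x, ψ₀ x = 1 := b.integral_normed
  refine ⟨∫ x, ψ₀ x * d x, ?_⟩
  have key : ∀ ψ : ℝ → ℝ, ContDiff ℝ ∞ ψ → HasCompactSupport ψ → (∫ x, ψ x) = 0 →
      ∫ x, ψ x * d x = 0 := by
    intro ψ hψ hc hi
    obtain ⟨N, hN0, hN⟩ : ∃ N : ℝ, 0 < N ∧ ∀ x, N ≤ |x| → ψ x = 0 := by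
      obtain ⟨N, hN0, hN⟩ := hc.exists_pos_le_norm
      exact ⟨N, hN0, fun x hx => hN x hx⟩
    -- This primitive vanishes to the left of `-N` by construction and to the right of `N` because
    -- `ψ` has mean zero.
    let χ : ℝ → ℝ := fun x => ∫ t in (-N)..x, ψ t
    have hχ : ∀ x, HasDerivAt χ (ψ x) x := fun x =>
      intervalIntegral.integral_hasDerivAt_right (hψ.continuous.intervalIntegrable _ _)
        (hψ.continuous.stronglyMeasurableAtFilter _ _) hψ.continuous.continuousAt
    have hχd : deriv χ = ψ := funext fun x => (hχ x).deriv
    have hχs : ContDiff ℝ ∞ χ := by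
      rw [contDiff_infty_iff_deriv, hχd]
      exact ⟨fun x => (hχ x).differentiableAt, hψ⟩
    have hfull : ∫ t in (-N)..N, ψ t = 0 := by
      rw [← hi]
      apply intervalIntegral.integral_eq_integral_of_support_subset
      intro x hx
      by_contra hx'
      apply hx
      apply hN
      rw [mem_Ioc, not_and_or] at hx'
      rcases hx' with h1 | h1
      · have : x ≤ -N := not_lt.mp h1
        rw [le_abs]; right; linarith
      · rw [le_abs]; left; linarith
    have hχc : HasCompactSupport χ := by
      apply HasCompactSupport.intro (isCompact_Icc (a := -N) (b := N))
      intro x hx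
      rw [mem_Icc, not_and_or, not_le, not_le] at hx
      rcases hx with hx | hx
      · have : ∀ t ∈ uIcc (-N) x, ψ t = 0 := by
          intro t ht
          rw [uIcc_of_ge hx.le, mem_Icc] at ht
          apply hN; rw [le_abs]; right; linarith
        show ∫ t in (-N)..x, ψ t = 0
        rw [intervalIntegral.integral_congr this]; simp
      · have : ∀ t ∈ uIcc N x, ψ t = 0 := by
          intro t ht
          rw [uIcc_of_le hx.le, mem_Icc] at ht
          apply hN; rw [le_abs]; left; linarith
        show ∫ t in (-N)..x, ψ t = 0
        rw [← intervalIntegral.integral_add_adjacent_intervals (b := N)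
          (hψ.continuous.intervalIntegrable _ _) (hψ.continuous.intervalIntegrable _ _), hfull,
          intervalIntegral.integral_congr this]; simp
    have := h χ hχs hχc
    rwa [hχd] at this
  have hae : ∀ᵐ x, d x - ∫ y, ψ₀ y * d y = 0 := by
    apply ae_eq_zero_of_integral_contDiff_smul_eq_zero
      (hd.sub continuous_const).locallyIntegrable
    intro ψ hψ hc
    have i1 : Integrable ψ := hψ.continuous.integrable_of_hasCompactSupport hc
    have i2 : Integrable ψ₀ := hψ₀.continuous.integrable_of_hasCompactSupport hψ₀c
    have i3 : Integrable fun x => ψ x * d x :=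
      (hψ.continuous.mul hd).integrable_of_hasCompactSupport hc.mul_right
    have i4 : Integrable fun x => ψ₀ x * d x :=
      (hψ₀.continuous.mul hd).integrable_of_hasCompactSupport hψ₀c.mul_right
    set m := ∫ x, ψ x with hm
    -- Subtracting `m ψ₀` removes the mean of an arbitrary test function; this is where the
    -- candidate constant `∫ ψ₀ d` comes from.
    have k := key (fun x => ψ x - m * ψ₀ x) (hψ.sub (contDiff_const.mul hψ₀))
      (hc.sub (hψ₀c.mul_left (f := fun _ => m))) (by
        rw [integral_sub i1 (i2.const_mul _), integral_const_mul, hψ₀i]; simp [hm])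
    have e : (fun x => (ψ x - m * ψ₀ x) * d x) = fun x => ψ x * d x - m * (ψ₀ x * d x) := by
      funext x; ring
    rw [e, integral_sub i3 (i4.const_mul _), integral_const_mul] at k
    have e2 : (fun x => ψ x • (d x - ∫ y, ψ₀ y * d y))
        = fun x => ψ x * d x - ψ x * (∫ y, ψ₀ y * d y) := by
      funext x; simp [mul_sub]
    change ∫ x, ψ x • (d x - ∫ y, ψ₀ y * d y) = 0
    rw [e2, integral_sub i3 (i1.mul_const _), integral_mul_const, ← hm]
    exact k
  have h2 : (fun x => d x - ∫ y, ψ₀ y * d y) = fun _ => 0 :=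
    (Continuous.ae_eq_iff_eq volume (hd.sub continuous_const) continuous_const).1 hae
  intro x
  have := congrFun h2 x
  simpa [sub_eq_zero] using this

/-- The difference between `f` and an explicit primitive of `g` has zero weak derivative, hence is
constant. -/
theorem IsPrimitive.of_integral_deriv_mul {f g : ℝ → ℝ} (hf : Continuous f)
    (hg : LocallyIntegrable g volume)
    (h : ∀ ψ : ℝ → ℝ, ContDiff ℝ ∞ ψ → HasCompactSupport ψ →
      ∫ x, deriv ψ x * f x = - ∫ x, ψ x * g x) : IsPrimitive f g := by
  have hG : IsPrimitive (fun x => ∫ t in (0:ℝ)..x, g t) g :=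
    ⟨hg, fun a b => by
      have hi : ∀ a b, IntervalIntegrable g volume a b := fun a b =>
        (hg.integrableOn_isCompact isCompact_uIcc).intervalIntegrable
      rw [intervalIntegral.integral_interval_sub_left (hi _ _) (hi _ _)]⟩
  obtain ⟨C, hC⟩ := exists_const_of_integral_deriv_mul_eq_zero (hf.sub hG.continuous) (by
    intro ψ hψ hc
    have hψ' : Continuous (deriv ψ) := hψ.continuous_deriv (by simp)
    have hψp : IsPrimitive ψ (deriv ψ) := .of_hasDerivAt
      (fun x => (hψ.differentiable (by simp) x).hasDerivAt) hψ'
    have i1 : Integrable fun x => deriv ψ x * f x :=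
      (hψ'.mul hf).integrable_of_hasCompactSupport hc.deriv.mul_right
    have i2 : Integrable fun x => deriv ψ x * ∫ t in (0:ℝ)..x, g t :=
      (hψ'.mul hG.continuous).integrable_of_hasCompactSupport hc.deriv.mul_right
    have i3 : Integrable fun x => ψ x * g x := by
      simpa using hg.integrable_smul_left_of_hasCompactSupport hψ.continuous hc
    have z : ψ =ᶠ[cocompact ℝ] 0 := hasCompactSupport_iff_eventuallyEq.1 hc |>.filter_mono (by
      exact cocompact_le_coclosedCompact)
    have z1 : ∀ᶠ x in atBot, ψ x * (∫ t in (0:ℝ)..x, g t) = 0 :=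
      (z.filter_mono atBot_le_cocompact).mono fun x hx => by simp [hx]
    have z2 : ∀ᶠ x in atTop, ψ x * (∫ t in (0:ℝ)..x, g t) = 0 :=
      (z.filter_mono atTop_le_cocompact).mono fun x hx => by simp [hx]
    have e := hψp.integral_mul_eq_zero hG i2 i3
      (tendsto_const_nhds.congr' (z1.mono fun x hx => hx.symm))
      (tendsto_const_nhds.congr' (z2.mono fun x hx => hx.symm))
    change ∫ x, deriv ψ x * (f x - ∫ t in (0:ℝ)..x, g t) = 0
    simp_rw [mul_sub]
    rw [integral_sub i1 i2, e, h ψ hψ hc]; ring)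
  refine ⟨hg, fun a b => ?_⟩
  have ha := hC a
  have hb := hC b
  have := hG.integral_eq a b
  simp only [Pi.sub_apply] at ha hb this
  linarith

/-! ### Real and imaginary parts, smooth functions and sums under weak derivatives. -/

theorem HasWeakDeriv.isPrimitive_re {f g : ℝ → ℂ} (h : HasWeakDeriv f g) (hf : Continuous f) :
    IsPrimitive (fun x => (f x).re) (fun x => (g x).re) := by
  refine .of_integral_deriv_mul (Complex.continuous_re.comp hf) (fun x => ?_) fun ψ hψ hc => ?_
  · obtain ⟨s, hs, hi⟩ := h.locallyIntegrable_deriv x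
    exact ⟨s, hs, hi.re⟩
  · have e := congrArg Complex.re (h.integral_eq ψ hψ hc)
    have hψ' : Continuous (deriv ψ) := hψ.continuous_deriv (by simp)
    have i1 : Integrable fun x => deriv ψ x • f x :=
      (hψ'.smul hf).integrable_of_hasCompactSupport hc.deriv.smul_right
    have i3 : Integrable fun x => ψ x • g x :=
      h.locallyIntegrable_deriv.integrable_smul_left_of_hasCompactSupport hψ.continuous hc
    have e1 := integral_re i1
    have e3 := integral_re i3
    simp only [RCLike.re_eq_complex_re, Complex.real_smul, Complex.re_ofReal_mul] at e1 e3
    simp only [Complex.real_smul, Complex.neg_re] at e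
    rw [e1, e3, e]

theorem HasWeakDeriv.isPrimitive_im {f g : ℝ → ℂ} (h : HasWeakDeriv f g) (hf : Continuous f) :
    IsPrimitive (fun x => (f x).im) (fun x => (g x).im) := by
  refine .of_integral_deriv_mul (Complex.continuous_im.comp hf) (fun x => ?_) fun ψ hψ hc => ?_
  · obtain ⟨s, hs, hi⟩ := h.locallyIntegrable_deriv x
    exact ⟨s, hs, hi.im⟩
  · have e := congrArg Complex.im (h.integral_eq ψ hψ hc)
    have hψ' : Continuous (deriv ψ) := hψ.continuous_deriv (by simp)
    have i1 : Integrable fun x => deriv ψ x • f x :=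
      (hψ'.smul hf).integrable_of_hasCompactSupport hc.deriv.smul_right
    have i3 : Integrable fun x => ψ x • g x :=
      h.locallyIntegrable_deriv.integrable_smul_left_of_hasCompactSupport hψ.continuous hc
    have e1 := integral_im i1
    have e3 := integral_im i3
    simp only [RCLike.im_eq_complex_im, Complex.real_smul, Complex.im_ofReal_mul] at e1 e3
    simp only [Complex.real_smul, Complex.neg_im] at e
    rw [e1, e3, e]

theorem HasWeakDeriv.of_hasDerivAt {f g : ℝ → ℂ} (h : ∀ x, HasDerivAt f (g x) x)
    (hg : Continuous g) : HasWeakDeriv f g := by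
  have hf : Continuous f := continuous_iff_continuousAt.2 fun x => (h x).continuousAt
  refine ⟨hf.locallyIntegrable, hg.locallyIntegrable, fun ψ hψ hc => ?_⟩
  have hψ' : Continuous (deriv ψ) := hψ.continuous_deriv (by simp)
  have := integral_bilinear_hasDerivAt_right_eq_neg_left_of_integrable
    (L := ContinuousLinearMap.lsmul ℝ ℝ) (u := ψ) (v := f) (u' := deriv ψ) (v' := g)
    (fun x _ => (hψ.differentiable (by simp) x).hasDerivAt) (fun x _ => h x)
    ((hψ.continuous.smul hg).integrable_of_hasCompactSupport hc.smul_right)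
    ((hψ'.smul hf).integrable_of_hasCompactSupport hc.deriv.smul_right)
    ((hψ.continuous.smul hf).integrable_of_hasCompactSupport hc.smul_right)
  simp only [ContinuousLinearMap.lsmul_apply] at this
  rw [this, neg_neg]

theorem HasWeakDeriv.add {f₁ g₁ f₂ g₂ : ℝ → ℂ} (h₁ : HasWeakDeriv f₁ g₁)
    (h₂ : HasWeakDeriv f₂ g₂) (c₁ : Continuous f₁) (c₂ : Continuous f₂) :
    HasWeakDeriv (fun x => f₁ x + f₂ x) (fun x => g₁ x + g₂ x) := by
  refine ⟨h₁.locallyIntegrable.add h₂.locallyIntegrable,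
    h₁.locallyIntegrable_deriv.add h₂.locallyIntegrable_deriv, fun ψ hψ hc => ?_⟩
  have hψ' : Continuous (deriv ψ) := hψ.continuous_deriv (by simp)
  have a₁ : Integrable fun x => deriv ψ x • f₁ x :=
    (hψ'.smul c₁).integrable_of_hasCompactSupport hc.deriv.smul_right
  have a₂ : Integrable fun x => deriv ψ x • f₂ x :=
    (hψ'.smul c₂).integrable_of_hasCompactSupport hc.deriv.smul_right
  have b₁ : Integrable fun x => ψ x • g₁ x :=
    h₁.locallyIntegrable_deriv.integrable_smul_left_of_hasCompactSupport hψ.continuous hc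
  have b₂ : Integrable fun x => ψ x • g₂ x :=
    h₂.locallyIntegrable_deriv.integrable_smul_left_of_hasCompactSupport hψ.continuous hc
  simp_rw [smul_add]
  rw [integral_add a₁ a₂, integral_add b₁ b₂,
    h₁.integral_eq ψ hψ hc, h₂.integral_eq ψ hψ hc, neg_add]

/-! ### The function `1 - tanh²` -/

theorem tanh_sq_lt_one (x : ℝ) : Real.tanh x ^ 2 < 1 := by
  have hc := Real.cosh_pos x
  rw [Real.tanh_eq_sinh_div_cosh, div_pow, div_lt_one (by positivity)]
  linarith [Real.cosh_sq x]

theorem hasDerivAt_tanh (x : ℝ) : HasDerivAt Real.tanh (1 - Real.tanh x ^ 2) x := by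
  have hc := (Real.cosh_pos x).ne'
  have h := (Real.hasDerivAt_sinh x).div (Real.hasDerivAt_cosh x) hc
  have e : Real.tanh = Real.sinh / Real.cosh := by
    funext y; rw [Real.tanh_eq_sinh_div_cosh]; rfl
  refine HasDerivAt.congr_deriv (e ▸ h) ?_
  rw [Real.tanh_eq_sinh_div_cosh]
  field_simp

theorem continuous_tanh : Continuous Real.tanh :=
  continuous_iff_continuousAt.2 fun x => (hasDerivAt_tanh x).continuousAt

/-- The square of the hyperbolic secant. -/
noncomputable def sechSq (x : ℝ) : ℝ := 1 - Real.tanh x ^ 2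

theorem sechSq_pos (x : ℝ) : 0 < sechSq x := sub_pos.2 (tanh_sq_lt_one x)

theorem sechSq_le_one (x : ℝ) : sechSq x ≤ 1 := by
  rw [sechSq]; linarith [sq_nonneg (Real.tanh x)]

theorem sechSq_eq (x : ℝ) : sechSq x = (Real.cosh x ^ 2)⁻¹ := by
  have hc := (Real.cosh_pos x).ne'
  rw [sechSq, Real.tanh_eq_sinh_div_cosh]
  field_simp
  linarith [Real.cosh_sq x]

theorem continuous_sechSq : Continuous sechSq :=
  continuous_const.sub (continuous_tanh.pow 2)

theorem hasDerivAt_sechSq (x : ℝ) : HasDerivAt sechSq (-2 * Real.tanh x * sechSq x) x := by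
  have h := ((hasDerivAt_tanh x).pow 2).const_sub 1
  refine HasDerivAt.congr_deriv h ?_
  rw [sechSq]; ring

theorem sechSq_neg (x : ℝ) : sechSq (-x) = sechSq x := by
  rw [sechSq, sechSq, Real.tanh_neg, neg_sq]

theorem sechSq_le_exp (x : ℝ) : sechSq x ≤ 4 * Real.exp (-2 * |x|) := by
  have hc : Real.exp |x| / 2 ≤ Real.cosh x := by
    rw [← Real.cosh_abs, Real.cosh_eq]
    linarith [Real.exp_pos (-|x|)]
  have he := Real.exp_pos |x|
  rw [sechSq_eq, show -2 * |x| = -|x| + -|x| by ring, Real.exp_add, Real.exp_neg]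
  have : (Real.exp |x| / 2) ^ 2 ≤ Real.cosh x ^ 2 := pow_le_pow_left₀ (by positivity) hc 2
  calc (Real.cosh x ^ 2)⁻¹ ≤ ((Real.exp |x| / 2) ^ 2)⁻¹ := inv_anti₀ (by positivity) this
    _ = _ := by field_simp; norm_num

/-- A rational weight dominating the exponentially decaying functions below. -/
noncomputable def ratWeight (x : ℝ) : ℝ := ((1 + x ^ 2) ^ 2)⁻¹

theorem ratWeight_pos (x : ℝ) : 0 < ratWeight x := by rw [ratWeight]; positivity

theorem ratWeight_le_one (x : ℝ) : ratWeight x ≤ 1 := by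
  rw [ratWeight]
  exact inv_le_one_of_one_le₀ (one_le_pow₀ (by linarith [sq_nonneg x]))

theorem continuous_ratWeight : Continuous ratWeight := by
  unfold ratWeight
  exact Continuous.inv₀ (by fun_prop) fun x => by positivity

theorem integrable_one_add_sq_mul_ratWeight : Integrable fun x : ℝ => (1 + x ^ 2) * ratWeight x := by
  refine integrable_inv_one_add_sq.congr (.of_forall fun x => ?_)
  have : (1 + x ^ 2) ≠ 0 := by positivity
  simp only [ratWeight]
  field_simp

theorem integrable_ratWeight : Integrable ratWeight := by
  refine integrable_one_add_sq_mul_ratWeight.mono' continuous_ratWeight.aestronglyMeasurable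
    (.of_forall fun x => ?_)
  rw [Real.norm_of_nonneg (ratWeight_pos x).le]
  nlinarith [ratWeight_pos x, sq_nonneg x]

/-- The fourth power of `1 + |x|/2 ≤ e^{|x|/2}` makes `e^{2|x|}` dominate `(1 + x²)²/16`; with the
factor 4 of `sechSq_le_exp` this gives 64. -/
theorem sechSq_le_ratWeight (x : ℝ) : sechSq x ≤ 64 * ratWeight x := by
  have h1 : 1 + |x| / 2 ≤ Real.exp (|x| / 2) := by linarith [Real.add_one_le_exp (|x| / 2)]
  have h2 : (1 + |x| / 2) ^ 4 ≤ Real.exp (2 * |x|) := by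
    calc (1 + |x| / 2) ^ 4 ≤ Real.exp (|x| / 2) ^ 4 := pow_le_pow_left₀ (by positivity) h1 4
      _ = _ := by rw [← Real.exp_nat_mul]; congr 1; push_cast; ring
  have h3 : (1 + x ^ 2) ^ 2 / 16 ≤ (1 + |x| / 2) ^ 4 := by
    have h4 : (1 + x ^ 2) / 4 ≤ (1 + |x| / 2) ^ 2 := by
      have := abs_nonneg x
      nlinarith [sq_abs x]
    calc (1 + x ^ 2) ^ 2 / 16 = ((1 + x ^ 2) / 4) ^ 2 := by ring
      _ ≤ ((1 + |x| / 2) ^ 2) ^ 2 := pow_le_pow_left₀ (by positivity) h4 2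
      _ = _ := by ring
  refine (sechSq_le_exp x).trans ?_
  rw [show -2 * |x| = -(2 * |x|) by ring, Real.exp_neg, ratWeight]
  calc 4 * (Real.exp (2 * |x|))⁻¹ ≤ 4 * ((1 + x ^ 2) ^ 2 / 16)⁻¹ := by
        gcongr
        exact h3.trans h2
    _ = _ := by field_simp; norm_num

theorem one_add_abs_le (x : ℝ) : 1 + |x| ≤ 2 * (1 + x ^ 2) := by
  nlinarith [sq_abs x, sq_nonneg (|x| - 1)]

/-- Continuous functions dominated by `(1 + x²) ratWeight` are integrable. -/
theorem integrable_of_le_ratWeight {f : ℝ → ℝ} (hf : AEStronglyMeasurable f volume) {C : ℝ}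
    (h : ∀ x, |f x| ≤ C * ((1 + x ^ 2) * ratWeight x)) : Integrable f :=
  (integrable_one_add_sq_mul_ratWeight.const_mul C).mono' hf (.of_forall h)

theorem integrable_sechSq : Integrable sechSq := by
  refine (integrable_ratWeight.const_mul 64).mono' continuous_sechSq.aestronglyMeasurable
    (.of_forall fun x => ?_)
  rw [Real.norm_of_nonneg (sechSq_pos x).le]
  exact sechSq_le_ratWeight x

theorem integrable_abs_mul_sechSq : Integrable fun x => |x| * sechSq x := by
  refine integrable_of_le_ratWeight (C := 128)
    (continuous_abs.mul continuous_sechSq).aestronglyMeasurable fun x => ?_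
  rw [abs_mul, abs_abs, abs_of_pos (sechSq_pos x)]
  calc |x| * sechSq x ≤ (2 * (1 + x ^ 2)) * (64 * ratWeight x) :=
        mul_le_mul (by linarith [one_add_abs_le x]) (sechSq_le_ratWeight x) (sechSq_pos x).le
          (by positivity)
    _ = _ := by ring

theorem tendsto_sechSq_atTop : Tendsto sechSq atTop (𝓝 0) := by
  have h : Tendsto (fun x : ℝ => 4 * Real.exp (-2 * |x|)) atTop (𝓝 (4 * 0)) := by
    refine (Real.tendsto_exp_atBot.comp ?_).const_mul 4
    exact tendsto_abs_atTop_atTop.const_mul_atTop_of_neg (by norm_num)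
  rw [mul_zero] at h
  exact squeeze_zero (fun x => (sechSq_pos x).le) sechSq_le_exp h

theorem tendsto_abs_mul_sechSq_atTop : Tendsto (fun x => |x| * sechSq x) atTop (𝓝 0) := by
  have h : Tendsto (fun x : ℝ => 128 * (1 + x ^ 2)⁻¹) atTop (𝓝 (128 * 0)) := by
    refine Tendsto.const_mul 128 (tendsto_inv_atTop_zero.comp ?_)
    exact tendsto_atTop_add_const_left _ _ (tendsto_pow_atTop (by norm_num))
  rw [mul_zero] at h
  refine squeeze_zero (fun x => mul_nonneg (abs_nonneg x) (sechSq_pos x).le) (fun x => ?_) h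
  have := sechSq_le_ratWeight x
  calc |x| * sechSq x ≤ (2 * (1 + x ^ 2)) * (64 * ratWeight x) :=
        mul_le_mul (by linarith [one_add_abs_le x]) (sechSq_le_ratWeight x) (sechSq_pos x).le
          (by positivity)
    _ = 128 * (1 + x ^ 2)⁻¹ := by
      have : (1 + x ^ 2) ≠ 0 := by positivity
      rw [ratWeight]; field_simp; norm_num

theorem tendsto_tanh_atTop : Tendsto Real.tanh atTop (𝓝 1) := by
  have h : Tendsto (fun x => √(1 - sechSq x)) atTop (𝓝 √(1 - 0)) :=
    (Real.continuous_sqrt.tendsto _).comp (tendsto_sechSq_atTop.const_sub 1)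
  rw [sub_zero, Real.sqrt_one] at h
  refine h.congr' ?_
  filter_upwards [eventually_ge_atTop 0] with x hx
  have h0 : 0 ≤ Real.tanh x := by
    rw [Real.tanh_eq_sinh_div_cosh]
    exact div_nonneg (Real.sinh_nonneg_iff.2 hx) (Real.cosh_pos x).le
  rw [sechSq, sub_sub_cancel, Real.sqrt_sq h0]

theorem tanh_nonneg {x : ℝ} (hx : 0 ≤ x) : 0 ≤ Real.tanh x := by
  rw [Real.tanh_eq_sinh_div_cosh]
  exact div_nonneg (Real.sinh_nonneg_iff.2 hx) (Real.cosh_pos x).le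

/-- The integral equals `1 - tanh x`, and `1 - t ≤ 1 - t²` on `[0, 1]`. -/
theorem integral_Ioi_sechSq_le {x : ℝ} (hx : 0 ≤ x) : ∫ t in Ioi x, sechSq t ≤ sechSq x := by
  rw [integral_Ioi_of_hasDerivAt_of_tendsto' (f := Real.tanh) (f' := sechSq)
    (fun t _ => hasDerivAt_tanh t)
    integrable_sechSq.integrableOn tendsto_tanh_atTop, sechSq]
  have h0 := tanh_nonneg hx
  have h1 := tanh_sq_lt_one x
  nlinarith

/-! ### The black soliton -/

theorem eta_zero (x : ℝ) : eta 0 x = 1 - blackSoliton x ^ 4 := by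
  rw [eta, darkProfile, if_pos rfl, Complex.norm_real, Real.norm_eq_abs, Even.pow_abs (by decide)]

/-- The derivative of the black soliton. -/
noncomputable def blackSolitonDeriv (x : ℝ) : ℝ :=
  3 * √2 * (sechSq x / √(3 - Real.tanh x ^ 2) ^ 3)

theorem two_lt_three_sub_tanh_sq (x : ℝ) : 2 < 3 - Real.tanh x ^ 2 := by
  linarith [tanh_sq_lt_one x]

theorem sqrt_three_sub_pos (x : ℝ) : 0 < √(3 - Real.tanh x ^ 2) :=
  Real.sqrt_pos.2 (by linarith [two_lt_three_sub_tanh_sq x])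

theorem sq_sqrt_three_sub (x : ℝ) : √(3 - Real.tanh x ^ 2) ^ 2 = 3 - Real.tanh x ^ 2 :=
  Real.sq_sqrt (by linarith [two_lt_three_sub_tanh_sq x])

theorem blackSoliton_sq (x : ℝ) :
    blackSoliton x ^ 2 = 2 * Real.tanh x ^ 2 / (3 - Real.tanh x ^ 2) := by
  rw [blackSoliton, mul_pow, div_pow, sq_sqrt_three_sub, Real.sq_sqrt (by norm_num)]
  ring

theorem eta_zero_eq (x : ℝ) :
    eta 0 x = 3 * sechSq x * (3 + Real.tanh x ^ 2) / (3 - Real.tanh x ^ 2) ^ 2 := by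
  have h := two_lt_three_sub_tanh_sq x
  rw [eta_zero, show blackSoliton x ^ 4 = (blackSoliton x ^ 2) ^ 2 by ring, blackSoliton_sq, sechSq]
  have : 3 - Real.tanh x ^ 2 ≠ 0 := by linarith
  field_simp
  ring

/-- With `eta_zero_le`, this makes the weight comparable to `sechSq`, so that decay is tracked on
the latter throughout. -/
theorem sechSq_le_eta_zero (x : ℝ) : sechSq x ≤ eta 0 x := by
  have h := two_lt_three_sub_tanh_sq x
  have hs := sechSq_pos x
  have ht := sq_nonneg (Real.tanh x)
  rw [eta_zero_eq, le_div_iff₀ (by positivity)]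
  have : (3 - Real.tanh x ^ 2) ^ 2 ≤ 3 * (3 + Real.tanh x ^ 2) := by nlinarith
  nlinarith

theorem eta_zero_le (x : ℝ) : eta 0 x ≤ 3 * sechSq x := by
  have h := two_lt_three_sub_tanh_sq x
  have hs := sechSq_pos x
  have ht := sq_nonneg (Real.tanh x)
  rw [eta_zero_eq, div_le_iff₀ (by positivity)]
  have : 3 + Real.tanh x ^ 2 ≤ (3 - Real.tanh x ^ 2) ^ 2 := by nlinarith
  nlinarith

theorem eta_zero_pos (x : ℝ) : 0 < eta 0 x := (sechSq_pos x).trans_le (sechSq_le_eta_zero x)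

theorem blackSoliton_sq_le_one (x : ℝ) : blackSoliton x ^ 2 ≤ 1 := by
  have h := two_lt_three_sub_tanh_sq x
  rw [blackSoliton_sq, div_le_one (by linarith)]
  linarith

theorem abs_blackSoliton_le_one (x : ℝ) : |blackSoliton x| ≤ 1 :=
  abs_le_one_iff_mul_self_le_one.2 (by linarith [blackSoliton_sq_le_one x])

theorem eta_zero_le_one (x : ℝ) : eta 0 x ≤ 1 := by
  rw [eta_zero]; linarith [sq_nonneg (blackSoliton x ^ 2)]

theorem hasDerivAt_sqrt_three_sub (x : ℝ) : HasDerivAt (fun y => √(3 - Real.tanh y ^ 2))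
    (-(Real.tanh x * sechSq x) / √(3 - Real.tanh x ^ 2)) x := by
  have h := (((hasDerivAt_tanh x).pow 2).const_sub 3).sqrt
    (by simp only [Pi.pow_apply]; linarith [two_lt_three_sub_tanh_sq x])
  refine HasDerivAt.congr_deriv h ?_
  have := sqrt_three_sub_pos x
  simp only [Pi.pow_apply, sechSq]
  field_simp
  ring

theorem hasDerivAt_blackSoliton (x : ℝ) : HasDerivAt blackSoliton (blackSolitonDeriv x) x := by
  have hD := sqrt_three_sub_pos x
  have hD2 := sq_sqrt_three_sub x
  have h := ((hasDerivAt_tanh x).div (hasDerivAt_sqrt_three_sub x) hD.ne').const_mul √2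
  refine HasDerivAt.congr_deriv h ?_
  rw [blackSolitonDeriv]
  generalize √(3 - Real.tanh x ^ 2) = D at *
  have hs : 1 - Real.tanh x ^ 2 = sechSq x := rfl
  rw [hs]
  have : sechSq x * D - Real.tanh x * (-(Real.tanh x * sechSq x) / D) = 3 * sechSq x / D := by
    field_simp; linear_combination sechSq x * hD2
  rw [this]; field_simp

/-- The soliton equation. It removes the linear term of the energy expansion and makes
`blackSoliton` a kernel direction of the quadratic form. -/
theorem hasDerivAt_blackSolitonDeriv (x : ℝ) :
    HasDerivAt blackSolitonDeriv (-(eta 0 x * blackSoliton x)) x := by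
  have hD := sqrt_three_sub_pos x
  have hD2 := sq_sqrt_three_sub x
  have h := ((hasDerivAt_sechSq x).div ((hasDerivAt_sqrt_three_sub x).pow 3)
    (pow_ne_zero 3 hD.ne')).const_mul (3 * √2)
  refine HasDerivAt.congr_deriv h ?_
  rw [eta_zero_eq, blackSoliton]
  simp only [Pi.pow_apply]
  generalize √(3 - Real.tanh x ^ 2) = D at *
  have hs : sechSq x = 1 - Real.tanh x ^ 2 := rfl
  have hT : Real.tanh x ^ 2 = 3 - D ^ 2 := by linarith
  rw [← hD2, hs]
  field_simp
  push_cast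
  norm_num
  rw [hT]
  ring

theorem continuous_blackSoliton : Continuous blackSoliton :=
  continuous_iff_continuousAt.2 fun x => (hasDerivAt_blackSoliton x).continuousAt

theorem continuous_blackSolitonDeriv : Continuous blackSolitonDeriv :=
  continuous_iff_continuousAt.2 fun x => (hasDerivAt_blackSolitonDeriv x).continuousAt

theorem continuous_eta_zero : Continuous (eta 0) := by
  rw [show eta 0 = fun x => 1 - blackSoliton x ^ 4 from funext eta_zero]
  exact continuous_const.sub (continuous_blackSoliton.pow 4)

theorem blackSolitonDeriv_pos (x : ℝ) : 0 < blackSolitonDeriv x := by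
  have := sqrt_three_sub_pos x
  have := sechSq_pos x
  rw [blackSolitonDeriv]; positivity

theorem blackSolitonDeriv_sq (x : ℝ) :
    blackSolitonDeriv x ^ 2 = 18 * sechSq x ^ 2 / (3 - Real.tanh x ^ 2) ^ 3 := by
  rw [blackSolitonDeriv, mul_pow, mul_pow, div_pow, Real.sq_sqrt (by norm_num),
    show (√(3 - Real.tanh x ^ 2) ^ 3) ^ 2 = (√(3 - Real.tanh x ^ 2) ^ 2) ^ 3 by ring,
    sq_sqrt_three_sub]
  ring

/-- The first integral of the equation of the black soliton. -/
theorem blackSolitonDeriv_sq_eq (x : ℝ) : blackSolitonDeriv x ^ 2 =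
    1 / 3 * (1 - blackSoliton x ^ 2) ^ 2 * (2 + blackSoliton x ^ 2) := by
  have h := two_lt_three_sub_tanh_sq x
  have : 3 - Real.tanh x ^ 2 ≠ 0 := by linarith
  rw [blackSolitonDeriv_sq, blackSoliton_sq, sechSq]
  field_simp
  ring

theorem blackSolitonDeriv_le (x : ℝ) : blackSolitonDeriv x ≤ 3 / 2 * sechSq x := by
  have h := two_lt_three_sub_tanh_sq x
  have hs := sechSq_pos x
  refine le_of_sq_le_sq ?_ (by positivity)
  rw [blackSolitonDeriv_sq, div_le_iff₀ (by positivity)]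
  have : (2:ℝ) ^ 3 ≤ (3 - Real.tanh x ^ 2) ^ 3 := pow_le_pow_left₀ (by norm_num) h.le 3
  nlinarith [sq_nonneg (sechSq x)]

theorem le_blackSolitonDeriv (x : ℝ) : 4 / 5 * sechSq x ≤ blackSolitonDeriv x := by
  have h := two_lt_three_sub_tanh_sq x
  have hs := sechSq_pos x
  refine le_of_sq_le_sq ?_ (blackSolitonDeriv_pos x).le
  rw [blackSolitonDeriv_sq, le_div_iff₀ (by positivity)]
  have : (3 - Real.tanh x ^ 2) ^ 3 ≤ 3 ^ 3 :=
    pow_le_pow_left₀ (by linarith) (by linarith [sq_nonneg (Real.tanh x)]) 3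
  nlinarith [sq_nonneg (sechSq x)]

theorem blackSoliton_neg (x : ℝ) : blackSoliton (-x) = -blackSoliton x := by
  rw [blackSoliton, blackSoliton, Real.tanh_neg, neg_sq]; ring

theorem eta_zero_neg (x : ℝ) : eta 0 (-x) = eta 0 x := by
  rw [eta_zero, eta_zero, blackSoliton_neg, Even.neg_pow (by decide)]

/-- Products of `eta 0` with bounded continuous functions are integrable. -/
theorem integrable_eta_zero_mul {f : ℝ → ℝ} (hf : Continuous f) {C : ℝ} (h : ∀ x, |f x| ≤ C) :
    Integrable fun x => eta 0 x * f x := by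
  refine (integrable_sechSq.const_mul (3 * C)).mono'
    (continuous_eta_zero.mul hf).aestronglyMeasurable (.of_forall fun x => ?_)
  rw [norm_mul, Real.norm_of_nonneg (eta_zero_pos x).le, Real.norm_eq_abs]
  calc eta 0 x * |f x| ≤ (3 * sechSq x) * C :=
        mul_le_mul (eta_zero_le x) (h x) (abs_nonneg _) (by linarith [sechSq_pos x])
    _ = _ := by ring

theorem integrable_eta_zero : Integrable (eta 0) := by
  simpa using integrable_eta_zero_mul (f := fun _ => 1) continuous_const (C := 1) (by simp)

theorem abs_blackSoliton_pow_le_one (n : ℕ) (x : ℝ) : |blackSoliton x ^ n| ≤ 1 := by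
  rw [abs_pow]; exact pow_le_one₀ (abs_nonneg _) (abs_blackSoliton_le_one x)

theorem integrable_eta_zero_mul_pow (n : ℕ) : Integrable fun x => eta 0 x * blackSoliton x ^ n :=
  integrable_eta_zero_mul (continuous_blackSoliton.pow n) (abs_blackSoliton_pow_le_one n)

theorem integral_pos_of_continuous {f : ℝ → ℝ} (hf : Continuous f) (hi : Integrable f)
    (h0 : ∀ x, 0 ≤ f x) {a : ℝ} (ha : 0 < f a) : 0 < ∫ x, f x := by
  refine (integral_nonneg h0).lt_of_ne fun h => ?_
  have h1 := (integral_eq_zero_iff_of_nonneg h0 hi).1 h.symm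
  have h2 := (Continuous.ae_eq_iff_eq volume hf continuous_const).1 h1
  exact ha.ne' (congrFun h2 a)

theorem tanh_one_pos : 0 < Real.tanh 1 := by
  rw [Real.tanh_eq_sinh_div_cosh]
  exact div_pos (Real.sinh_pos_iff.2 one_pos) (Real.cosh_pos 1)

theorem blackSoliton_one_pos : 0 < blackSoliton 1 := by
  have := tanh_one_pos
  have := sqrt_three_sub_pos 1
  rw [blackSoliton]; positivity

theorem integral_eta_zero_pos : 0 < ∫ x, eta 0 x :=
  integral_pos_of_continuous continuous_eta_zero integrable_eta_zero (fun x => (eta_zero_pos x).le)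
    (eta_zero_pos 0)

theorem integral_eta_zero_mul_even_pow_pos (n : ℕ) :
    0 < ∫ x, eta 0 x * blackSoliton x ^ (2 * n) :=
  integral_pos_of_continuous (continuous_eta_zero.mul (continuous_blackSoliton.pow _))
    (integrable_eta_zero_mul_pow _)
    (fun x => mul_nonneg (eta_zero_pos x).le (by rw [pow_mul]; positivity))
    (a := 1) (mul_pos (eta_zero_pos 1) (pow_pos blackSoliton_one_pos _))

theorem integral_eta_zero_mul_blackSoliton : ∫ x, eta 0 x * blackSoliton x = 0 := by
  have h := integral_neg_eq_self (fun x => eta 0 x * blackSoliton x) volume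
  simp_rw [eta_zero_neg, blackSoliton_neg, mul_neg] at h
  rw [integral_neg] at h
  linarith

/-! ### The real energy space -/

/-- Cauchy–Schwarz for the pair `√w` and `√w f`. -/
theorem sq_integral_weight_le {μ : Measure ℝ} {w f : ℝ → ℝ} (hw0 : ∀ x, 0 ≤ w x)
    (hw : Integrable w μ) (hf : AEStronglyMeasurable f μ)
    (hwf : Integrable (fun x => w x * f x ^ 2) μ) :
    Integrable (fun x => w x * f x) μ ∧
      (∫ x, w x * f x ∂μ) ^ 2 ≤ (∫ x, w x ∂μ) * ∫ x, w x * f x ^ 2 ∂μ := by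
  have hs : ∀ x, √(w x) * √(w x) = w x := fun x => Real.mul_self_sqrt (hw0 x)
  have hm : AEStronglyMeasurable (fun x => √(w x)) μ :=
    Real.continuous_sqrt.comp_aestronglyMeasurable hw.aestronglyMeasurable
  have h1 : MemLp (fun x => √(w x)) 2 μ :=
    (memLp_two_iff_integrable_sq hm).2 (by simpa only [sq, hs] using hw)
  have h2 : MemLp (fun x => √(w x) * f x) 2 μ := by
    refine (memLp_two_iff_integrable_sq (hm.mul hf)).2 (hwf.congr (.of_forall fun x => ?_))
    simp only [Pi.mul_apply, mul_pow, sq (√(w x)), hs]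
  have e1 : (fun x => √(w x) * (√(w x) * f x)) = fun x => w x * f x := by
    funext x; rw [← mul_assoc, hs]
  have e2 : (fun x => (√(w x) * f x) ^ 2) = fun x => w x * f x ^ 2 := by
    funext x; rw [mul_pow, sq (√(w x)), hs]
  have e3 : (fun x => √(w x) ^ 2) = w := by
    funext x; rw [sq, hs]
  have hi : Integrable (fun x => √(w x) * (√(w x) * f x)) μ := h1.integrable_mul h2
  have h := sq_integral_mul_le h1 h2
  rw [e1, e2, e3] at h
  rw [e1] at hi
  exact ⟨hi, h⟩

/-- `f` is a real function in the energy space of the black soliton, with derivative `g`. -/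
structure InEnergySpace (f g : ℝ → ℝ) : Prop where
  isPrimitive : IsPrimitive f g
  memLp : MemLp g 2 volume
  integrable : Integrable fun x => eta 0 x * f x ^ 2

/-- The squared norm of the energy space. -/
noncomputable def energyNormSq (f g : ℝ → ℝ) : ℝ := (∫ x, g x ^ 2) + ∫ x, eta 0 x * f x ^ 2

theorem energyNormSq_nonneg (f g : ℝ → ℝ) : 0 ≤ energyNormSq f g :=
  add_nonneg (integral_nonneg fun _ => sq_nonneg _)
    (integral_nonneg fun x => mul_nonneg (eta_zero_pos x).le (sq_nonneg _))

theorem integral_eta_sq_nonneg (f : ℝ → ℝ) : 0 ≤ ∫ x, eta 0 x * f x ^ 2 :=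
  integral_nonneg fun x => mul_nonneg (eta_zero_pos x).le (sq_nonneg _)

/-- Cauchy–Schwarz on the interval between the two points: the Hölder-1/2 bound of one-dimensional
Sobolev functions. -/
theorem IsPrimitive.sq_sub_le {f g : ℝ → ℝ} (h : IsPrimitive f g) (hg : MemLp g 2 volume)
    (x y : ℝ) : (f x - f y) ^ 2 ≤ |x - y| * ∫ t, g t ^ 2 := by
  wlog hxy : y ≤ x generalizing x y
  · rw [abs_sub_comm, ← neg_sub, neg_sq]
    exact this y x (le_of_not_ge hxy)
  have hg' : MemLp g 2 (volume.restrict (Ioc y x)) := hg.restrict _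
  have h1 : MemLp (fun _ : ℝ => (1 : ℝ)) 2 (volume.restrict (Ioc y x)) := memLp_const 1
  have h2 := sq_integral_mul_le h1 hg'
  simp only [one_mul, one_pow] at h2
  rw [← h.integral_eq y x, intervalIntegral.integral_of_le hxy, abs_of_nonneg (by linarith)]
  refine h2.trans ?_
  have e : ∫ _ in Ioc y x, (1 : ℝ) = x - y := by simp [hxy]
  rw [e]
  exact mul_le_mul_of_nonneg_left
    (setIntegral_le_integral hg.integrable_sq (.of_forall fun t => sq_nonneg _)) (by linarith)

/-- Functions in the energy space grow at most like a square root. -/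
theorem exists_sq_le_energyNormSq : ∃ C : ℝ, 0 < C ∧ ∀ f g : ℝ → ℝ, InEnergySpace f g →
    ∀ x, f x ^ 2 ≤ C * (1 + |x|) * energyNormSq f g := by
  set M := ∫ x, eta 0 x with hM
  have hMpos : 0 < M := integral_eta_zero_pos
  have hi : Integrable fun x => eta 0 x * |x| := by
    refine (integrable_abs_mul_sechSq.const_mul 3).mono'
      (continuous_eta_zero.mul continuous_abs).aestronglyMeasurable (.of_forall fun x => ?_)
    rw [norm_mul, Real.norm_of_nonneg (eta_zero_pos x).le, Real.norm_eq_abs, abs_abs]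
    nlinarith [eta_zero_le x, abs_nonneg x]
  set K := ∫ x, eta 0 x * |x| with hK
  have hK0 : 0 ≤ K := integral_nonneg fun x => mul_nonneg (eta_zero_pos x).le (abs_nonneg _)
  refine ⟨2 + 4 * (1 + K) / M, by positivity, fun f g h x => ?_⟩
  set G := ∫ t, g t ^ 2 with hG
  set A := ∫ t, eta 0 t * f t ^ 2 with hA
  have hG0 : 0 ≤ G := integral_nonneg fun _ => sq_nonneg _
  have hA0 : 0 ≤ A := integral_eta_sq_nonneg f
  have h0 : M * f 0 ^ 2 ≤ 2 * A + 2 * K * G := by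
    -- The value at the origin is compared with an average against `eta 0`; the price `|y|` of
    -- moving from `0` to `y` is integrable for this weight.
    have h1 : ∀ y, eta 0 y * f 0 ^ 2 ≤ 2 * (eta 0 y * f y ^ 2) + 2 * G * (eta 0 y * |y|) := by
      intro y
      have h2 := h.isPrimitive.sq_sub_le h.memLp 0 y
      rw [zero_sub, abs_neg] at h2
      have h3 : f 0 ^ 2 ≤ 2 * f y ^ 2 + 2 * (|y| * G) := by nlinarith [sq_nonneg (f 0 - 2 * f y)]
      nlinarith [eta_zero_pos y]
    have h4 := integral_mono (integrable_eta_zero.mul_const (f 0 ^ 2))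
      ((h.integrable.const_mul 2).add (hi.const_mul (2 * G))) h1
    simp only [Pi.add_apply] at h4
    rw [integral_mul_const, integral_lin2 h.integrable hi] at h4
    linarith
  have h1 := h.isPrimitive.sq_sub_le h.memLp x 0
  rw [sub_zero] at h1
  have h2 : f x ^ 2 ≤ 2 * f 0 ^ 2 + 2 * (|x| * G) := by nlinarith [sq_nonneg (f x - 2 * f 0)]
  have h3 : f 0 ^ 2 ≤ 2 * (1 + K) / M * (G + A) := by
    rw [div_mul_eq_mul_div, le_div_iff₀ hMpos]
    nlinarith [mul_nonneg hK0 hA0]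
  have hx := abs_nonneg x
  have e : energyNormSq f g = G + A := rfl
  rw [e]
  have h5 : 0 ≤ 2 * (1 + K) / M := by positivity
  have h6 : 0 ≤ 2 * (1 + K) / M * (G + A) := by positivity
  have h7 : 2 + 4 * (1 + K) / M = 2 + 2 * (2 * (1 + K) / M) := by ring
  rw [h7]
  generalize 2 * (1 + K) / M = B at *
  nlinarith [mul_nonneg hx h6, mul_nonneg hx hA0]

namespace InEnergySpace

variable {f g : ℝ → ℝ}

theorem continuous (h : InEnergySpace f g) : Continuous f := h.isPrimitive.continuous

theorem integrable_mul (h : InEnergySpace f g) : Integrable fun x => eta 0 x * f x :=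
  (sq_integral_weight_le (fun x => (eta_zero_pos x).le) integrable_eta_zero
    h.continuous.aestronglyMeasurable h.integrable).1

theorem integrable_mul_mul (h : InEnergySpace f g) {b : ℝ → ℝ} (hb : Continuous b) {C : ℝ}
    (hC : ∀ x, |b x| ≤ C) : Integrable fun x => eta 0 x * (b x * f x) := by
  refine (h.integrable_mul.norm.const_mul C).mono'
    (continuous_eta_zero.mul (hb.mul h.continuous)).aestronglyMeasurable (.of_forall fun x => ?_)
  rw [norm_mul, norm_mul, norm_mul]
  have := hC x
  rw [← Real.norm_eq_abs] at this
  calc ‖eta 0 x‖ * (‖b x‖ * ‖f x‖) = ‖b x‖ * (‖eta 0 x‖ * ‖f x‖) := by ring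
    _ ≤ _ := mul_le_mul_of_nonneg_right this (by positivity)

theorem add {f₁ g₁ f₂ g₂ : ℝ → ℝ} (h₁ : InEnergySpace f₁ g₁) (h₂ : InEnergySpace f₂ g₂) :
    InEnergySpace (fun x => f₁ x + f₂ x) (fun x => g₁ x + g₂ x) where
  isPrimitive := h₁.isPrimitive.add h₂.isPrimitive
  memLp := h₁.memLp.add h₂.memLp
  integrable := by
    refine ((h₁.integrable.const_mul 2).add (h₂.integrable.const_mul 2)).mono'
      (continuous_eta_zero.mul ((h₁.continuous.add h₂.continuous).pow 2)).aestronglyMeasurable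
      (.of_forall fun x => ?_)
    have := (eta_zero_pos x).le
    rw [Real.norm_of_nonneg (by positivity)]
    simp only [Pi.add_apply]
    nlinarith [mul_nonneg this (sq_nonneg (f₁ x - f₂ x))]

theorem const_mul (h : InEnergySpace f g) (c : ℝ) :
    InEnergySpace (fun x => c * f x) (fun x => c * g x) where
  isPrimitive := h.isPrimitive.const_mul c
  memLp := h.memLp.const_mul c
  integrable := by
    refine (h.integrable.const_mul (c ^ 2)).congr (.of_forall fun x => ?_)
    simp only; ring

end InEnergySpace

theorem inEnergySpace_const (c : ℝ) : InEnergySpace (fun _ => c) (fun _ => 0) where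
  isPrimitive := .of_hasDerivAt (fun x => hasDerivAt_const x c) continuous_const
  memLp := MemLp.zero'
  integrable := integrable_eta_zero.mul_const _

theorem memLp_of_sq_le_sechSq {f : ℝ → ℝ} (hf : Continuous f) {C : ℝ}
    (h : ∀ x, f x ^ 2 ≤ C * sechSq x) : MemLp f 2 volume := by
  refine (memLp_two_iff_integrable_sq hf.aestronglyMeasurable).2 ?_
  refine (integrable_sechSq.const_mul C).mono' (hf.pow 2).aestronglyMeasurable
    (.of_forall fun x => ?_)
  rw [Real.norm_of_nonneg (sq_nonneg _)]
  exact h x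

theorem memLp_blackSolitonDeriv : MemLp blackSolitonDeriv 2 volume := by
  refine memLp_of_sq_le_sechSq continuous_blackSolitonDeriv (C := 9 / 4) fun x => ?_
  have h1 := blackSolitonDeriv_le x
  have h2 := blackSolitonDeriv_pos x
  have h3 := sechSq_le_one x
  have h4 := sechSq_pos x
  nlinarith

theorem inEnergySpace_blackSoliton : InEnergySpace blackSoliton blackSolitonDeriv where
  isPrimitive := .of_hasDerivAt hasDerivAt_blackSoliton continuous_blackSolitonDeriv
  memLp := memLp_blackSolitonDeriv
  integrable := integrable_eta_zero_mul_pow 2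

theorem sechSq_le_sechSq {t x : ℝ} (h : |t| ≤ |x|) : sechSq x ≤ sechSq t := by
  rw [sechSq_eq, sechSq_eq]
  have h1 : Real.cosh t ≤ Real.cosh x := Real.cosh_le_cosh.2 h
  have h2 := Real.cosh_pos t
  exact inv_anti₀ (by positivity) (pow_le_pow_left₀ h2.le h1 2)

theorem tendsto_sechSq_atBot : Tendsto sechSq atBot (𝓝 0) := by
  have := tendsto_sechSq_atTop.comp tendsto_neg_atBot_atTop
  simpa only [Function.comp_def, sechSq_neg] using this

theorem tendsto_abs_mul_sechSq_atBot : Tendsto (fun x => |x| * sechSq x) atBot (𝓝 0) := by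
  have := tendsto_abs_mul_sechSq_atTop.comp tendsto_neg_atBot_atTop
  simpa only [Function.comp_def, sechSq_neg, abs_neg] using this

theorem integral_Iic_sechSq_le {x : ℝ} (hx : x ≤ 0) : ∫ t in Iic x, sechSq t ≤ sechSq x := by
  have h := integral_comp_neg_Iic x sechSq
  simp_rw [sechSq_neg] at h
  rw [h, ← sechSq_neg x]
  exact integral_Ioi_sechSq_le (by linarith)

/-! ### The flux of a function orthogonal to the weight -/

/-- The flux `∫_{-∞}^x η₀ f`. -/
noncomputable def flux (f : ℝ → ℝ) (x : ℝ) : ℝ := ∫ t in Iic x, eta 0 t * f t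

section Flux

variable {f g : ℝ → ℝ}

theorem hasDerivAt_flux (h : InEnergySpace f g) (x : ℝ) :
    HasDerivAt (flux f) (eta 0 x * f x) x := by
  have hc : Continuous fun t => eta 0 t * f t := continuous_eta_zero.mul h.continuous
  have e : flux f = fun y => flux f 0 + ∫ t in (0:ℝ)..y, eta 0 t * f t := by
    funext y
    rw [← intervalIntegral.integral_Iic_sub_Iic h.integrable_mul.integrableOn
      h.integrable_mul.integrableOn]
    simp only [flux]; ring
  rw [e]
  exact (intervalIntegral.integral_hasDerivAt_right (hc.intervalIntegrable _ _)
    (hc.stronglyMeasurableAtFilter _ _) hc.continuousAt).const_add _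

theorem continuous_flux (h : InEnergySpace f g) : Continuous (flux f) :=
  continuous_iff_continuousAt.2 fun x => (hasDerivAt_flux h x).continuousAt

/-- The part of `∫ η₀ f²` outside of `[-r, r]`. -/
noncomputable def tailMass (f : ℝ → ℝ) (r : ℝ) : ℝ :=
  (∫ t in Ioi r, eta 0 t * f t ^ 2) + ∫ t in Iic (-r), eta 0 t * f t ^ 2

theorem tendsto_tailMass (f : ℝ → ℝ) :
    Tendsto (tailMass f) atTop (𝓝 0) := by
  have h1 : Tendsto (fun r : ℝ => ∫ t in Ioi r, eta 0 t * f t ^ 2) atTop (𝓝 0) :=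
    tendsto_integral_Ioi_zero tendsto_id
  have h2 : Tendsto (fun r : ℝ => ∫ t in Iic (-r), eta 0 t * f t ^ 2) atTop (𝓝 0) :=
    tendsto_integral_Iic_zero tendsto_neg_atTop_atBot
  rw [← add_zero (0 : ℝ)]
  exact h1.add h2

theorem tailMass_le (h : InEnergySpace f g) {r : ℝ} :
    tailMass f r ≤ 2 * ∫ x, eta 0 x * f x ^ 2 := by
  have h0 : 0 ≤ᵐ[volume] fun x => eta 0 x * f x ^ 2 :=
    .of_forall fun x => mul_nonneg (eta_zero_pos x).le (sq_nonneg _)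
  have h1 := setIntegral_le_integral (s := Ioi r) h.integrable h0
  have h2 := setIntegral_le_integral (s := Iic (-r)) h.integrable h0
  rw [tailMass]; linarith

/-- Cauchy–Schwarz on the half-line that starts at `x` and points away from the origin. The tail
mass is kept, rather than the full mass, because `abs_boundary_le` needs more than the exponential
decay. -/
theorem flux_sq_le (h : InEnergySpace f g) (h0 : ∫ x, eta 0 x * f x = 0) (x : ℝ) :
    flux f x ^ 2 ≤ 3 * sechSq x * tailMass f |x| := by
  have hn : ∀ s : Set ℝ, 0 ≤ ∫ t in s, eta 0 t * f t ^ 2 := fun s =>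
    integral_nonneg fun t => mul_nonneg (eta_zero_pos t).le (sq_nonneg _)
  have key : ∀ s : Set ℝ, (∫ t in s, sechSq t) ≤ sechSq x →
      (∫ t in s, eta 0 t * f t) ^ 2 ≤ 3 * sechSq x * ∫ t in s, eta 0 t * f t ^ 2 := by
    intro s hs
    have h1 := (sq_integral_weight_le (μ := volume.restrict s) (fun x => (eta_zero_pos x).le)
      integrable_eta_zero.integrableOn h.continuous.aestronglyMeasurable
      h.integrable.integrableOn).2
    have h2 : ∫ t in s, eta 0 t ≤ 3 * sechSq x := by
      have := integral_mono (μ := volume.restrict s) integrable_eta_zero.integrableOn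
        (integrable_sechSq.integrableOn.const_mul 3) eta_zero_le
      rw [integral_const_mul] at this
      linarith
    exact h1.trans (mul_le_mul_of_nonneg_right h2 (hn s))
  have hs := sechSq_pos x
  rcases le_total 0 x with hx | hx
  -- For `x ≥ 0` the vanishing total integral trades the left integral for the short right tail.
  · have e : flux f x = -∫ t in Ioi x, eta 0 t * f t := by
      have := intervalIntegral.integral_Iic_add_Ioi (b := x) h.integrable_mul.integrableOn
        h.integrable_mul.integrableOn
      rw [h0] at this
      rw [flux]; linarith
    rw [e, neg_sq, abs_of_nonneg hx, tailMass]
    refine (key _ (integral_Ioi_sechSq_le hx)).trans (mul_le_mul_of_nonneg_left ?_ (by positivity))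
    linarith [hn (Iic (-x))]
  · rw [abs_of_nonpos hx, tailMass, neg_neg]
    refine (key _ (integral_Iic_sechSq_le hx)).trans (mul_le_mul_of_nonneg_left ?_ (by positivity))
    linarith [hn (Ioi (-x))]

theorem flux_sq_le' (h : InEnergySpace f g) (h0 : ∫ x, eta 0 x * f x = 0) (x : ℝ) :
    flux f x ^ 2 ≤ (6 * ∫ x, eta 0 x * f x ^ 2) * sechSq x := by
  have h1 := flux_sq_le h h0 x
  have h2 := tailMass_le h (r := |x|)
  have h3 := sechSq_pos x
  nlinarith

theorem memLp_flux (h : InEnergySpace f g) (h0 : ∫ x, eta 0 x * f x = 0) :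
    MemLp (flux f) 2 volume :=
  memLp_of_sq_le_sechSq (continuous_flux h) (flux_sq_le' h h0)

theorem isPrimitive_flux (h : InEnergySpace f g) :
    IsPrimitive (flux f) fun x => eta 0 x * f x :=
  .of_hasDerivAt (hasDerivAt_flux h) (continuous_eta_zero.mul h.continuous)

theorem tendsto_zero_of_sq_le {l : Filter ℝ} {u v : ℝ → ℝ} (huv : ∀ x, u x ^ 2 ≤ v x)
    (hv : Tendsto v l (𝓝 0)) : Tendsto u l (𝓝 0) := by
  have h1 : Tendsto (fun x => √(v x)) l (𝓝 √0) := (Real.continuous_sqrt.tendsto _).comp hv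
  rw [Real.sqrt_zero] at h1
  refine squeeze_zero_norm (fun x => ?_) h1
  rw [Real.norm_eq_abs]
  exact Real.abs_le_sqrt (huv x)

/-- Integration by parts: the flux decays exponentially while `f` grows at most like a square root,
so no boundary term survives. -/
theorem integral_eta_sq_eq (h : InEnergySpace f g) (h0 : ∫ x, eta 0 x * f x = 0) :
    ∫ x, eta 0 x * f x ^ 2 = - ∫ x, flux f x * g x := by
  obtain ⟨C, hC, hb⟩ := exists_sq_le_energyNormSq
  have hsq : ∀ x, (flux f x * f x) ^ 2 ≤
      (6 * ∫ x, eta 0 x * f x ^ 2) * (C * energyNormSq f g) * (sechSq x + |x| * sechSq x) := by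
    intro x
    rw [mul_pow]
    calc flux f x ^ 2 * f x ^ 2
        ≤ ((6 * ∫ x, eta 0 x * f x ^ 2) * sechSq x) * (C * (1 + |x|) * energyNormSq f g) :=
          mul_le_mul (flux_sq_le' h h0 x) (hb f g h x) (sq_nonneg _)
            ((sq_nonneg _).trans (flux_sq_le' h h0 x))
      _ = _ := by ring
  have := (isPrimitive_flux h).integral_mul_eq_zero h.isPrimitive
    (h.integrable.congr (.of_forall fun x => by simp only; ring))
    ((memLp_flux h h0).integrable_mul h.memLp)
    (tendsto_zero_of_sq_le hsq (by
      simpa using (tendsto_sechSq_atBot.add tendsto_abs_mul_sechSq_atBot).const_mul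
        ((6 * ∫ x, eta 0 x * f x ^ 2) * (C * energyNormSq f g))))
    (tendsto_zero_of_sq_le hsq (by
      simpa using (tendsto_sechSq_atTop.add tendsto_abs_mul_sechSq_atTop).const_mul
        ((6 * ∫ x, eta 0 x * f x ^ 2) * (C * energyNormSq f g))))
  rw [← this]
  exact integral_congr_ae (.of_forall fun x => by simp only; ring)

/-- Integration by parts turns orthogonality of `f` to the soliton into orthogonality of the flux to
the ground state `blackSolitonDeriv`. -/
theorem integral_blackSolitonDeriv_mul_flux (h : InEnergySpace f g)
    (h0 : ∫ x, eta 0 x * f x = 0) (h1 : ∫ x, eta 0 x * (blackSoliton x * f x) = 0) :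
    ∫ x, blackSolitonDeriv x * flux f x = 0 := by
  have hsq : ∀ x, (blackSoliton x * flux f x) ^ 2 ≤ (6 * ∫ x, eta 0 x * f x ^ 2) * sechSq x := by
    intro x
    rw [mul_pow]
    exact (mul_le_of_le_one_left (sq_nonneg _) (blackSoliton_sq_le_one x)).trans
      (flux_sq_le' h h0 x)
  have e : ∀ x, blackSoliton x * (eta 0 x * f x) = eta 0 x * (blackSoliton x * f x) :=
    fun x => by ring
  have := inEnergySpace_blackSoliton.isPrimitive.integral_mul_eq_zero (isPrimitive_flux h)
    (memLp_blackSolitonDeriv.integrable_mul (memLp_flux h h0))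
    (by simpa only [e] using h.integrable_mul_mul continuous_blackSoliton abs_blackSoliton_le_one)
    (tendsto_zero_of_sq_le hsq (by simpa using tendsto_sechSq_atBot.const_mul _))
    (tendsto_zero_of_sq_le hsq (by simpa using tendsto_sechSq_atTop.const_mul _))
  simp_rw [e] at this
  rw [this, h1, neg_zero]

/-- The quotient of the flux by the derivative of the black soliton. -/
noncomputable def fluxQuotient (f : ℝ → ℝ) (x : ℝ) : ℝ := flux f x / blackSolitonDeriv x

/-- The derivative of `fluxQuotient`. -/
noncomputable def fluxQuotientDeriv (f : ℝ → ℝ) (x : ℝ) : ℝ :=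
  eta 0 x * (f x * blackSolitonDeriv x + blackSoliton x * flux f x) / blackSolitonDeriv x ^ 2

theorem hasDerivAt_fluxQuotient (h : InEnergySpace f g) (x : ℝ) :
    HasDerivAt (fluxQuotient f) (fluxQuotientDeriv f x) x := by
  refine HasDerivAt.congr_deriv ((hasDerivAt_flux h x).div (hasDerivAt_blackSolitonDeriv x)
    (blackSolitonDeriv_pos x).ne') ?_
  rw [fluxQuotientDeriv]; ring

theorem continuous_fluxQuotientDeriv (h : InEnergySpace f g) :
    Continuous (fluxQuotientDeriv f) := by
  have h1 := continuous_flux h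
  have h2 := continuous_eta_zero
  have h3 := continuous_blackSolitonDeriv
  have h4 := continuous_blackSoliton
  have h5 := h.continuous
  exact Continuous.div (by fun_prop) (by fun_prop)
    fun x => pow_ne_zero 2 (blackSolitonDeriv_pos x).ne'

/-- The Dirichlet density of `fluxQuotient`. -/
noncomputable def fluxDensity (f : ℝ → ℝ) (x : ℝ) : ℝ :=
  blackSolitonDeriv x ^ 2 / eta 0 x * fluxQuotientDeriv f x ^ 2

theorem fluxDensity_nonneg (f : ℝ → ℝ) (x : ℝ) : 0 ≤ fluxDensity f x := by
  have := eta_zero_pos x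
  rw [fluxDensity]; positivity

theorem continuous_fluxDensity (h : InEnergySpace f g) : Continuous (fluxDensity f) :=
  ((continuous_blackSolitonDeriv.pow 2).div continuous_eta_zero
    fun x => (eta_zero_pos x).ne').mul ((continuous_fluxQuotientDeriv h).pow 2)

/-- The Jacobi (ground state) identity for `F = φ₀' v`, using `(φ₀')' = -η₀ φ₀`: the difference `η₀
f² - F²` is the Dirichlet density of `v` up to an exact derivative. -/
theorem hasDerivAt_boundary (h : InEnergySpace f g) (x : ℝ) :
    HasDerivAt (fun x => blackSoliton x * flux f x ^ 2 / blackSolitonDeriv x)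
      (fluxDensity f x - eta 0 x * f x ^ 2 + flux f x ^ 2) x := by
  have hd := (blackSolitonDeriv_pos x).ne'
  have he := (eta_zero_pos x).ne'
  refine HasDerivAt.congr_deriv (((hasDerivAt_blackSoliton x).mul ((hasDerivAt_flux h x).pow 2)).div
    (hasDerivAt_blackSolitonDeriv x) hd) ?_
  rw [fluxDensity, fluxQuotientDeriv]
  simp only [Pi.pow_apply, Pi.mul_apply]
  field_simp
  push_cast
  ring

/-- The factor `sechSq` in the bound of the squared flux cancels against the lower bound of
`blackSolitonDeriv`, leaving `3 / (4/5) = 15/4` times the tail mass, which tends to zero. -/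
theorem abs_boundary_le (h : InEnergySpace f g) (h0 : ∫ x, eta 0 x * f x = 0) (x : ℝ) :
    |blackSoliton x * flux f x ^ 2 / blackSolitonDeriv x| ≤ 15 / 4 * tailMass f |x| := by
  have hd := blackSolitonDeriv_pos x
  rw [abs_div, abs_of_pos hd, div_le_iff₀ hd, abs_mul, abs_of_nonneg (sq_nonneg (flux f x))]
  have h1 := flux_sq_le h h0 x
  have h2 := le_blackSolitonDeriv x
  have h3 := sechSq_pos x
  have h4 : 0 ≤ tailMass f |x| := by
    by_contra hn
    push Not at hn
    nlinarith [sq_nonneg (flux f x)]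
  have h5 := mul_le_of_le_one_left (sq_nonneg (flux f x)) (abs_blackSoliton_le_one x)
  nlinarith

/-- The ground state identity integrated over `[-n, n]`, with both boundary terms vanishing in the
limit. Symmetric intervals avoid proving separately that the density is integrable. -/
theorem tendsto_integral_fluxDensity (h : InEnergySpace f g) (h0 : ∫ x, eta 0 x * f x = 0) :
    Tendsto (fun n : ℝ => ∫ x in (-n)..n, fluxDensity f x) atTop
      (𝓝 ((∫ x, eta 0 x * f x ^ 2) - ∫ x, flux f x ^ 2)) := by
  have hc1 : Continuous fun x => eta 0 x * f x ^ 2 := continuous_eta_zero.mul (h.continuous.pow 2)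
  have hc2 : Continuous fun x => flux f x ^ 2 := (continuous_flux h).pow 2
  have hc3 := continuous_fluxDensity h
  have e : ∀ n : ℝ, ∫ x in (-n)..n, fluxDensity f x =
      (∫ x in (-n)..n, eta 0 x * f x ^ 2) - (∫ x in (-n)..n, flux f x ^ 2)
      + (blackSoliton n * flux f n ^ 2 / blackSolitonDeriv n
        - blackSoliton (-n) * flux f (-n) ^ 2 / blackSolitonDeriv (-n)) := by
    intro n
    have hc4 : Continuous fun x => fluxDensity f x - eta 0 x * f x ^ 2 := hc3.sub hc1
    rw [← intervalIntegral.integral_eq_sub_of_hasDerivAt (fun x _ => hasDerivAt_boundary h x)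
        ((hc4.add hc2).intervalIntegrable _ _),
      intervalIntegral.integral_add (hc4.intervalIntegrable _ _)
        (hc2.intervalIntegrable _ _), intervalIntegral.integral_sub (hc3.intervalIntegrable _ _)
        (hc1.intervalIntegrable _ _)]
    ring
  simp_rw [e]
  have t1 := intervalIntegral_tendsto_integral h.integrable tendsto_neg_atTop_atBot tendsto_id
  have t2 := intervalIntegral_tendsto_integral (memLp_flux h h0).integrable_sq
    tendsto_neg_atTop_atBot tendsto_id
  have t3 : Tendsto (fun x : ℝ => 15 / 4 * tailMass f |x|) atTop (𝓝 0) := by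
    simpa using ((tendsto_tailMass f).comp tendsto_abs_atTop_atTop).const_mul (15 / 4)
  have b1 : Tendsto (fun x => blackSoliton x * flux f x ^ 2 / blackSolitonDeriv x) atTop (𝓝 0) :=
    squeeze_zero_norm (abs_boundary_le h h0) t3
  have b2 : Tendsto (fun x => blackSoliton (-x) * flux f (-x) ^ 2 / blackSolitonDeriv (-x)) atTop
      (𝓝 0) :=
    squeeze_zero_norm (fun x => (abs_boundary_le h h0 (-x))) (by simpa only [abs_neg] using t3)
  simpa using (t1.sub t2).add (b1.sub b2)

theorem eta_zero_div_le (t : ℝ) : eta 0 t / blackSolitonDeriv t ^ 2 ≤ 5 / sechSq t := by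
  have h1 := eta_zero_le t
  have h2 := le_blackSolitonDeriv t
  have h3 := sechSq_pos t
  have h4 := blackSolitonDeriv_pos t
  rw [div_le_div_iff₀ (by positivity) h3]
  have : (4 / 5 * sechSq t) ^ 2 ≤ blackSolitonDeriv t ^ 2 := pow_le_pow_left₀ (by positivity) h2 2
  nlinarith

/-- Weighted Cauchy–Schwarz on the derivative of the quotient. The weight `η₀/φ₀'²` is at most
`5/sechSq t`, and `sechSq` decreases away from the origin, so its integral over the segment from `0`
to `x` is at most `5|x|/sechSq x`. -/
theorem fluxQuotient_sub_sq_le (h : InEnergySpace f g) {n x : ℝ} (hx : |x| ≤ n) :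
    (fluxQuotient f x - fluxQuotient f 0) ^ 2 ≤
      5 * |x| / sechSq x * ∫ t in (-n)..n, fluxDensity f t := by
  have hS := sechSq_pos x
  have hcd := continuous_fluxDensity h
  have hcw : Continuous fun t => eta 0 t / blackSolitonDeriv t ^ 2 :=
    continuous_eta_zero.div (continuous_blackSolitonDeriv.pow 2)
      fun t => pow_ne_zero 2 (blackSolitonDeriv_pos t).ne'
  have hcp : Continuous fun t => blackSolitonDeriv t ^ 2 / eta 0 t * fluxQuotientDeriv f t :=
    ((continuous_blackSolitonDeriv.pow 2).div continuous_eta_zero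
      fun x => (eta_zero_pos x).ne').mul (continuous_fluxQuotientDeriv h)
  have key : ∀ a b : ℝ, a ≤ b → -n ≤ a → b ≤ n → b - a = |x| →
      (∀ t ∈ Ioc a b, |t| ≤ |x|) → (fluxQuotient f b - fluxQuotient f a) ^ 2 ≤
      5 * |x| / sechSq x * ∫ t in (-n)..n, fluxDensity f t := by
    intro a b hab hna hbn hlen ht
    rw [← intervalIntegral.integral_eq_sub_of_hasDerivAt
      (fun t _ => hasDerivAt_fluxQuotient h t)
      ((continuous_fluxQuotientDeriv h).intervalIntegrable _ _),
      intervalIntegral.integral_of_le hab]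
    have e1 : ∀ t, eta 0 t / blackSolitonDeriv t ^ 2 *
        (blackSolitonDeriv t ^ 2 / eta 0 t * fluxQuotientDeriv f t) = fluxQuotientDeriv f t := by
      intro t
      have := (eta_zero_pos t).ne'
      have := (blackSolitonDeriv_pos t).ne'
      field_simp
    have e2 : ∀ t, eta 0 t / blackSolitonDeriv t ^ 2 *
        (blackSolitonDeriv t ^ 2 / eta 0 t * fluxQuotientDeriv f t) ^ 2 = fluxDensity f t := by
      intro t
      have := (eta_zero_pos t).ne'
      have := (blackSolitonDeriv_pos t).ne'
      rw [fluxDensity]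
      field_simp
    have i0 : IntegrableOn (fun t => eta 0 t / blackSolitonDeriv t ^ 2) (Ioc a b) :=
      (hcw.integrableOn_Icc (a := a) (b := b)).mono_set Ioc_subset_Icc_self
    have i1 : IntegrableOn (fluxDensity f) (Ioc a b) :=
      (hcd.integrableOn_Icc (a := a) (b := b)).mono_set Ioc_subset_Icc_self
    have cs := (sq_integral_weight_le (μ := volume.restrict (Ioc a b))
      (fun t => div_nonneg (eta_zero_pos t).le (sq_nonneg (blackSolitonDeriv t)))
      i0 hcp.aestronglyMeasurable (by simp_rw [e2]; exact i1)).2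
    simp_rw [e1, e2] at cs
    refine cs.trans (mul_le_mul ?_ ?_ (integral_nonneg fun t => fluxDensity_nonneg f t)
      (by positivity))
    · have m := setIntegral_mono_on i0 (integrableOn_const (C := 5 / sechSq x) (by simp) )
        measurableSet_Ioc (fun t hm => (eta_zero_div_le t).trans
          (div_le_div_of_nonneg_left (by norm_num) hS (sechSq_le_sechSq (ht t hm))))
      refine m.trans (le_of_eq ?_)
      simp only [integral_const, MeasurableSet.univ, measureReal_restrict_apply, univ_inter,
        Real.volume_real_Ioc_of_le hab, smul_eq_mul, hlen]
      ring
    · rw [intervalIntegral.integral_of_le (by linarith)]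
      refine setIntegral_mono_set
        ((hcd.integrableOn_Icc (a := -n) (b := n)).mono_set Ioc_subset_Icc_self)
        (.of_forall fun t => fluxDensity_nonneg f t) (.of_forall fun t ht => ?_)
      exact ⟨lt_of_le_of_lt hna ht.1, ht.2.trans hbn⟩
  have hx' := abs_le.1 hx
  rcases le_total 0 x with h0 | h0
  · refine key 0 x h0 (by linarith [abs_nonneg x]) hx'.2 (by rw [abs_of_nonneg h0, sub_zero]) ?_
    intro t ht
    rw [abs_of_pos ht.1, abs_of_nonneg h0]; exact ht.2
  · rw [← neg_sub, neg_sq]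
    refine key x 0 h0 hx'.1 (by linarith [abs_nonneg x]) (by rw [abs_of_nonpos h0, zero_sub]) ?_
    intro t ht
    rw [abs_of_nonpos ht.2, abs_of_nonpos h0]; linarith [ht.1]

/-- A Poincaré inequality for the quotient `v` of the flux by the ground state: `v - v(0)` is
bounded by the Dirichlet integral, and orthogonality to the ground state makes subtracting the
constant harmless. -/
theorem integral_flux_sq_le (h : InEnergySpace f g) (h0 : ∫ x, eta 0 x * f x = 0)
    (h1 : ∫ x, eta 0 x * (blackSoliton x * f x) = 0) :
    ∫ x, flux f x ^ 2 ≤ 12 * (∫ x, |x| * sechSq x) *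
      ((∫ x, eta 0 x * f x ^ 2) - ∫ x, flux f x ^ 2) := by
  set k := fluxQuotient f 0 with hk
  have hcf := continuous_flux h
  have i1 : Integrable fun x => flux f x ^ 2 := (memLp_flux h h0).integrable_sq
  have i2 : Integrable fun x => blackSolitonDeriv x * flux f x :=
    memLp_blackSolitonDeriv.integrable_mul (memLp_flux h h0)
  have i3 : Integrable fun x => blackSolitonDeriv x ^ 2 := memLp_blackSolitonDeriv.integrable_sq
  have i4 : Integrable fun x => flux f x ^ 2 + (-2 * k) * (blackSolitonDeriv x * flux f x)
      + k ^ 2 * blackSolitonDeriv x ^ 2 := (i1.add (i2.const_mul _)).add (i3.const_mul _)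
  have hJ : ∀ n : ℝ, 0 ≤ n → 0 ≤ ∫ t in (-n)..n, fluxDensity f t := fun n hn =>
    intervalIntegral.integral_nonneg (by linarith) fun t _ => fluxDensity_nonneg f t
  have hle : ∀ n : ℝ, 0 ≤ n → (∫ x in (-n)..n, (flux f x ^ 2
      + (-2 * k) * (blackSolitonDeriv x * flux f x) + k ^ 2 * blackSolitonDeriv x ^ 2)) ≤
      12 * (∫ x, |x| * sechSq x) * ∫ t in (-n)..n, fluxDensity f t := by
    intro n hn
    have hp : ∀ x ∈ Icc (-n) n, flux f x ^ 2 + (-2 * k) * (blackSolitonDeriv x * flux f x)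
        + k ^ 2 * blackSolitonDeriv x ^ 2 ≤
        (12 * ∫ t in (-n)..n, fluxDensity f t) * (|x| * sechSq x) := by
      intro x hx
      have hb := fluxQuotient_sub_sq_le h (abs_le.2 ⟨hx.1, hx.2⟩)
      have hd := blackSolitonDeriv_pos x
      have hS := sechSq_pos x
      have e : flux f x = blackSolitonDeriv x * fluxQuotient f x := by
        rw [fluxQuotient]; field_simp
      have e2 : flux f x ^ 2 + (-2 * k) * (blackSolitonDeriv x * flux f x)
          + k ^ 2 * blackSolitonDeriv x ^ 2
          = blackSolitonDeriv x ^ 2 * (fluxQuotient f x - k) ^ 2 := by rw [e]; ring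
      rw [e2]
      have hd2 : blackSolitonDeriv x ^ 2 ≤ (3 / 2 * sechSq x) ^ 2 :=
        pow_le_pow_left₀ hd.le (blackSolitonDeriv_le x) 2
      -- The constants multiply to `(3/2)² · 5 = 45/4`, rounded up to 12. One power of `sechSq`
      -- survives to make the factor `|x|` integrable.
      calc blackSolitonDeriv x ^ 2 * (fluxQuotient f x - k) ^ 2
          ≤ (3 / 2 * sechSq x) ^ 2 * (5 * |x| / sechSq x * ∫ t in (-n)..n, fluxDensity f t) :=
            mul_le_mul hd2 hb (sq_nonneg _) (sq_nonneg _)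
        _ = (45 / 4) * ((∫ t in (-n)..n, fluxDensity f t) * (|x| * sechSq x)) := by
            field_simp; ring
        _ ≤ 12 * ((∫ t in (-n)..n, fluxDensity f t) * (|x| * sechSq x)) := by
            refine mul_le_mul_of_nonneg_right (by norm_num) (mul_nonneg (hJ n hn) (by positivity))
        _ = _ := by ring
    have hm := intervalIntegral.integral_mono_on (by linarith : -n ≤ n) i4.intervalIntegrable
      (integrable_abs_mul_sechSq.intervalIntegrable.const_mul _) hp
    rw [intervalIntegral.integral_const_mul] at hm
    refine hm.trans ?_
    have : ∫ x in (-n)..n, |x| * sechSq x ≤ ∫ x, |x| * sechSq x := by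
      rw [intervalIntegral.integral_of_le (by linarith)]
      exact setIntegral_le_integral integrable_abs_mul_sechSq
        (.of_forall fun x => mul_nonneg (abs_nonneg x) (sechSq_pos x).le)
    have := mul_le_mul_of_nonneg_left this (hJ n hn)
    linarith
  have l1 := intervalIntegral_tendsto_integral i4 tendsto_neg_atTop_atBot tendsto_id
  have l2 := (tendsto_integral_fluxDensity h h0).const_mul (12 * ∫ x, |x| * sechSq x)
  have hlim := le_of_tendsto_of_tendsto l1 l2
    ((eventually_ge_atTop 0).mono fun n hn => hle n hn)
  have l3 := integral_lin3 i1 i2 i3 1 (-2 * k) (k ^ 2)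
  simp only [one_mul] at l3
  rw [l3, integral_blackSolitonDeriv_mul_flux h h0 h1] at hlim
  -- The cross term vanished by orthogonality, so subtracting `k φ₀'` can only have increased the
  -- norm of the flux.
  have : 0 ≤ k ^ 2 * ∫ x, blackSolitonDeriv x ^ 2 :=
    mul_nonneg (sq_nonneg _) (integral_nonneg fun _ => sq_nonneg _)
  linarith

end Flux

/-- The spectral gap: on functions orthogonal to the constants and to the black soliton, the
weighted Poincaré inequality has a constant less than one. -/
theorem exists_spectral_gap : ∃ q : ℝ, 0 < q ∧ q < 1 ∧ ∀ f g : ℝ → ℝ, InEnergySpace f g →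
    ∫ x, eta 0 x * f x = 0 → ∫ x, eta 0 x * (blackSoliton x * f x) = 0 →
    ∫ x, eta 0 x * f x ^ 2 ≤ q * ∫ x, g x ^ 2 := by
  set K := 12 * ∫ x, |x| * sechSq x with hK
  have hK0 : 0 ≤ K := mul_nonneg (by norm_num)
    (integral_nonneg fun x => mul_nonneg (abs_nonneg x) (sechSq_pos x).le)
  -- The estimates yield `K / (K + 1)`; the larger value is positive without a proof that `K ≠ 0`.
  refine ⟨(K + 1) / (K + 2), by positivity, by rw [div_lt_one (by positivity)]; linarith,
    fun f g h h0 h1 => ?_⟩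
  have hD := integral_flux_sq_le h h0 h1
  rw [← hK] at hD
  have hcs := sq_integral_mul_le (memLp_flux h h0) h.memLp
  have hA := integral_eta_sq_eq h h0
  have hA0 := integral_eta_sq_nonneg f
  have hG0 : 0 ≤ ∫ x, g x ^ 2 := integral_nonneg fun _ => sq_nonneg _
  have hD0 : 0 ≤ ∫ x, flux f x ^ 2 := integral_nonneg fun _ => sq_nonneg _
  have hcs' : (∫ x, eta 0 x * f x ^ 2) ^ 2 ≤ (∫ x, flux f x ^ 2) * ∫ x, g x ^ 2 := by
    rw [hA, neg_sq]; exact hcs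
  generalize (∫ x, eta 0 x * f x ^ 2) = A at *
  generalize (∫ x, flux f x ^ 2) = D at *
  generalize (∫ x, g x ^ 2) = G at *
  have hDA : D * (K + 2) ≤ (K + 1) * A := by
    have : D ≤ A := by nlinarith
    linarith
  rw [div_mul_eq_mul_div, le_div_iff₀ (by positivity)]
  rcases hA0.eq_or_lt with hz | hpos
  · rw [← hz]; rw [zero_mul]; positivity
  · have : A * (A * (K + 2)) ≤ A * ((K + 1) * G) := by
      calc A * (A * (K + 2)) = A ^ 2 * (K + 2) := by ring
        _ ≤ (D * G) * (K + 2) := by gcongr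
        _ = (D * (K + 2)) * G := by ring
        _ ≤ ((K + 1) * A) * G := by gcongr
        _ = _ := by ring
    exact le_of_mul_le_mul_left this hpos

/-! ### Coercivity around the black soliton -/

/-- The weak form of `-φ₀'' = η₀ φ₀`: orthogonality to the soliton for the weight is the same as
orthogonality of derivatives in `L²`. -/
theorem integral_blackSolitonDeriv_mul {f g : ℝ → ℝ} (h : InEnergySpace f g) :
    ∫ x, blackSolitonDeriv x * g x = ∫ x, eta 0 x * (blackSoliton x * f x) := by
  obtain ⟨C, hC, hb⟩ := exists_sq_le_energyNormSq
  have hp : IsPrimitive blackSolitonDeriv fun x => -(eta 0 x * blackSoliton x) :=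
    .of_hasDerivAt hasDerivAt_blackSolitonDeriv (continuous_eta_zero.mul continuous_blackSoliton).neg
  have hsq : ∀ x, (blackSolitonDeriv x * f x) ^ 2 ≤
      (9 / 4 * (C * energyNormSq f g)) * (sechSq x + |x| * sechSq x) := by
    intro x
    have h1 := blackSolitonDeriv_pos x
    have h2 := sechSq_pos x
    have h3 : blackSolitonDeriv x ^ 2 ≤ 9 / 4 * sechSq x := by
      nlinarith [blackSolitonDeriv_le x, sechSq_le_one x]
    rw [mul_pow]
    calc blackSolitonDeriv x ^ 2 * f x ^ 2
        ≤ (9 / 4 * sechSq x) * (C * (1 + |x|) * energyNormSq f g) :=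
          mul_le_mul h3 (hb f g h x) (sq_nonneg _) (by positivity)
      _ = _ := by ring
  have e : ∀ x, -(eta 0 x * blackSoliton x) * f x = -(eta 0 x * (blackSoliton x * f x)) :=
    fun x => by ring
  have hi := h.integrable_mul_mul continuous_blackSoliton abs_blackSoliton_le_one
  have := hp.integral_mul_eq_zero h.isPrimitive (by simp_rw [e]; exact hi.neg)
    (memLp_blackSolitonDeriv.integrable_mul h.memLp)
    (tendsto_zero_of_sq_le hsq (by
      simpa using (tendsto_sechSq_atBot.add tendsto_abs_mul_sechSq_atBot).const_mul
        (9 / 4 * (C * energyNormSq f g))))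
    (tendsto_zero_of_sq_le hsq (by
      simpa using (tendsto_sechSq_atTop.add tendsto_abs_mul_sechSq_atTop).const_mul
        (9 / 4 * (C * energyNormSq f g))))
  simp_rw [e] at this
  rw [integral_neg] at this
  linarith

theorem integral_blackSolitonDeriv_sq :
    ∫ x, blackSolitonDeriv x ^ 2 = ∫ x, eta 0 x * blackSoliton x ^ 2 := by
  have := integral_blackSolitonDeriv_mul inEnergySpace_blackSoliton
  simpa only [sq] using this

/-- A function of the energy space decomposed along the constants, the black soliton, and their
orthogonal complement. -/
theorem exists_decomposition {f g : ℝ → ℝ} (h : InEnergySpace f g) : ∃ a b : ℝ, ∃ w w' : ℝ → ℝ,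
    InEnergySpace w w' ∧ (∀ x, f x = a * blackSoliton x + (b + w x)) ∧
    (∫ x, eta 0 x * w x) = 0 ∧ (∫ x, eta 0 x * (blackSoliton x * w x)) = 0 ∧
    (∫ x, eta 0 x * f x) = b * (∫ x, eta 0 x) ∧
    (∫ x, eta 0 x * (blackSoliton x * f x)) = a * (∫ x, eta 0 x * blackSoliton x ^ 2) ∧
    (∫ x, g x ^ 2) = (∫ x, w' x ^ 2) + a ^ 2 * (∫ x, eta 0 x * blackSoliton x ^ 2) ∧
    (∫ x, eta 0 x * f x ^ 2) = (∫ x, eta 0 x * w x ^ 2) + b ^ 2 * (∫ x, eta 0 x)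
      + a ^ 2 * (∫ x, eta 0 x * blackSoliton x ^ 2) := by
  have hM : 0 < ∫ x, eta 0 x := integral_eta_zero_pos
  have hK : 0 < ∫ x, eta 0 x * blackSoliton x ^ 2 := by
    simpa using integral_eta_zero_mul_even_pow_pos 1
  have h0 := integral_eta_zero_mul_blackSoliton
  have hD := integral_blackSolitonDeriv_sq
  have hG := integral_blackSolitonDeriv_mul h
  have j0 := integrable_eta_zero
  have j1 : Integrable fun x => eta 0 x * blackSoliton x := by
    simpa using integrable_eta_zero_mul_pow 1
  have j2 := integrable_eta_zero_mul_pow 2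
  have j3 := h.integrable_mul
  have j4 := h.integrable_mul_mul continuous_blackSoliton abs_blackSoliton_le_one
  set M := ∫ x, eta 0 x with hMd
  set K := ∫ x, eta 0 x * blackSoliton x ^ 2 with hKd
  set I := ∫ x, eta 0 x * f x with hI
  set J := ∫ x, eta 0 x * (blackSoliton x * f x) with hJ
  -- Plain orthogonal projection: constants and the soliton are orthogonal for the weight by parity,
  -- so the two coefficients decouple.
  have hw : InEnergySpace (fun x => f x + (-(J / K) * blackSoliton x + -(I / M)))
      (fun x => g x + (-(J / K) * blackSolitonDeriv x + 0)) :=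
    h.add ((inEnergySpace_blackSoliton.const_mul _).add (inEnergySpace_const _))
  have w0 : (∫ x, eta 0 x * (f x + (-(J / K) * blackSoliton x + -(I / M)))) = 0 := by
    have l := integral_lin3 j3 j1 j0 1 (-(J / K)) (-(I / M))
    rw [h0, ← hI, ← hMd] at l
    calc _ = ∫ x, (1 * (eta 0 x * f x) + -(J / K) * (eta 0 x * blackSoliton x)
          + -(I / M) * eta 0 x) := integral_congr_ae (.of_forall fun x => by simp only; ring)
      _ = 0 := by rw [l]; field_simp; ring
  have w1 : (∫ x, eta 0 x * (blackSoliton x * (f x + (-(J / K) * blackSoliton x + -(I / M)))))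
      = 0 := by
    have l := integral_lin3 j4 j2 j1 1 (-(J / K)) (-(I / M))
    rw [h0, ← hJ, ← hKd] at l
    calc _ = ∫ x, (1 * (eta 0 x * (blackSoliton x * f x)) + -(J / K) * (eta 0 x * blackSoliton x ^ 2)
          + -(I / M) * (eta 0 x * blackSoliton x)) :=
          integral_congr_ae (.of_forall fun x => by simp only; ring)
      _ = 0 := by rw [l]; field_simp; ring
  refine ⟨J / K, I / M, _, _, hw, fun x => by ring, w0, w1, by field_simp, by field_simp, ?_, ?_⟩
  -- The cross term with the soliton derivative is again `J` by the soliton equation, so the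
  -- Dirichlet integral splits along the same decomposition.
  · have l := integral_lin3 h.memLp.integrable_sq (memLp_blackSolitonDeriv.integrable_mul h.memLp)
      memLp_blackSolitonDeriv.integrable_sq 1 (-2 * (J / K)) ((J / K) ^ 2)
    simp only [Pi.mul_apply] at l
    rw [hG, hD] at l
    have : ∫ x, (g x + (-(J / K) * blackSolitonDeriv x + 0)) ^ 2 =
        ∫ x, (1 * g x ^ 2 + -2 * (J / K) * (blackSolitonDeriv x * g x)
          + (J / K) ^ 2 * blackSolitonDeriv x ^ 2) :=
      integral_congr_ae (.of_forall fun x => by simp only; ring)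
    rw [this, l]
    field_simp
    ring
  · have hw1 := hw.integrable
    have hw2 := hw.integrable_mul
    have hw3 := hw.integrable_mul_mul continuous_blackSoliton abs_blackSoliton_le_one
    set w : ℝ → ℝ := fun x => f x + (-(J / K) * blackSoliton x + -(I / M)) with hwd
    have l1 := integral_lin3 hw1 hw2 hw3 1 (2 * (I / M)) (2 * (J / K))
    have l2 := integral_lin3 j0 j1 j2 ((I / M) ^ 2) (2 * (I / M) * (J / K)) ((J / K) ^ 2)
    have l3 := integral_add (((hw1.const_mul 1).add (hw2.const_mul (2 * (I / M)))).add
      (hw3.const_mul (2 * (J / K)))) (((j0.const_mul ((I / M) ^ 2)).add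
      (j1.const_mul (2 * (I / M) * (J / K)))).add (j2.const_mul ((J / K) ^ 2)))
    simp only [Pi.add_apply] at l3
    rw [l1, l2, h0, ← hKd, ← hMd, w0, w1] at l3
    refine (Eq.trans (integral_congr_ae (.of_forall fun x => ?_)) l3).trans ?_
    · ring
    · ring

/-- Coercivity of the linearized operator, up to its nonpositive directions. -/
theorem exists_linear_coercivity : ∃ δ C : ℝ, 0 < δ ∧ 0 ≤ C ∧ ∀ f g : ℝ → ℝ, InEnergySpace f g →
    δ * energyNormSq f g - C * ((∫ x, eta 0 x * f x) ^ 2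
      + (∫ x, eta 0 x * (blackSoliton x * f x)) ^ 2) ≤
    (∫ x, g x ^ 2) - ∫ x, eta 0 x * f x ^ 2 := by
  obtain ⟨q, hq0, hq1, hgap⟩ := exists_spectral_gap
  have hM : 0 < ∫ x, eta 0 x := integral_eta_zero_pos
  have hK : 0 < ∫ x, eta 0 x * blackSoliton x ^ 2 := by
    simpa using integral_eta_zero_mul_even_pow_pos 1
  -- The form equals `W - A - b² M`. The term `2/M` pays for the negative direction and its share of
  -- the norm; `1/K` pays for the share of the kernel direction.
  refine ⟨(1 - q) / 2, 2 / (∫ x, eta 0 x) + 1 / (∫ x, eta 0 x * blackSoliton x ^ 2),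
    by linarith, by positivity, fun f g h => ?_⟩
  obtain ⟨a, b, w, w', hw, -, hw0, hw1, e1, e2, e3, e4⟩ := exists_decomposition h
  have hg := hgap w w' hw hw0 hw1
  have hW0 := integral_eta_sq_nonneg w
  rw [energyNormSq, e1, e2, e3, e4]
  generalize (∫ x, eta 0 x) = M at *
  generalize (∫ x, eta 0 x * blackSoliton x ^ 2) = K at *
  generalize (∫ x, w' x ^ 2) = W at *
  generalize (∫ x, eta 0 x * w x ^ 2) = A at *
  have hW1 : 0 ≤ W := by
    by_contra hn
    push Not at hn
    nlinarith
  have hWA : (1 - q) / 2 * (W + A) ≤ W - A := by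
    nlinarith [mul_nonneg (by linarith : 0 ≤ 3 - q) (sub_nonneg.2 hg),
      mul_nonneg (sq_nonneg (1 - q)) hW1]
  have t1 : 2 / M * (b * M) ^ 2 = 2 * b ^ 2 * M := by field_simp
  have t2 : 1 / K * (a * K) ^ 2 = a ^ 2 * K := by field_simp
  have t3 : 0 ≤ 1 / K * (b * M) ^ 2 := by positivity
  have t4 : 0 ≤ 2 / M * (a * K) ^ 2 := by positivity
  have t5 : 0 ≤ q * (b ^ 2 * M) := by positivity
  have t6 : 0 ≤ q * (a ^ 2 * K) := by positivity
  have t7 : 0 ≤ b ^ 2 * M := by positivity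
  nlinarith

/-! ### The superlinear part of the potential and the kernel direction. -/

/-- The variation `|φ₀ + p + i q|² - φ₀²` of the squared modulus. -/
noncomputable def modVar (p q : ℝ → ℝ) (x : ℝ) : ℝ :=
  2 * blackSoliton x * p x + p x ^ 2 + q x ^ 2

/-- The part of the potential energy which is superlinear in `modVar`. -/
noncomputable def potentialRemainder (p q : ℝ → ℝ) (x : ℝ) : ℝ :=
  blackSoliton x ^ 2 * modVar p q x ^ 2 + modVar p q x ^ 3 / 3

theorem neg_sq_le_modVar (p q : ℝ → ℝ) (x : ℝ) : -blackSoliton x ^ 2 ≤ modVar p q x := by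
  rw [modVar]
  nlinarith [sq_nonneg (blackSoliton x + p x), sq_nonneg (q x)]

/-- The remainder is `m² (φ₀² + m/3)`, and `m ≥ -φ₀²` because `φ₀² + m` is a squared modulus. No
smallness of the perturbation is needed. -/
theorem le_potentialRemainder (p q : ℝ → ℝ) (x : ℝ) :
    2 / 3 * (blackSoliton x ^ 2 * modVar p q x ^ 2) ≤ potentialRemainder p q x := by
  rw [potentialRemainder]
  nlinarith [neg_sq_le_modVar p q x, sq_nonneg (modVar p q x),
    mul_nonneg (sq_nonneg (modVar p q x)) (by linarith [neg_sq_le_modVar p q x] :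
      0 ≤ modVar p q x + blackSoliton x ^ 2)]

theorem potentialRemainder_nonneg (p q : ℝ → ℝ) (x : ℝ) : 0 ≤ potentialRemainder p q x :=
  le_trans (by positivity) (le_potentialRemainder p q x)

section Core

variable {p p' q q' : ℝ → ℝ}

theorem continuous_modVar (hp : Continuous p) (hq : Continuous q) : Continuous (modVar p q) := by
  unfold modVar
  exact ((((continuous_const.mul continuous_blackSoliton).mul hp).add (hp.pow 2)).add (hq.pow 2))

theorem integrable_sq_mul_modVar_sq (hp : Continuous p) (hq : Continuous q)
    (hP : Integrable (potentialRemainder p q)) :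
    Integrable fun x => blackSoliton x ^ 2 * modVar p q x ^ 2 := by
  refine (hP.const_mul (3 / 2)).mono' ((continuous_blackSoliton.pow 2).mul
    ((continuous_modVar hp hq).pow 2)).aestronglyMeasurable (.of_forall fun x => ?_)
  rw [Real.norm_of_nonneg (by positivity)]
  linarith [le_potentialRemainder p q x]

theorem integral_sq_mul_modVar_sq_le (hp : Continuous p) (hq : Continuous q)
    (hP : Integrable (potentialRemainder p q)) :
    ∫ x, blackSoliton x ^ 2 * modVar p q x ^ 2 ≤ 3 / 2 * ∫ x, potentialRemainder p q x := by
  rw [← integral_const_mul]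
  exact integral_mono (integrable_sq_mul_modVar_sq hp hq hP) (hP.const_mul _)
    fun x => by simp only; linarith [le_potentialRemainder p q x]

theorem InEnergySpace.sq_integral_mul_le {f g : ℝ → ℝ} (h : InEnergySpace f g) {b : ℝ → ℝ}
    (hb : Continuous b) (hb1 : ∀ x, |b x| ≤ 1) :
    (∫ x, eta 0 x * (b x * f x)) ^ 2 ≤ (∫ x, eta 0 x) * ∫ x, eta 0 x * f x ^ 2 := by
  have hle : ∀ x, eta 0 x * (b x * f x) ^ 2 ≤ eta 0 x * f x ^ 2 := fun x => by
    have h1 := eta_zero_pos x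
    rw [mul_pow]
    gcongr
    exact mul_le_of_le_one_left (sq_nonneg _) ((sq_le_one_iff_abs_le_one _).2 (hb1 x))
  have hi : Integrable fun x => eta 0 x * (b x * f x) ^ 2 := by
    refine h.integrable.mono' (continuous_eta_zero.mul
      ((hb.mul h.continuous).pow 2)).aestronglyMeasurable (.of_forall fun x => ?_)
    rw [Real.norm_of_nonneg (mul_nonneg (eta_zero_pos x).le (sq_nonneg _))]
    exact hle x
  refine (sq_integral_weight_le (fun x => (eta_zero_pos x).le) integrable_eta_zero
    (hb.mul h.continuous).aestronglyMeasurable hi).2.trans ?_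
  exact mul_le_mul_of_nonneg_left (integral_mono hi h.integrable hle) integral_eta_zero_pos.le

theorem sq_integral_mul_modVar_le (hp : Continuous p) (hq : Continuous q)
    (hP : Integrable (potentialRemainder p q)) :
    (∫ x, eta 0 x * (blackSoliton x ^ 2 * modVar p q x)) ^ 2 ≤
      (∫ x, eta 0 x) * (3 / 2 * ∫ x, potentialRemainder p q x) := by
  have iX := integrable_sq_mul_modVar_sq hp hq hP
  have hle : ∀ x, eta 0 x * (blackSoliton x ^ 2 * modVar p q x) ^ 2 ≤
      blackSoliton x ^ 2 * modVar p q x ^ 2 := fun x => by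
    have h0 := eta_zero_pos x
    have h1 := eta_zero_le_one x
    have h2 := blackSoliton_sq_le_one x
    calc eta 0 x * (blackSoliton x ^ 2 * modVar p q x) ^ 2
        = eta 0 x * (blackSoliton x ^ 2 * (blackSoliton x ^ 2 * modVar p q x ^ 2)) := by ring
      _ ≤ 1 * (1 * (blackSoliton x ^ 2 * modVar p q x ^ 2)) := by gcongr
      _ = _ := by ring
  have hc : Continuous fun x => blackSoliton x ^ 2 * modVar p q x :=
    (continuous_blackSoliton.pow 2).mul (continuous_modVar hp hq)
  have hi : Integrable fun x => eta 0 x * (blackSoliton x ^ 2 * modVar p q x) ^ 2 := by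
    refine iX.mono' (continuous_eta_zero.mul (hc.pow 2)).aestronglyMeasurable
      (.of_forall fun x => ?_)
    rw [Real.norm_of_nonneg (mul_nonneg (eta_zero_pos x).le (sq_nonneg _))]
    exact hle x
  refine (sq_integral_weight_le (fun x => (eta_zero_pos x).le) integrable_eta_zero
    hc.aestronglyMeasurable hi).2.trans (mul_le_mul_of_nonneg_left ?_ integral_eta_zero_pos.le)
  exact (integral_mono hi iX hle).trans (integral_sq_mul_modVar_sq_le hp hq hP)

theorem integral_mul_sq_add_sq (hp : InEnergySpace p p') (hq : InEnergySpace q q') :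
    Integrable (fun x => eta 0 x * (blackSoliton x ^ 2 * (p x ^ 2 + q x ^ 2))) ∧
    0 ≤ (∫ x, eta 0 x * (blackSoliton x ^ 2 * (p x ^ 2 + q x ^ 2))) ∧
    (∫ x, eta 0 x * (blackSoliton x ^ 2 * (p x ^ 2 + q x ^ 2))) ≤
      energyNormSq p p' + energyNormSq q q' := by
  have hle : ∀ x, eta 0 x * (blackSoliton x ^ 2 * (p x ^ 2 + q x ^ 2)) ≤
      eta 0 x * p x ^ 2 + eta 0 x * q x ^ 2 := fun x => by
    have h1 := eta_zero_pos x
    rw [← mul_add]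
    gcongr
    exact mul_le_of_le_one_left (by positivity) (blackSoliton_sq_le_one x)
  have h0 : ∀ x, 0 ≤ eta 0 x * (blackSoliton x ^ 2 * (p x ^ 2 + q x ^ 2)) := fun x =>
    mul_nonneg (eta_zero_pos x).le (by positivity)
  have hi : Integrable fun x => eta 0 x * (blackSoliton x ^ 2 * (p x ^ 2 + q x ^ 2)) := by
    refine (hp.integrable.add hq.integrable).mono' (continuous_eta_zero.mul
      ((continuous_blackSoliton.pow 2).mul
      ((hp.continuous.pow 2).add (hq.continuous.pow 2)))).aestronglyMeasurable
      (.of_forall fun x => ?_)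
    rw [Real.norm_of_nonneg (h0 x)]
    exact hle x
  refine ⟨hi, integral_nonneg h0, ?_⟩
  have l := integral_mono hi (hp.integrable.add hq.integrable) hle
  rw [integral_add' hp.integrable hq.integrable] at l
  have h1 : 0 ≤ ∫ x, p' x ^ 2 := integral_nonneg fun _ => sq_nonneg _
  have h2 : 0 ≤ ∫ x, q' x ^ 2 := integral_nonneg fun _ => sq_nonneg _
  rw [energyNormSq, energyNormSq]
  linarith

/-- Multiplying the identity for `2 a L` by `L a` and using Young's inequality leaves the product `a
I₃`. Since `|a| ≤ N/√K` and `I₃ ≤ N²`, it is a cubic error. -/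
theorem component_bound_aux {M K L N Q A a b I₁ I₂ I₃ : ℝ} (hM : 0 < M) (hK : 0 < K) (hL : 0 < L)
    (hN0 : 0 ≤ N) (hQ0 : 0 ≤ Q) (hA0 : 0 ≤ A) (hid : 2 * a * L = I₁ - 2 * I₂ - I₃)
    (b1 : I₁ ^ 2 ≤ M * (3 / 2 * Q)) (b2 : I₂ ^ 2 ≤ M * (A + b ^ 2 * M)) (h30 : 0 ≤ I₃)
    (h3 : I₃ ≤ N ^ 2) (ha : |a| * √K ≤ N) :
    a ^ 2 ≤ (3 * M / (4 * L ^ 2) + 2 * M / L ^ 2 + 2 * M ^ 2 / L ^ 2 + 1 / (L * √K))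
      * (Q + A + b ^ 2 + N ^ 3) := by
  have hKs : 0 < √K := Real.sqrt_pos.2 hK
  have b3 : -(a * I₃) ≤ N ^ 3 / √K := by
    rw [le_div_iff₀ hKs]
    have h1 : -a ≤ |a| := neg_le_abs a
    calc -(a * I₃) * √K = (-a) * √K * I₃ := by ring
      _ ≤ |a| * √K * I₃ := by gcongr
      _ ≤ N * N ^ 2 := by gcongr
      _ = N ^ 3 := by ring
  have hfin : L ^ 2 * a ^ 2 ≤ I₁ ^ 2 / 2 + 2 * I₂ ^ 2 + L * (N ^ 3 / √K) := by
    have e : 2 * L ^ 2 * a ^ 2 = (L * a) * (I₁ - 2 * I₂) + L * (-(a * I₃)) := by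
      linear_combination (L * a) * hid
    have h1 : L * (-(a * I₃)) ≤ L * (N ^ 3 / √K) := mul_le_mul_of_nonneg_left b3 hL.le
    have h2 : (L * a) * (I₁ - 2 * I₂) ≤ L ^ 2 * a ^ 2 + (I₁ - 2 * I₂) ^ 2 / 4 := by
      linarith [sq_nonneg (L * a - (I₁ - 2 * I₂) / 2)]
    have h3 : (I₁ - 2 * I₂) ^ 2 / 4 ≤ I₁ ^ 2 / 2 + 2 * I₂ ^ 2 := by
      linarith [sq_nonneg (I₁ + 2 * I₂)]
    linarith
  have hN3 : 0 ≤ N ^ 3 := by positivity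
  have hb2 : 0 ≤ b ^ 2 := sq_nonneg b
  have hstep : a ^ 2 ≤ 3 * M / (4 * L ^ 2) * Q + 2 * M / L ^ 2 * A + 2 * M ^ 2 / L ^ 2 * b ^ 2
      + 1 / (L * √K) * N ^ 3 := by
    have : L ^ 2 * a ^ 2 ≤ L ^ 2 * (3 * M / (4 * L ^ 2) * Q + 2 * M / L ^ 2 * A
        + 2 * M ^ 2 / L ^ 2 * b ^ 2 + 1 / (L * √K) * N ^ 3) := by
      have e : L ^ 2 * (3 * M / (4 * L ^ 2) * Q + 2 * M / L ^ 2 * A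
        + 2 * M ^ 2 / L ^ 2 * b ^ 2 + 1 / (L * √K) * N ^ 3)
        = M * (3 / 2 * Q) / 2 + 2 * (M * (A + b ^ 2 * M)) + L * (N ^ 3 / √K) := by
        field_simp; ring
      rw [e]; linarith
    exact le_of_mul_le_mul_left this (by positivity)
  refine hstep.trans ?_
  have k1 : 0 ≤ 3 * M / (4 * L ^ 2) := by positivity
  have k2 : 0 ≤ 2 * M / L ^ 2 := by positivity
  have k3 : 0 ≤ 2 * M ^ 2 / L ^ 2 := by positivity
  have k4 : 0 ≤ 1 / (L * √K) := by positivity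
  have s1 : Q ≤ Q + A + b ^ 2 + N ^ 3 := by linarith
  have s2 : A ≤ Q + A + b ^ 2 + N ^ 3 := by linarith
  have s3 : b ^ 2 ≤ Q + A + b ^ 2 + N ^ 3 := by linarith
  have s4 : N ^ 3 ≤ Q + A + b ^ 2 + N ^ 3 := by linarith
  rw [add_mul, add_mul, add_mul]
  gcongr

/-- The component along the black soliton is controlled by the variation of the modulus. -/
theorem exists_component_bound : ∃ C : ℝ, 0 ≤ C ∧ ∀ p p' q q' w w' : ℝ → ℝ, ∀ a b : ℝ,
    InEnergySpace p p' → InEnergySpace q q' → InEnergySpace w w' →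
    Integrable (potentialRemainder p q) →
    (∀ x, p x = a * blackSoliton x + (b + w x)) → (∫ x, eta 0 x * w x) = 0 →
    a ^ 2 * (∫ x, eta 0 x * blackSoliton x ^ 2) ≤ energyNormSq p p' + energyNormSq q q' →
    a ^ 2 ≤ C * ((∫ x, potentialRemainder p q x) + (∫ x, eta 0 x * w x ^ 2) + b ^ 2
      + √(energyNormSq p p' + energyNormSq q q') ^ 3) := by
  have hM : 0 < ∫ x, eta 0 x := integral_eta_zero_pos
  have hK : 0 < ∫ x, eta 0 x * blackSoliton x ^ 2 := by
    simpa using integral_eta_zero_mul_even_pow_pos 1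
  have hL : 0 < ∫ x, eta 0 x * blackSoliton x ^ 4 := by
    simpa using integral_eta_zero_mul_even_pow_pos 2
  set M := ∫ x, eta 0 x with hMd
  set K := ∫ x, eta 0 x * blackSoliton x ^ 2 with hKd
  set L := ∫ x, eta 0 x * blackSoliton x ^ 4 with hLd
  refine ⟨3 * M / (4 * L ^ 2) + 2 * M / L ^ 2 + 2 * M ^ 2 / L ^ 2 + 1 / (L * √K), by positivity, ?_⟩
  intro p p' q q' w w' a b hp hq hw hP hdec hw0 haK
  have hn0 : 0 ≤ energyNormSq p p' + energyNormSq q q' :=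
    add_nonneg (energyNormSq_nonneg _ _) (energyNormSq_nonneg _ _)
  have hv : InEnergySpace (fun x => b + w x) (fun x => 0 + w' x) := (inEnergySpace_const b).add hw
  have j2 := hv.integrable_mul_mul (b := fun x => blackSoliton x ^ 3)
    (continuous_blackSoliton.pow 3) (abs_blackSoliton_pow_le_one 3)
  have c2 := hv.sq_integral_mul_le (b := fun x => blackSoliton x ^ 3)
    (continuous_blackSoliton.pow 3) (abs_blackSoliton_pow_le_one 3)
  have c2' : (∫ x, eta 0 x * (b + w x) ^ 2) = (∫ x, eta 0 x * w x ^ 2) + b ^ 2 * M := by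
    have l := integral_lin3 hw.integrable hw.integrable_mul integrable_eta_zero 1 (2 * b) (b ^ 2)
    rw [hw0, ← hMd] at l
    calc _ = ∫ x, (1 * (eta 0 x * w x ^ 2) + 2 * b * (eta 0 x * w x) + b ^ 2 * eta 0 x) :=
          integral_congr_ae (.of_forall fun x => by simp only; ring)
      _ = _ := by rw [l]; ring
  obtain ⟨j3, h30, h3⟩ := integral_mul_sq_add_sq hp hq
  refine component_bound_aux hM hK hL (Real.sqrt_nonneg _)
    (integral_nonneg fun x => potentialRemainder_nonneg p q x) (integral_eta_sq_nonneg w) ?_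
    (sq_integral_mul_modVar_le hp.continuous hq.continuous hP) (c2' ▸ c2) h30
    (by rwa [Real.sq_sqrt hn0]) ?_
  -- Testing `m = 2 φ₀ p + p² + q²` against `η₀ φ₀²` isolates `a`: its coefficient `2 ∫ η₀ φ₀⁴` is
  -- positive.
  · have l := integral_lin3 (integrable_eta_zero_mul_pow 4) j2 j3 (2 * a) 2 1
    have : ∫ x, eta 0 x * (blackSoliton x ^ 2 * modVar p q x)
        = ∫ x, (2 * a * (eta 0 x * blackSoliton x ^ 4)
        + 2 * (eta 0 x * (blackSoliton x ^ 3 * (b + w x)))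
        + 1 * (eta 0 x * (blackSoliton x ^ 2 * (p x ^ 2 + q x ^ 2)))) := by
      refine integral_congr_ae (.of_forall fun x => ?_)
      simp only [modVar]
      linear_combination (2 * eta 0 x * blackSoliton x ^ 3) * hdec x
    rw [this, l]; ring
  · rw [← Real.sqrt_sq_eq_abs, ← Real.sqrt_mul (sq_nonneg a)]
    exact Real.sqrt_le_sqrt haK

end Core

/-- The quadratic form does not see `a`, which enters the norm `np`. Bound `ha` replaces it by
quantities that the form, the remainder or the error terms control. -/
theorem coercivity_aux {M K r C₁ C₂ δ δ₂ ε B N3 Q W A a b np nq J₁ J₂ Bq : ℝ} (hM : 0 < M)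
    (hK : 0 < K) (hr0 : 0 ≤ r) (hr1 : r < 1) (hC₁ : 0 ≤ C₁) (hC₂ : 0 ≤ C₂) (hB : B = 2 + 2 * K * C₁)
    (hε : ε = (1 - r) / (2 * B)) (hδ : 0 < δ) (m1 : δ ≤ ε) (m2 : δ ≤ δ₂) (m3 : δ ≤ (1 - r) / 2)
    (hg : A ≤ r * W) (hW0 : 0 ≤ W) (hQ0 : 0 ≤ Q) (hN3 : 0 ≤ N3) (hnp : 0 ≤ np) (hnq : 0 ≤ nq)
    (hNp : np = W + A + b ^ 2 * M + 2 * (a ^ 2 * K))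
    (ha : a ^ 2 ≤ C₁ * (Q + A + b ^ 2 + N3))
    (hq : δ₂ * nq - C₂ * (J₁ ^ 2 + J₂ ^ 2) ≤ Bq) :
    δ * (np + nq + Q) - (C₂ + 1 / M + ε * (B / M ^ 2 + 1 / M + B)) *
      ((b * M) ^ 2 + J₁ ^ 2 + J₂ ^ 2 + N3) ≤ W - A - b ^ 2 * M + Bq + Q := by
  have hBpos : 0 < B := by rw [hB]; positivity
  have hεpos : 0 < ε := hδ.trans_le m1
  have hAW : A ≤ W := hg.trans (mul_le_of_le_one_left hW0 hr1.le)
  have hbM : b ^ 2 * M = 1 / M * (b * M) ^ 2 := by field_simp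
  have hbound : np ≤ B * (W + Q + N3) + (B / M ^ 2 + 1 / M) * (b * M) ^ 2 := by
    have h1 : 2 * (a ^ 2 * K) ≤ 2 * K * C₁ * (Q + W + b ^ 2 + N3) := by
      have h2 : a ^ 2 ≤ C₁ * (Q + W + b ^ 2 + N3) :=
        ha.trans (mul_le_mul_of_nonneg_left (by linarith) hC₁)
      calc 2 * (a ^ 2 * K) = 2 * K * a ^ 2 := by ring
        _ ≤ 2 * K * (C₁ * (Q + W + b ^ 2 + N3)) := by gcongr
        _ = _ := by ring
    have h3 : (B / M ^ 2 + 1 / M) * (b * M) ^ 2 = B * b ^ 2 + b ^ 2 * M := by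
      field_simp
    rw [h3, hNp, hB]
    have h4 := sq_nonneg b
    linarith
  have hεB : ε * B = (1 - r) / 2 := by rw [hε]; field_simp
  have f1 : δ * np ≤ ε * B * (W + Q + N3) + ε * (B / M ^ 2 + 1 / M) * (b * M) ^ 2 := by
    calc δ * np ≤ ε * np := by gcongr
      _ ≤ ε * (B * (W + Q + N3) + (B / M ^ 2 + 1 / M) * (b * M) ^ 2) := by gcongr
      _ = _ := by ring
  have f2 : δ * nq ≤ δ₂ * nq := by gcongr
  have f3 : δ * Q ≤ (1 - r) / 2 * Q := by gcongr
  have z1 : 0 ≤ C₂ * ((b * M) ^ 2 + N3) := by positivity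
  have z2 : 0 ≤ 1 / M * (J₁ ^ 2 + J₂ ^ 2 + N3) := by positivity
  have z3 : 0 ≤ ε * (B / M ^ 2 + 1 / M) * (J₁ ^ 2 + J₂ ^ 2 + N3) := by positivity
  have z4 : 0 ≤ ε * B * ((b * M) ^ 2 + J₁ ^ 2 + J₂ ^ 2) := by positivity
  have f4 : (C₂ + 1 / M + ε * (B / M ^ 2 + 1 / M + B)) * ((b * M) ^ 2 + J₁ ^ 2 + J₂ ^ 2 + N3)
      = C₂ * (J₁ ^ 2 + J₂ ^ 2) + C₂ * ((b * M) ^ 2 + N3) + 1 / M * (b * M) ^ 2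
        + 1 / M * (J₁ ^ 2 + J₂ ^ 2 + N3) + ε * (B / M ^ 2 + 1 / M) * (b * M) ^ 2
        + ε * (B / M ^ 2 + 1 / M) * (J₁ ^ 2 + J₂ ^ 2 + N3)
        + ε * B * ((b * M) ^ 2 + J₁ ^ 2 + J₂ ^ 2) + ε * B * N3 := by ring
  have f5 : ε * B * (W + Q + N3) = (1 - r) / 2 * W + (1 - r) / 2 * Q + ε * B * N3 := by
    rw [← hεB]; ring
  have f6 : (1 - r) / 2 * W + (1 - r) / 2 * W ≤ W - A := by linarith
  have f7 : 0 ≤ (1 - r) / 2 * W := mul_nonneg (by linarith) hW0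
  have f8 : (1 - r) / 2 * Q + (1 - r) / 2 * Q ≤ Q := by
    have : 0 ≤ r * Q := by positivity
    linarith
  rw [f4, hbM]
  linarith

/-- Coercivity of the energy around the black soliton, with explicit error terms. -/
theorem exists_coercivity : ∃ δ C : ℝ, 0 < δ ∧ 0 ≤ C ∧ ∀ p p' q q' : ℝ → ℝ,
    InEnergySpace p p' → InEnergySpace q q' → Integrable (potentialRemainder p q) →
    δ * (energyNormSq p p' + energyNormSq q q' + ∫ x, potentialRemainder p q x)
      - C * ((∫ x, eta 0 x * p x) ^ 2 + (∫ x, eta 0 x * q x) ^ 2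
        + (∫ x, eta 0 x * (blackSoliton x * q x)) ^ 2
        + √(energyNormSq p p' + energyNormSq q q') ^ 3) ≤
    ((∫ x, p' x ^ 2) - ∫ x, eta 0 x * p x ^ 2) + ((∫ x, q' x ^ 2) - ∫ x, eta 0 x * q x ^ 2)
      + ∫ x, potentialRemainder p q x := by
  obtain ⟨r, hr0, hr1, hgap⟩ := exists_spectral_gap
  obtain ⟨C₁, hC₁, hcomp⟩ := exists_component_bound
  obtain ⟨δ₂, C₂, hδ₂, hC₂, hlin⟩ := exists_linear_coercivity
  have hM : 0 < ∫ x, eta 0 x := integral_eta_zero_pos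
  have hK : 0 < ∫ x, eta 0 x * blackSoliton x ^ 2 := by
    simpa using integral_eta_zero_mul_even_pow_pos 1
  set M := ∫ x, eta 0 x with hMd
  set K := ∫ x, eta 0 x * blackSoliton x ^ 2 with hKd
  set B := 2 + 2 * K * C₁ with hB
  have hBpos : 0 < B := by positivity
  -- Chosen so that `ε B = (1 - r)/2`: restoring the norm of `p` spends at most half of the spectral
  -- gap and half of the remainder.
  set ε := (1 - r) / (2 * B) with hε
  have hεpos : 0 < ε := div_pos (by linarith) (by positivity)
  have hδ : 0 < min ε (min δ₂ ((1 - r) / 2)) := lt_min hεpos (lt_min hδ₂ (by linarith))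
  refine ⟨min ε (min δ₂ ((1 - r) / 2)), C₂ + 1 / M + ε * (B / M ^ 2 + 1 / M + B),
    hδ, by positivity, ?_⟩
  intro p p' q q' hp hq hP
  obtain ⟨a, b, w, w', hw, hdec, hw0, hw1, e1, e2, e3, e4⟩ := exists_decomposition hp
  rw [← hMd] at e1 e4
  rw [← hKd] at e3 e4
  have hA0 := integral_eta_sq_nonneg w
  have hnq := energyNormSq_nonneg q q'
  have hW0 : 0 ≤ ∫ x, w' x ^ 2 := integral_nonneg fun _ => sq_nonneg _
  have hNp : energyNormSq p p' = (∫ x, w' x ^ 2) + (∫ x, eta 0 x * w x ^ 2) + b ^ 2 * M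
      + 2 * (a ^ 2 * K) := by rw [energyNormSq, e3, e4]; ring
  have ha := hcomp p p' q q' w w' a b hp hq hw hP hdec hw0 (by
    have : 0 ≤ a ^ 2 * K := by positivity
    have : 0 ≤ b ^ 2 * M := by positivity
    rw [hNp]; linarith)
  have key := coercivity_aux hM hK hr0.le hr1 hC₁ hC₂ hB hε hδ (min_le_left _ _)
    ((min_le_right _ _).trans (min_le_left _ _)) ((min_le_right _ _).trans (min_le_right _ _))
    (hgap w w' hw hw0 hw1) hW0 (integral_nonneg fun x => potentialRemainder_nonneg p q x)
    (by positivity) (energyNormSq_nonneg p p') hnq hNp ha (hlin q q' hq)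
  rw [e1]
  refine key.trans (le_of_eq ?_)
  rw [e3, e4]; ring

/-! ### Parameters of the dark profiles -/

/-- The parameter `√(3c² + 4) - 2`, in which all the coefficients of the dark profile are simple. -/
noncomputable def tauParam (c : ℝ) : ℝ := √(3 * c ^ 2 + 4) - 2

theorem tauParam_add_two_sq (c : ℝ) : (tauParam c + 2) ^ 2 = 3 * c ^ 2 + 4 := by
  rw [tauParam, sub_add_cancel, Real.sq_sqrt (by positivity)]

theorem tauParam_nonneg (c : ℝ) : 0 ≤ tauParam c := by
  have : √(2 ^ 2) ≤ √(3 * c ^ 2 + 4) := Real.sqrt_le_sqrt (by nlinarith [sq_nonneg c])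
  rw [Real.sqrt_sq (by norm_num)] at this
  rw [tauParam]; linarith

theorem tauParam_pos {c : ℝ} (hc : c ≠ 0) : 0 < tauParam c := by
  refine (tauParam_nonneg c).lt_of_ne fun h => hc ?_
  have := tauParam_add_two_sq c
  rw [← h] at this
  have : c ^ 2 = 0 := by linarith
  exact pow_eq_zero_iff (by norm_num) |>.1 this

theorem tauParam_le (c : ℝ) : tauParam c ≤ 3 / 4 * c ^ 2 := by
  have := tauParam_add_two_sq c
  nlinarith [tauParam_nonneg c]

/-- With `τ = tauParam c` one has `3c² + 4 = (τ + 2)²`, and the radicand factors as `τ (6 + τ)²`.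
This removes the `0/0` of the defining fractions at `c = 0`. -/
theorem mu_denominator (c : ℝ) :
    √(18 * c ^ 2 - 8 + (3 * c ^ 2 + 4) ^ (3 / 2 : ℝ)) = √(tauParam c) * (6 + tauParam c) := by
  have h0 := tauParam_nonneg c
  have h1 : (3 * c ^ 2 + 4) ^ (3 / 2 : ℝ) = (tauParam c + 2) ^ 3 := by
    rw [← tauParam_add_two_sq, ← Real.rpow_natCast, ← Real.rpow_mul (by linarith),
      ← Real.rpow_natCast]
    norm_num
  have h2 : 18 * c ^ 2 - 8 + (tauParam c + 2) ^ 3 = tauParam c * (6 + tauParam c) ^ 2 := by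
    linear_combination -6 * tauParam_add_two_sq c
  rw [h1, h2, Real.sqrt_mul h0, Real.sqrt_sq (by linarith)]

theorem mu₁_eq {c : ℝ} (hc : c ≠ 0) : mu₁ c = √(tauParam c) := by
  have h0 := tauParam_pos hc
  have hs := Real.sqrt_pos.2 h0
  have h1 : √(3 * c ^ 2 + 4) = tauParam c + 2 := by rw [tauParam]; ring
  have h2 : 3 * c ^ 2 - 4 + 2 * (tauParam c + 2) = √(tauParam c) * (√(tauParam c) * (6 + tauParam c)) := by
    rw [← mul_assoc, Real.mul_self_sqrt h0.le]
    linear_combination -(tauParam_add_two_sq c)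
  rw [mu₁, mu_denominator, h1, h2]
  field_simp

theorem mu₂_sq {c : ℝ} (hc : c ≠ 0) (hc1 : |c| ≤ 1) :
    mu₂ c ^ 2 = (4 + tauParam c) * (2 - tauParam c) / (6 + tauParam c) := by
  have h0 := tauParam_pos hc
  have hc2 : c ^ 2 ≤ 1 := (sq_le_one_iff_abs_le_one c).2 hc1
  have h1 : c ^ 2 = tauParam c * (tauParam c + 4) / 3 := by
    linear_combination -(1 / 3) * tauParam_add_two_sq c
  rw [mu₂, mu_denominator, div_pow, mul_pow, mul_pow, mul_pow, Real.sq_sqrt h0.le,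
    Real.sq_sqrt (by linarith), h1]
  field_simp
  ring

theorem mu_eq {c : ℝ} (hc : c ≠ 0) (hc1 : |c| ≤ 1) :
    mu c = -(2 - tauParam c) / (6 + tauParam c) := by
  have h0 := tauParam_pos hc
  rw [mu, mu₂_sq hc hc1, mu₁_eq hc, Real.sq_sqrt h0.le]
  field_simp
  ring

/-- The sign of the dark profile at `+∞`, for small speeds. -/
noncomputable def profileSign (c : ℝ) : ℝ := if c < 0 then -1 else 1

theorem profileSign_sq (c : ℝ) : profileSign c ^ 2 = 1 := by
  rw [profileSign]; split_ifs <;> norm_num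

theorem abs_profileSign (c : ℝ) : |profileSign c| = 1 := by
  rw [profileSign]; split_ifs <;> norm_num

theorem mu₂_eq {c : ℝ} (hc : c ≠ 0) : mu₂ c = profileSign c * |mu₂ c| := by
  have h0 := tauParam_pos hc
  have h1 : 0 < √(18 * c ^ 2 - 8 + (3 * c ^ 2 + 4) ^ (3 / 2 : ℝ)) := by
    rw [mu_denominator]; have := Real.sqrt_pos.2 h0; positivity
  rw [profileSign]
  split_ifs with h
  · have : mu₂ c ≤ 0 := div_nonpos_of_nonpos_of_nonneg
      (mul_nonpos_of_nonpos_of_nonneg (by linarith) (Real.sqrt_nonneg _)) h1.le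
    rw [abs_of_nonpos this]; ring
  · have : 0 ≤ mu₂ c := div_nonneg (mul_nonneg (by linarith) (Real.sqrt_nonneg _)) h1.le
    rw [abs_of_nonneg this]; ring

theorem two_div_sqrt_three_sq : (2 / √3) ^ 2 = (4 : ℝ) / 3 := by
  rw [div_pow, Real.sq_sqrt (by norm_num)]; norm_num

theorem one_le_two_div_sqrt_three : 1 ≤ 2 / √3 := by
  have h := two_div_sqrt_three_sq
  have : 0 < 2 / √3 := by positivity
  nlinarith

theorem two_div_sqrt_three_le : 2 / √3 ≤ 3 / 2 := by
  have h := two_div_sqrt_three_sq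
  have : 0 < 2 / √3 := by positivity
  nlinarith

/-- The squares differ by at most `τ ≤ |c|`, and dividing by the sum of the two numbers is harmless
since `2/√3 ≥ 1`. -/
theorem abs_mu₂_sub_le {c : ℝ} (hc : c ≠ 0) (hc1 : |c| ≤ 1) : |(|mu₂ c| - 2 / √3)| ≤ |c| := by
  have h0 := tauParam_pos hc
  have h1 := tauParam_le c
  have hc2 : |c| ^ 2 = c ^ 2 := sq_abs c
  have h2 : tauParam c ≤ |c| := by nlinarith [abs_nonneg c]
  have h3 := mu₂_sq hc hc1
  rw [← sq_abs] at h3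
  have h4 := two_div_sqrt_three_sq
  have h5 := one_le_two_div_sqrt_three
  have h6 := abs_nonneg (mu₂ c)
  have h7 : |mu₂ c| ^ 2 - (2 / √3) ^ 2
      = -((10 * tauParam c + 3 * tauParam c ^ 2) / (3 * (6 + tauParam c))) := by
    rw [h3, h4]; field_simp; ring
  have h8 : (10 * tauParam c + 3 * tauParam c ^ 2) / (3 * (6 + tauParam c)) ≤ tauParam c := by
    rw [div_le_iff₀ (by positivity)]; nlinarith
  have h9 : 0 ≤ (10 * tauParam c + 3 * tauParam c ^ 2) / (3 * (6 + tauParam c)) := by positivity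
  generalize 2 / √3 = ν at *
  generalize |mu₂ c| = u at *
  generalize (10 * tauParam c + 3 * tauParam c ^ 2) / (3 * (6 + tauParam c)) = r at *
  rw [abs_le]
  constructor <;> nlinarith

theorem sqrt_tauParam_le {c : ℝ} : √(tauParam c) ≤ |c| := by
  rw [← Real.sqrt_sq_eq_abs]
  exact Real.sqrt_le_sqrt (by nlinarith [tauParam_le c, sq_nonneg c])

theorem tauParam_le_abs {c : ℝ} (hc1 : |c| ≤ 1) : tauParam c ≤ |c| := by
  nlinarith [tauParam_le c, sq_abs c, abs_nonneg c]

theorem mu_mem {c : ℝ} (hc : c ≠ 0) (hc1 : |c| ≤ 1) :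
    -(1 / 3) ≤ mu c ∧ mu c ≤ 0 ∧ |mu c - -(1 / 3)| ≤ |c| := by
  have h0 := tauParam_pos hc
  have h2 := tauParam_le_abs hc1
  have e : mu c - -(1 / 3) = 4 * tauParam c / (3 * (6 + tauParam c)) := by
    rw [mu_eq hc hc1]; field_simp; ring
  have h3 : 0 ≤ 4 * tauParam c / (3 * (6 + tauParam c)) := by positivity
  refine ⟨by linarith, ?_, ?_⟩
  · rw [mu_eq hc hc1]
    exact div_nonpos_of_nonpos_of_nonneg (by linarith) (by linarith)
  · rw [e, abs_of_nonneg h3, div_le_iff₀ (by positivity)]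
    nlinarith

theorem kappa_mem {c : ℝ} (hc1 : |c| ≤ 1) : 1 / 2 ≤ kappa c ∧ kappa c ≤ 1 ∧ 1 - kappa c ≤ |c| := by
  have hc2 : c ^ 2 ≤ 1 := (sq_le_one_iff_abs_le_one c).2 hc1
  have h0 : 0 ≤ kappa c := by rw [kappa]; positivity
  have h1 : kappa c ^ 2 = 1 - c ^ 2 / 4 := by
    rw [kappa, div_pow, Real.sq_sqrt (by linarith)]; ring
  refine ⟨by nlinarith, by nlinarith [sq_nonneg c], ?_⟩
  nlinarith [sq_abs c, abs_nonneg c]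

/-! ### Elementary estimates of hyperbolic functions -/

/-- Five powers of `1 + |x|` have to be absorbed, hence the fifth power of `(1 + |x|)/5 ≤ e^{|x|/5}`
and the constant `5⁵ = 3125`. -/
theorem one_add_abs_mul_exp_le (x : ℝ) : (1 + |x|) * Real.exp (-|x|) ≤ 3125 * ratWeight x := by
  have hx := abs_nonneg x
  have h1 : (1 + |x|) / 5 ≤ Real.exp (|x| / 5) := by linarith [Real.add_one_le_exp (|x| / 5)]
  have h2 : ((1 + |x|) / 5) ^ 5 ≤ Real.exp |x| := by
    calc ((1 + |x|) / 5) ^ 5 ≤ Real.exp (|x| / 5) ^ 5 := pow_le_pow_left₀ (by positivity) h1 5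
      _ = _ := by rw [← Real.exp_nat_mul]; congr 1; push_cast; ring
  have h3 : (1 + x ^ 2) ^ 2 ≤ ((1 + |x|) ^ 2) ^ 2 :=
    pow_le_pow_left₀ (by positivity) (by nlinarith [sq_abs x]) 2
  have he := Real.exp_pos |x|
  rw [Real.exp_neg, ratWeight, ← div_eq_mul_inv, ← div_eq_mul_inv,
    div_le_div_iff₀ he (by positivity)]
  calc (1 + |x|) * (1 + x ^ 2) ^ 2 ≤ (1 + |x|) * ((1 + |x|) ^ 2) ^ 2 := by gcongr
    _ = 3125 * ((1 + |x|) / 5) ^ 5 := by ring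
    _ ≤ _ := by gcongr

theorem sechSq_half_le (x : ℝ) : (1 + |x|) * sechSq (x / 2) ≤ 12500 * ratWeight x := by
  have h := sechSq_le_exp (x / 2)
  rw [abs_div, abs_two, show -2 * (|x| / 2) = -|x| by ring] at h
  have h2 := one_add_abs_mul_exp_le x
  have := mul_le_mul_of_nonneg_left h (by positivity : 0 ≤ 1 + |x|)
  linarith

theorem sechSq_kappa_le {k : ℝ} (hk : 1 / 2 ≤ k) (x : ℝ) : sechSq (k * x) ≤ 12500 * ratWeight x := by
  have h1 : sechSq (k * x) ≤ sechSq (x / 2) := by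
    refine sechSq_le_sechSq ?_
    rw [abs_mul, abs_div, abs_two, abs_of_nonneg (by linarith : 0 ≤ k)]
    nlinarith [abs_nonneg x]
  have := sechSq_half_le x
  nlinarith [mul_nonneg (abs_nonneg x) (sechSq_pos (x / 2)).le]

/-- Mean value inequality: every point between `x` and `k x` has modulus at least `|x|/2` because `k
≥ 1/2`, so the derivative is at most `sechSq (x / 2)`. -/
theorem abs_tanh_sub_le {k : ℝ} (hk : 1 / 2 ≤ k) (hk1 : k ≤ 1) (x : ℝ) :
    |Real.tanh (k * x) - Real.tanh x| ≤ 12500 * ((1 - k) * ratWeight x) := by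
  have hb : ∀ ξ ∈ uIcc x (k * x), ‖sechSq ξ‖ ≤ sechSq (x / 2) := by
    intro ξ hξ
    rw [Real.norm_of_nonneg (sechSq_pos ξ).le]
    refine sechSq_le_sechSq ?_
    rw [abs_div, abs_two]
    rw [mem_uIcc] at hξ
    rcases le_total 0 x with hx | hx
    · rw [abs_of_nonneg hx]
      have : k * x ≤ x := by nlinarith
      have : x / 2 ≤ ξ := by rcases hξ with h | h <;> nlinarith [h.1, h.2]
      exact this.trans (le_abs_self ξ)
    · rw [abs_of_nonpos hx]
      have : x ≤ k * x := by nlinarith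
      have : -x / 2 ≤ -ξ := by rcases hξ with h | h <;> nlinarith [h.1, h.2]
      exact this.trans (neg_le_abs ξ)
  have h := Convex.norm_image_sub_le_of_norm_hasDerivWithin_le (f := Real.tanh) (f' := sechSq)
    (fun ξ _ => (hasDerivAt_tanh ξ).hasDerivWithinAt) hb (convex_uIcc x (k * x)) left_mem_uIcc
    right_mem_uIcc
  rw [Real.norm_eq_abs, Real.norm_eq_abs] at h
  have e : |k * x - x| = (1 - k) * |x| := by
    rw [show k * x - x = -((1 - k) * x) by ring, abs_neg, abs_mul, abs_of_nonneg (by linarith)]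
  rw [e] at h
  have h2 := sechSq_half_le x
  have h3 : |x| * sechSq (x / 2) ≤ 12500 * ratWeight x := by linarith [sechSq_pos (x / 2)]
  calc _ ≤ sechSq (x / 2) * ((1 - k) * |x|) := h
    _ = (1 - k) * (|x| * sechSq (x / 2)) := by ring
    _ ≤ (1 - k) * (12500 * ratWeight x) := mul_le_mul_of_nonneg_left h3 (by linarith)
    _ = _ := by ring

/-! ### Real profiles -/

/-- The factor `(1 + m tanh²(kx))^{-1/2}`. -/
noncomputable def profileFactor (m k x : ℝ) : ℝ := (√(1 + m * Real.tanh (k * x) ^ 2))⁻¹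

section Factor

variable {m k : ℝ}

theorem one_add_mul_tanh_sq_mem (hm : -(1 / 3) ≤ m) (hm0 : m ≤ 0) (x : ℝ) :
    2 / 3 ≤ 1 + m * Real.tanh (k * x) ^ 2 ∧ 1 + m * Real.tanh (k * x) ^ 2 ≤ 1 := by
  have h1 := tanh_sq_lt_one (k * x)
  have h2 := sq_nonneg (Real.tanh (k * x))
  constructor <;> nlinarith

theorem profileFactor_sq (hm : -(1 / 3) ≤ m) (hm0 : m ≤ 0) (x : ℝ) :
    profileFactor m k x ^ 2 = (1 + m * Real.tanh (k * x) ^ 2)⁻¹ := by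
  rw [profileFactor, inv_pow, Real.sq_sqrt (by linarith [one_add_mul_tanh_sq_mem (k := k) hm hm0 x])]

theorem profileFactor_pos (hm : -(1 / 3) ≤ m) (hm0 : m ≤ 0) (x : ℝ) : 0 < profileFactor m k x :=
  inv_pos.2 (Real.sqrt_pos.2 (by linarith [one_add_mul_tanh_sq_mem (k := k) hm hm0 x]))

theorem profileFactor_mem (hm : -(1 / 3) ≤ m) (hm0 : m ≤ 0) (x : ℝ) :
    1 ≤ profileFactor m k x ∧ profileFactor m k x ≤ 3 / 2 := by
  have h := one_add_mul_tanh_sq_mem (k := k) hm hm0 x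
  have h0 := profileFactor_pos (k := k) hm hm0 x
  have h2 := profileFactor_sq (k := k) hm hm0 x
  have h3 : 1 ≤ (1 + m * Real.tanh (k * x) ^ 2)⁻¹ := (one_le_inv₀ (by linarith)).2 h.2
  have h4 : (1 + m * Real.tanh (k * x) ^ 2)⁻¹ ≤ (2 / 3)⁻¹ := inv_anti₀ (by norm_num) h.1
  constructor <;> nlinarith

theorem hasDerivAt_tanh_mul (x : ℝ) :
    HasDerivAt (fun y => Real.tanh (k * y)) (k * sechSq (k * x)) x := by
  have h := (hasDerivAt_tanh (k * x)).comp x ((hasDerivAt_id x).const_mul k)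
  refine HasDerivAt.congr_deriv h ?_
  rw [sechSq]; ring

theorem hasDerivAt_profileFactor (hm : -(1 / 3) ≤ m) (hm0 : m ≤ 0) (x : ℝ) :
    HasDerivAt (profileFactor m k)
      (-m * k * Real.tanh (k * x) * sechSq (k * x) * profileFactor m k x ^ 3) x := by
  have hp := one_add_mul_tanh_sq_mem (k := k) hm hm0 x
  have hs : 0 < √(1 + m * Real.tanh (k * x) ^ 2) := Real.sqrt_pos.2 (by linarith)
  have h := (((((hasDerivAt_tanh_mul (k := k) x).pow 2).const_mul m).const_add 1).sqrt
    (by simp only [Pi.pow_apply]; linarith)).inv (by simp only [Pi.pow_apply]; exact hs.ne')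
  refine HasDerivAt.congr_deriv h ?_
  simp only [Pi.pow_apply, profileFactor]
  field_simp
  push_cast
  ring

theorem hasDerivAt_tanh_mul_profileFactor (hm : -(1 / 3) ≤ m) (hm0 : m ≤ 0) (x : ℝ) :
    HasDerivAt (fun y => Real.tanh (k * y) * profileFactor m k y)
      (k * sechSq (k * x) * profileFactor m k x ^ 3) x := by
  refine HasDerivAt.congr_deriv ((hasDerivAt_tanh_mul (k := k) x).mul
    (hasDerivAt_profileFactor hm hm0 x)) ?_
  have h1 := profileFactor_sq (k := k) hm hm0 x
  have h2 := one_add_mul_tanh_sq_mem (k := k) hm hm0 x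
  have h3 : profileFactor m k x ^ 2 * (1 + m * Real.tanh (k * x) ^ 2) = 1 := by
    rw [h1]; exact inv_mul_cancel₀ (by linarith)
  linear_combination (-k * sechSq (k * x) * profileFactor m k x) * h3

theorem continuous_profileFactor (hm : -(1 / 3) ≤ m) (hm0 : m ≤ 0) :
    Continuous (profileFactor m k) :=
  continuous_iff_continuousAt.2 fun x => (hasDerivAt_profileFactor hm hm0 x).continuousAt

end Factor

/-- Places the black soliton in the same family as the dark profiles, with limiting parameters `m =
-1/3`, `k = 1` and amplitude `2/√3`, so the two are compared factor by factor. -/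
theorem blackSoliton_eq (x : ℝ) :
    blackSoliton x = 2 / √3 / √2 * (Real.tanh (1 * x) * profileFactor (-(1 / 3)) 1 x) := by
  have h3 : 0 < √(3:ℝ) := by positivity
  have h2 : 0 < √(2:ℝ) := by positivity
  have h : √(3 - Real.tanh x ^ 2) = √3 * √(1 + -(1 / 3) * Real.tanh (1 * x) ^ 2) := by
    rw [← Real.sqrt_mul (by norm_num), one_mul]; congr 1; ring
  have e : (√2 : ℝ) = 2 / √2 := by
    rw [eq_div_iff h2.ne']; exact Real.mul_self_sqrt (by norm_num)
  rw [blackSoliton, profileFactor, h, one_mul]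
  nth_rw 1 [e]
  simp only [div_eq_mul_inv, mul_inv]
  ring

theorem blackSolitonDeriv_eq (x : ℝ) :
    blackSolitonDeriv x = 2 / √3 / √2 * (1 * sechSq (1 * x) * profileFactor (-(1 / 3)) 1 x ^ 3) := by
  have h := (hasDerivAt_tanh_mul_profileFactor (m := -(1 / 3)) (k := 1) le_rfl (by norm_num)
    x).const_mul (2 / √3 / √2)
  rw [← show blackSoliton = _ from funext blackSoliton_eq] at h
  exact (hasDerivAt_blackSoliton x).unique h

theorem darkProfile_eq {c : ℝ} (hc : c ≠ 0) (x : ℝ) : darkProfile c x =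
    ((mu₂ c / √2 * (Real.tanh (kappa c * x) * profileFactor (mu c) (kappa c) x) : ℝ) : ℂ)
      + ((mu₁ c / √2 * profileFactor (mu c) (kappa c) x : ℝ) : ℂ) * Complex.I := by
  rw [darkProfile, if_neg hc, profileFactor]
  push_cast
  simp only [div_eq_mul_inv, mul_inv]
  ring

/-- The derivative of the dark profile. -/
noncomputable def darkProfileDeriv (c x : ℝ) : ℂ :=
  ((mu₂ c / √2 * (kappa c * sechSq (kappa c * x) * profileFactor (mu c) (kappa c) x ^ 3) : ℝ) : ℂ)
    + ((mu₁ c / √2 * (-mu c * kappa c * Real.tanh (kappa c * x) * sechSq (kappa c * x)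
      * profileFactor (mu c) (kappa c) x ^ 3) : ℝ) : ℂ) * Complex.I

theorem hasDerivAt_darkProfile {c : ℝ} (hc : c ≠ 0) (hc1 : |c| ≤ 1) (x : ℝ) :
    HasDerivAt (darkProfile c) (darkProfileDeriv c x) x := by
  obtain ⟨hm, hm0, -⟩ := mu_mem hc hc1
  have h1 := ((hasDerivAt_tanh_mul_profileFactor (k := kappa c) hm hm0 x).const_mul
    (mu₂ c / √2)).ofReal_comp
  have h2 := (((hasDerivAt_profileFactor (k := kappa c) hm hm0 x).const_mul
    (mu₁ c / √2)).ofReal_comp).mul_const Complex.I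
  rw [show darkProfile c = _ from funext (darkProfile_eq hc)]
  exact h1.add h2

theorem continuous_darkProfileDeriv {c : ℝ} (hc : c ≠ 0) (hc1 : |c| ≤ 1) :
    Continuous (darkProfileDeriv c) := by
  obtain ⟨hm, hm0, -⟩ := mu_mem hc hc1
  have h1 := continuous_profileFactor (k := kappa c) hm hm0
  have h2 := continuous_tanh
  have h3 := continuous_sechSq
  unfold darkProfileDeriv
  fun_prop

/-! ### Closeness of the dark profiles to the black soliton -/

theorem abs_mul_sub_mul_le {a b a' b' A B : ℝ} (hA : |a| ≤ A) (hB : |b'| ≤ B) :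
    |a * b - a' * b'| ≤ A * |b - b'| + B * |a - a'| := by
  calc |a * b - a' * b'| = |a * (b - b') + (a - a') * b'| := by congr 1; ring
    _ ≤ |a * (b - b')| + |(a - a') * b'| := abs_add_le _ _
    _ = |a| * |b - b'| + |b'| * |a - a'| := by rw [abs_mul, abs_mul, mul_comm |a - a'|]
    _ ≤ _ := by gcongr

/-- The squared factors are reciprocals of affine functions of `tanh²`, so their difference is
explicit; each factor is at least 1, so dividing by their sum loses nothing. -/
theorem abs_profileFactor_sub_le {c : ℝ} (hc : c ≠ 0) (hc1 : |c| ≤ 1) (x : ℝ) :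
    |profileFactor (mu c) (kappa c) x - profileFactor (-(1 / 3)) 1 x| ≤ 100000 * |c| := by
  obtain ⟨hm, hm0, hm1⟩ := mu_mem hc hc1
  obtain ⟨hk, hk1, hk2⟩ := kappa_mem hc1
  have ht := abs_tanh_sub_le hk hk1 x
  have hw := ratWeight_le_one x
  have hw0 := ratWeight_pos x
  have hc0 := abs_nonneg c
  have ht' : |Real.tanh (kappa c * x) - Real.tanh (1 * x)| ≤ 12500 * |c| := by
    rw [one_mul]
    refine ht.trans ?_
    have : (1 - kappa c) * ratWeight x ≤ |c| * 1 := mul_le_mul hk2 hw hw0.le hc0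
    linarith
  have a1 := profileFactor_mem (k := kappa c) hm hm0 x
  have a2 := profileFactor_mem (m := -(1 / 3)) (k := 1) le_rfl (by norm_num) x
  have s1 := profileFactor_sq (k := kappa c) hm hm0 x
  have s2 := profileFactor_sq (m := -(1 / 3)) (k := 1) le_rfl (by norm_num) x
  have p1 := one_add_mul_tanh_sq_mem (k := kappa c) hm hm0 x
  have p2 := one_add_mul_tanh_sq_mem (m := -(1 / 3)) (k := 1) le_rfl (by norm_num) x
  have b1 := (sq_le_one_iff_abs_le_one _).1 (tanh_sq_lt_one (kappa c * x)).le
  have b2 := (sq_le_one_iff_abs_le_one _).1 (tanh_sq_lt_one (1 * x)).le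
  generalize Real.tanh (kappa c * x) = t at *
  generalize Real.tanh (1 * x) = T at *
  generalize profileFactor (mu c) (kappa c) x = a at *
  generalize profileFactor (-(1 / 3)) 1 x = b at *
  have hT2 : |T ^ 2| ≤ 1 := by rw [abs_pow]; exact pow_le_one₀ (abs_nonneg _) b2
  have d1 : |t ^ 2 - T ^ 2| ≤ 2 * |t - T| := by
    have := abs_mul_sub_mul_le (b := t) (a' := T) b1 b2
    rw [sq, sq]; linarith
  have d2 : |mu c * t ^ 2 - -(1 / 3) * T ^ 2| ≤ 1 * |t ^ 2 - T ^ 2| + 1 * |mu c - -(1 / 3)| :=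
    abs_mul_sub_mul_le (by rw [abs_of_nonpos hm0]; linarith) hT2
  have d3 : |mu c * t ^ 2 - -(1 / 3) * T ^ 2| ≤ 25001 * |c| := by linarith
  have e : a ^ 2 - b ^ 2
      = -(a ^ 2 * b ^ 2 * (mu c * t ^ 2 - -(1 / 3) * T ^ 2)) := by
    have q1 : a ^ 2 * (1 + mu c * t ^ 2) = 1 := by rw [s1]; exact inv_mul_cancel₀ (by linarith)
    have q2 : b ^ 2 * (1 + -(1 / 3) * T ^ 2) = 1 := by rw [s2]; exact inv_mul_cancel₀ (by linarith)
    linear_combination b ^ 2 * q1 - a ^ 2 * q2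
  have e2 : |a ^ 2 - b ^ 2| ≤ 6 * (25001 * |c|) := by
    rw [e, abs_neg, abs_mul, abs_of_nonneg (by positivity)]
    have : a ^ 2 * b ^ 2 ≤ 6 := by
      have u1 : a ^ 2 ≤ 9 / 4 := by nlinarith
      have u2 : b ^ 2 ≤ 9 / 4 := by nlinarith
      nlinarith [sq_nonneg a, sq_nonneg b]
    exact mul_le_mul this d3 (abs_nonneg _) (by norm_num)
  have e3 : |a ^ 2 - b ^ 2| = |a - b| * (a + b) := by
    rw [show a ^ 2 - b ^ 2 = (a - b) * (a + b) by ring, abs_mul,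
      abs_of_nonneg (by linarith : 0 ≤ a + b)]
  have e4 : |a - b| * 2 ≤ |a - b| * (a + b) := mul_le_mul_of_nonneg_left (by linarith) (abs_nonneg _)
  linarith

theorem re_ofReal_add_ofReal_mul_I (a b : ℝ) : ((a : ℂ) + (b : ℂ) * Complex.I).re = a := by simp

theorem im_ofReal_add_ofReal_mul_I (a b : ℝ) : ((a : ℂ) + (b : ℂ) * Complex.I).im = b := by simp

theorem darkProfile_re {c : ℝ} (hc : c ≠ 0) (x : ℝ) : (darkProfile c x).re
    = mu₂ c / √2 * (Real.tanh (kappa c * x) * profileFactor (mu c) (kappa c) x) := by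
  rw [darkProfile_eq hc, re_ofReal_add_ofReal_mul_I]

theorem darkProfile_im {c : ℝ} (hc : c ≠ 0) (x : ℝ) :
    (darkProfile c x).im = mu₁ c / √2 * profileFactor (mu c) (kappa c) x := by
  rw [darkProfile_eq hc, im_ofReal_add_ofReal_mul_I]

theorem darkProfileDeriv_re (c x : ℝ) : (darkProfileDeriv c x).re =
    mu₂ c / √2 * (kappa c * sechSq (kappa c * x) * profileFactor (mu c) (kappa c) x ^ 3) := by
  rw [darkProfileDeriv, re_ofReal_add_ofReal_mul_I]

theorem darkProfileDeriv_im (c x : ℝ) : (darkProfileDeriv c x).im =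
    mu₁ c / √2 * (-mu c * kappa c * Real.tanh (kappa c * x) * sechSq (kappa c * x)
      * profileFactor (mu c) (kappa c) x ^ 3) := by
  rw [darkProfileDeriv, im_ofReal_add_ofReal_mul_I]

/-- The relation `μ₁² + μ₂² = 2 + 2μ` normalizes the modulus at infinity to 1. Hence squared moduli
differ by a decaying amount although the profiles themselves do not. -/
theorem one_sub_norm_darkProfile_sq {c : ℝ} (hc : c ≠ 0) (hc1 : |c| ≤ 1) (x : ℝ) :
    1 - ‖darkProfile c x‖ ^ 2 =
      (1 - tauParam c / 2) * (sechSq (kappa c * x) * profileFactor (mu c) (kappa c) x ^ 2) := by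
  obtain ⟨hm, hm0, -⟩ := mu_mem hc hc1
  have h0 := tauParam_pos hc
  have hn : ‖darkProfile c x‖ ^ 2 = (darkProfile c x).re ^ 2 + (darkProfile c x).im ^ 2 := by
    rw [← Complex.normSq_eq_norm_sq, Complex.normSq_apply]; ring
  have p1 := one_add_mul_tanh_sq_mem (k := kappa c) hm hm0 x
  have q1 : profileFactor (mu c) (kappa c) x ^ 2 * (1 + mu c * Real.tanh (kappa c * x) ^ 2) = 1 := by
    rw [profileFactor_sq hm hm0]; exact inv_mul_cancel₀ (by linarith)
  rw [hn, darkProfile_re hc, darkProfile_im hc, mul_pow, mul_pow, mul_pow, div_pow, div_pow,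
    mu₂_sq hc hc1, mu₁_eq hc, Real.sq_sqrt h0.le, Real.sq_sqrt (by norm_num), sechSq]
  rw [mu_eq hc hc1] at q1 ⊢
  generalize profileFactor (-(2 - tauParam c) / (6 + tauParam c)) (kappa c) x = a at *
  generalize Real.tanh (kappa c * x) = t at *
  have key : -(2 - tauParam c) / (6 + tauParam c)
      - (4 + tauParam c) * (2 - tauParam c) / (6 + tauParam c) / 2 = -(2 - tauParam c) / 2 := by
    field_simp; ring
  linear_combination (-1) * q1 + (a ^ 2 * t ^ 2) * key

theorem norm_darkProfile_le_one {c : ℝ} (hc : c ≠ 0) (hc1 : |c| ≤ 1) (x : ℝ) :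
    ‖darkProfile c x‖ ≤ 1 := by
  have h := one_sub_norm_darkProfile_sq hc hc1 x
  have h1 : 0 ≤ (1 - tauParam c / 2) * (sechSq (kappa c * x)
      * profileFactor (mu c) (kappa c) x ^ 2) :=
    mul_nonneg (by linarith [tauParam_le_abs hc1]) (mul_nonneg (sechSq_pos _).le (sq_nonneg _))
  nlinarith [norm_nonneg (darkProfile c x)]

theorem one_sub_blackSoliton_sq (x : ℝ) :
    1 - blackSoliton x ^ 2 = sechSq (1 * x) * profileFactor (-(1 / 3)) 1 x ^ 2 := by
  have h := two_lt_three_sub_tanh_sq x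
  have p1 := one_add_mul_tanh_sq_mem (m := -(1 / 3)) (k := 1) le_rfl (by norm_num) x
  rw [profileFactor_sq le_rfl (by norm_num), blackSoliton_sq, sechSq]
  rw [one_mul] at *
  have h1 : 3 - Real.tanh x ^ 2 ≠ 0 := by linarith
  rw [show 1 + -(1 / 3) * Real.tanh x ^ 2 = (3 - Real.tanh x ^ 2) / 3 by ring, inv_div]
  field_simp
  ring

theorem abs_div_sqrt_two_mul_le (a b : ℝ) : |a / √2 * b| ≤ |a * b| := by
  have h : 1 ≤ √(2:ℝ) := Real.one_le_sqrt.2 (by norm_num)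
  rw [div_mul_eq_mul_div, abs_div, abs_of_nonneg (by linarith : 0 ≤ √(2:ℝ))]
  exact div_le_self (abs_nonneg _) h

/-- Products are telescoped one factor at a time by `abs_mul_sub_mul_le`. The last two bounds gain
the decay `w` from the factors `S` and `S₀`; the constants are far from sharp. -/
theorem profile_estimates_aux {e w t T A A₀ S S₀ u ν k : ℝ} (he : 0 ≤ e) (he1 : e ≤ 1)
    (hw0 : 0 < w) (hw : w ≤ 1)
    (ht : |t - T| ≤ 12500 * (e * w)) (hA : |A - A₀| ≤ 100000 * e) (a1 : 1 ≤ A) (a2 : A ≤ 3 / 2)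
    (a3 : 1 ≤ A₀) (a4 : A₀ ≤ 3 / 2) (b1 : |t| ≤ 1) (b2 : |T| ≤ 1) (S1 : S ≤ 12500 * w)
    (S2 : S₀ ≤ 12500 * w) (S10 : 0 < S) (S20 : 0 < S₀) (S1e : S = 1 - t ^ 2)
    (S2e : S₀ = 1 - T ^ 2) (hν : |u - ν| ≤ e) (hν1 : ν ≤ 3 / 2) (hν0 : 0 ≤ ν) (hk : 0 ≤ k)
    (hk1 : k ≤ 1) (hke : 1 - k ≤ e) :
    |u * (t * A) - ν * (T * A₀)| ≤ 10 ^ 12 * e ∧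
    |u * (k * S * A ^ 3) - ν * (1 * S₀ * A₀ ^ 3)| ≤ 10 ^ 12 * (e * w) ∧
    |S * A ^ 2 - S₀ * A₀ ^ 2| ≤ 10 ^ 11 * (e * w) := by
  have hew : e * w ≤ e := mul_le_of_le_one_right he hw
  have hew0 : 0 ≤ e * w := by positivity
  have hA' : |A| ≤ 3 / 2 := by rw [abs_of_nonneg (by linarith)]; exact a2
  have hA₀' : |A₀| ≤ 3 / 2 := by rw [abs_of_nonneg (by linarith)]; exact a4
  have hA₀2 : |A₀ ^ 2| ≤ 9 / 4 := by rw [abs_of_nonneg (by positivity)]; nlinarith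
  have hA₀3 : |A₀ ^ 3| ≤ 27 / 8 := by
    rw [abs_of_nonneg (by positivity)]
    have := pow_le_pow_left₀ (by linarith) a4 3
    linarith
  have hu : |u| ≤ 5 / 2 := by
    have h1 := abs_le.1 hν
    rw [abs_le]; constructor <;> linarith [h1.1, h1.2]
  have hS : |S| ≤ 12500 * w := by rw [abs_of_pos S10]; exact S1
  have hS' : |S₀| ≤ 12500 * w := by rw [abs_of_pos S20]; exact S2
  have dS : |S - S₀| ≤ 25000 * (e * w) := by
    have := abs_mul_sub_mul_le (b := t) (a' := T) b1 b2
    rw [S1e, S2e, sub_sub_sub_cancel_left, abs_sub_comm, sq, sq]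
    linarith
  have dA2 : |A ^ 2 - A₀ ^ 2| ≤ 300000 * e := by
    have := abs_mul_sub_mul_le (b := A) (a' := A₀) hA' hA₀'
    rw [sq, sq]; linarith
  have dA3 : |A ^ 3 - A₀ ^ 3| ≤ 750000 * e := by
    have := abs_mul_sub_mul_le (b := A ^ 2) (a' := A₀) hA' hA₀2
    rw [pow_succ' _ 2, pow_succ' _ 2]; linarith
  have dSA2 : |S * A ^ 2 - S₀ * A₀ ^ 2| ≤ 10 ^ 11 * (e * w) := by
    refine (abs_mul_sub_mul_le hS hA₀2).trans ?_
    have := mul_le_mul_of_nonneg_left dA2 (by positivity : 0 ≤ 12500 * w)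
    nlinarith
  have dSA3 : |S * A ^ 3 - S₀ * A₀ ^ 3| ≤ 10 ^ 11 * (e * w) := by
    refine (abs_mul_sub_mul_le hS hA₀3).trans ?_
    have := mul_le_mul_of_nonneg_left dA3 (by positivity : 0 ≤ 12500 * w)
    nlinarith
  have hSA : |S₀ * A₀ ^ 3| ≤ 50000 * w := by
    rw [abs_mul]
    have := mul_le_mul hS' hA₀3 (abs_nonneg _) (by positivity)
    linarith
  refine ⟨?_, ?_, dSA2⟩
  · have h1 := abs_mul_sub_mul_le (b := A) (a' := T) b1 hA₀'
    have hTA : |T * A₀| ≤ 3 / 2 := by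
      rw [abs_mul]
      have := mul_le_mul b2 hA₀' (abs_nonneg _) (by norm_num)
      linarith
    have h2 := abs_mul_sub_mul_le (b := t * A) (a' := ν) hu hTA
    linarith
  · have h1 := abs_mul_sub_mul_le (a := k) (A := 1) (b := S * A ^ 3) (a' := 1)
      (by rw [abs_of_nonneg hk]; exact hk1) hSA
    have h2 := abs_mul_sub_mul_le (b := k * (S * A ^ 3)) (a' := ν) (b' := 1 * (S₀ * A₀ ^ 3)) hu
      (show |1 * (S₀ * A₀ ^ 3)| ≤ 50000 * w by rw [one_mul]; exact hSA)
    have h3 : |k - 1| ≤ e := by rw [abs_sub_comm, abs_of_nonneg (by linarith)]; exact hke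
    have h4 := mul_le_mul_of_nonneg_left h3 (by positivity : 0 ≤ 50000 * w)
    have h5 := mul_le_mul_of_nonneg_left hν (by positivity : 0 ≤ 50000 * w)
    rw [mul_assoc k, mul_assoc 1]
    linarith

/-- The dark profiles converge to the black soliton, up to a sign, at a linear rate in the
speed. -/
theorem exists_profile_estimates : ∃ C : ℝ, 0 < C ∧ ∀ c : ℝ, c ≠ 0 → |c| ≤ 1 → ∀ x : ℝ,
    |(darkProfile c x).re - profileSign c * blackSoliton x| ≤ C * |c| ∧
    |(darkProfile c x).im| ≤ C * |c| ∧
    |(darkProfileDeriv c x).re - profileSign c * blackSolitonDeriv x| ≤ C * (|c| * ratWeight x) ∧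
    |(darkProfileDeriv c x).im| ≤ C * (|c| * ratWeight x) ∧
    |‖darkProfile c x‖ ^ 2 - blackSoliton x ^ 2| ≤ C * (|c| * ratWeight x) := by
  refine ⟨10 ^ 12, by norm_num, fun c hc hc1 x => ?_⟩
  obtain ⟨hm, hm0, hm1⟩ := mu_mem hc hc1
  obtain ⟨hk, hk1, hk2⟩ := kappa_mem hc1
  have hw := ratWeight_le_one x
  have hw0 := ratWeight_pos x
  have hc0 := abs_nonneg c
  have hcw0 : 0 ≤ |c| * ratWeight x := by positivity
  have ht : |Real.tanh (kappa c * x) - Real.tanh (1 * x)| ≤ 12500 * (|c| * ratWeight x) := by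
    rw [one_mul]
    refine (abs_tanh_sub_le hk hk1 x).trans ?_
    gcongr
  have a1 := profileFactor_mem (k := kappa c) hm hm0 x
  have a2 := profileFactor_mem (m := -(1 / 3)) (k := 1) le_rfl (by norm_num) x
  have b1 := (sq_le_one_iff_abs_le_one _).1 (tanh_sq_lt_one (kappa c * x)).le
  have S1 := sechSq_kappa_le hk x
  have S10 := sechSq_pos (kappa c * x)
  have hτ := sqrt_tauParam_le (c := c)
  have hτ0 := tauParam_pos hc
  have hτ1 := tauParam_le_abs hc1
  obtain ⟨r1, r2, r3⟩ := profile_estimates_aux hc0 hc1 hw0 hw ht (abs_profileFactor_sub_le hc hc1 x)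
    a1.1 a1.2 a2.1 a2.2 b1 ((sq_le_one_iff_abs_le_one _).1 (tanh_sq_lt_one (1 * x)).le)
    S1 (sechSq_kappa_le (k := 1) (by norm_num) x) S10 (sechSq_pos (1 * x)) rfl rfl
    (abs_mu₂_sub_le hc hc1) two_div_sqrt_three_le (by linarith [one_le_two_div_sqrt_three])
    (by linarith) hk1 hk2
  refine ⟨?_, ?_, ?_, ?_, ?_⟩
  · rw [darkProfile_re hc, blackSoliton_eq, mu₂_eq hc]
    refine le_trans ?_ r1
    rw [mul_div_assoc, mul_assoc, ← mul_sub, abs_mul, abs_profileSign, one_mul,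
      div_mul_eq_mul_div, div_mul_eq_mul_div, ← sub_div, div_eq_mul_inv, mul_comm,
      ← one_mul (|mu₂ c| * _ - _)]
    rw [← mul_assoc, mul_one, inv_eq_one_div]
    refine (abs_div_sqrt_two_mul_le _ _).trans (by rw [one_mul])
  · rw [darkProfile_im hc, mu₁_eq hc]
    refine (abs_div_sqrt_two_mul_le _ _).trans ?_
    rw [abs_mul, abs_of_nonneg (Real.sqrt_nonneg _), abs_of_nonneg (by linarith)]
    have := mul_le_mul hτ a1.2 (by linarith) hc0
    linarith
  · rw [darkProfileDeriv_re, blackSolitonDeriv_eq, mu₂_eq hc]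
    refine le_trans ?_ r2
    rw [mul_div_assoc, mul_assoc, ← mul_sub, abs_mul, abs_profileSign, one_mul,
      div_mul_eq_mul_div, div_mul_eq_mul_div, ← sub_div, div_eq_mul_inv, mul_comm,
      ← one_mul (|mu₂ c| * _ - _)]
    rw [← mul_assoc, mul_one, inv_eq_one_div]
    refine (abs_div_sqrt_two_mul_le _ _).trans (by rw [one_mul])
  · rw [darkProfileDeriv_im, mu₁_eq hc]
    refine (abs_div_sqrt_two_mul_le _ _).trans ?_
    have hA3 : profileFactor (mu c) (kappa c) x ^ 3 ≤ (3 / 2) ^ 3 :=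
      pow_le_pow_left₀ (by linarith) a1.2 3
    have hA0 : 0 ≤ profileFactor (mu c) (kappa c) x ^ 3 := pow_nonneg (by linarith) 3
    simp only [abs_mul]
    obtain ⟨n, hn⟩ : ∃ n, n = -mu c := ⟨_, rfl⟩
    have hn0 : 0 ≤ n := by linarith
    have hn1 : n ≤ 1 := by linarith
    have hk0 : 0 ≤ kappa c := by linarith
    rw [abs_of_nonneg (Real.sqrt_nonneg _), abs_neg, abs_of_nonpos hm0, ← hn,
      abs_of_nonneg (by linarith : 0 ≤ kappa c), abs_of_pos S10, abs_of_nonneg hA0]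
    calc √(tauParam c) * (n * kappa c * |Real.tanh (kappa c * x)| * sechSq (kappa c * x)
          * profileFactor (mu c) (kappa c) x ^ 3)
        ≤ |c| * (1 * 1 * 1 * (12500 * ratWeight x) * (3 / 2) ^ 3) := by
          gcongr
      _ ≤ _ := by nlinarith
  -- Beyond the comparison `r3`, the only extra term is the one carrying `tauParam c`, which is
  -- itself at most `|c|`.
  · have e1 := one_sub_norm_darkProfile_sq hc hc1 x
    have e2 := one_sub_blackSoliton_sq x
    have hA2 : profileFactor (mu c) (kappa c) x ^ 2 ≤ 9 / 4 := by nlinarith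
    have hSA : sechSq (kappa c * x) * profileFactor (mu c) (kappa c) x ^ 2
        ≤ 12500 * ratWeight x * (9 / 4) := mul_le_mul S1 hA2 (sq_nonneg _) (by positivity)
    have hSA0 : 0 ≤ sechSq (kappa c * x) * profileFactor (mu c) (kappa c) x ^ 2 := by positivity
    have h3 : tauParam c * (sechSq (kappa c * x) * profileFactor (mu c) (kappa c) x ^ 2)
        ≤ |c| * (12500 * ratWeight x * (9 / 4)) := mul_le_mul hτ1 hSA hSA0 hc0
    have h4 : 0 ≤ tauParam c * (sechSq (kappa c * x) * profileFactor (mu c) (kappa c) x ^ 2) := by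
      positivity
    rw [abs_le] at r3 ⊢
    constructor <;> linarith [r3.1, r3.2]

/-! ### Perturbations in the energy space -/

/-- Only the derivative has to decay: a function that is merely bounded has finite weighted norm.
This suits the difference of two profiles with different limits at infinity. -/
theorem inEnergySpace_of_le {f g : ℝ → ℝ} (hf : ∀ x, HasDerivAt f (g x) x) (hg : Continuous g)
    {a : ℝ} (ha : ∀ x, |f x| ≤ a) (hw : ∀ x, |g x| ≤ a * ratWeight x) :
    InEnergySpace f g ∧
      energyNormSq f g ≤ a ^ 2 * ((∫ x, ratWeight x) + ∫ x, eta 0 x) := by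
  have hfc : Continuous f := continuous_iff_continuousAt.2 fun x => (hf x).continuousAt
  have h1 : ∀ x, g x ^ 2 ≤ a ^ 2 * ratWeight x := fun x => by
    have h0 := ratWeight_pos x
    calc g x ^ 2 ≤ (a * ratWeight x) ^ 2 := sq_le_sq' (abs_le.1 (hw x)).1 (abs_le.1 (hw x)).2
      _ = a ^ 2 * (ratWeight x * ratWeight x) := by ring
      _ ≤ a ^ 2 * ratWeight x := mul_le_mul_of_nonneg_left
          (mul_le_of_le_one_left h0.le (ratWeight_le_one x)) (sq_nonneg a)
  have h2 : ∀ x, eta 0 x * f x ^ 2 ≤ a ^ 2 * eta 0 x := fun x => by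
    rw [mul_comm]
    exact mul_le_mul_of_nonneg_right (sq_le_sq' (abs_le.1 (ha x)).1 (abs_le.1 (ha x)).2)
      (eta_zero_pos x).le
  have i1 : Integrable fun x => g x ^ 2 :=
    (integrable_ratWeight.const_mul (a ^ 2)).mono' (hg.pow 2).aestronglyMeasurable
      (.of_forall fun x => by rw [Real.norm_of_nonneg (sq_nonneg _)]; exact h1 x)
  have i2 : Integrable fun x => eta 0 x * f x ^ 2 :=
    (integrable_eta_zero.const_mul (a ^ 2)).mono'
      (continuous_eta_zero.mul (hfc.pow 2)).aestronglyMeasurable (.of_forall fun x => by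
        rw [Real.norm_of_nonneg (mul_nonneg (eta_zero_pos x).le (sq_nonneg _))]; exact h2 x)
  refine ⟨⟨.of_hasDerivAt hf hg, (memLp_two_iff_integrable_sq hg.aestronglyMeasurable).2 i1, i2⟩, ?_⟩
  rw [energyNormSq, mul_add, ← integral_const_mul, ← integral_const_mul]
  exact add_le_add (integral_mono i1 (integrable_ratWeight.const_mul _) h1)
    (integral_mono i2 (integrable_eta_zero.const_mul _) h2)

theorem energyNormSq_add_le {f₁ g₁ f₂ g₂ : ℝ → ℝ} (h₁ : InEnergySpace f₁ g₁)
    (h₂ : InEnergySpace f₂ g₂) :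
    energyNormSq (fun x => f₁ x + f₂ x) (fun x => g₁ x + g₂ x) ≤
      2 * energyNormSq f₁ g₁ + 2 * energyNormSq f₂ g₂ := by
  have h := h₁.add h₂
  have e1 := integral_mono h.memLp.integrable_sq
    ((h₁.memLp.integrable_sq.const_mul 2).add (h₂.memLp.integrable_sq.const_mul 2))
    fun x => by
      simp only [Pi.add_apply]
      nlinarith [sq_nonneg (g₁ x - g₂ x)]
  have e2 := integral_mono h.integrable
    ((h₁.integrable.const_mul 2).add (h₂.integrable.const_mul 2)) fun x => by
      simp only [Pi.add_apply]
      nlinarith [mul_nonneg (eta_zero_pos x).le (sq_nonneg (f₁ x - f₂ x))]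
  simp only [Pi.add_apply] at e1 e2
  rw [integral_lin2 h₁.memLp.integrable_sq h₂.memLp.integrable_sq] at e1
  rw [integral_lin2 h₁.integrable h₂.integrable] at e2
  simp only [energyNormSq]
  linarith

theorem energyNormSq_const_mul {s : ℝ} (hs : s ^ 2 = 1) (f g : ℝ → ℝ) :
    energyNormSq (fun x => s * f x) (fun x => s * g x) = energyNormSq f g := by
  simp only [energyNormSq, mul_pow, hs, one_mul]

/-- Write `f₁` as `(f₁ + f₂) + (-1) f₂` and use the forward inequality. -/
theorem energyNormSq_le_add {f₁ g₁ f₂ g₂ : ℝ → ℝ} (h₁ : InEnergySpace f₁ g₁)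
    (h₂ : InEnergySpace f₂ g₂) :
    energyNormSq f₁ g₁ ≤
      2 * energyNormSq (fun x => f₁ x + f₂ x) (fun x => g₁ x + g₂ x)
        + 2 * energyNormSq f₂ g₂ := by
  have h := energyNormSq_add_le (h₁.add h₂) (h₂.const_mul (-1))
  rw [energyNormSq_const_mul (by norm_num) f₂ g₂] at h
  simpa only [neg_mul, one_mul, add_neg_cancel_right] using h

/-- A functional which vanishes at `f` almost vanishes at a small perturbation of `f` when its
weight is perturbed. -/
theorem exists_abs_integral_mul_le : ∃ K : ℝ, 0 < K ∧ ∀ f g k k₀ b : ℝ → ℝ, ∀ a s n : ℝ,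
    InEnergySpace f g → Continuous k → Continuous k₀ → Continuous b → s ^ 2 = 1 → 0 ≤ n →
    energyNormSq f g ≤ n ^ 2 → (∀ x, |k x - k₀ x| ≤ a * ratWeight x) →
    (∀ x, |k₀ x| ≤ eta 0 x) → (∀ x, |b x| ≤ a) → ∫ x, k x * f x = 0 →
    |∫ x, k₀ x * (s * f x + b x)| ≤ K * (a * (1 + n)) := by
  obtain ⟨C, hC, hb⟩ := exists_sq_le_energyNormSq
  set I := ∫ x : ℝ, (1 + x ^ 2) * ratWeight x with hI
  set M := ∫ x, eta 0 x with hM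
  have hI0 : 0 ≤ I := integral_nonneg fun x => by have := ratWeight_pos x; positivity
  have hM0 : 0 < M := integral_eta_zero_pos
  refine ⟨(2 * C + 1) * I + M, by positivity,
    fun f g k k₀ b a s n h hk hk₀ hbc hs hn hfn hkk hkη hba h0 => ?_⟩
  have ha : 0 ≤ a := (abs_nonneg _).trans (hba 0)
  have hf : ∀ x, |f x| ≤ (2 * C + 1) * ((1 + x ^ 2) * n) := fun x => by
    refine abs_le_of_sq_le_sq ?_ (by positivity)
    have h1 := (hb f g h x).trans (mul_le_mul_of_nonneg_left hfn (by positivity))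
    have h2 := one_add_abs_le x
    have h3 : C * (1 + |x|) ≤ (2 * C + 1) ^ 2 * (1 + x ^ 2) ^ 2 := by
      have h4 : C * (1 + |x|) ≤ C * (2 * (1 + x ^ 2)) := mul_le_mul_of_nonneg_left h2 hC.le
      nlinarith [sq_nonneg x, sq_nonneg C, mul_nonneg hC.le (sq_nonneg x),
        mul_nonneg (sq_nonneg (2 * C + 1)) (by positivity : 0 ≤ x ^ 2 + (x ^ 2) ^ 2)]
    calc f x ^ 2 ≤ C * (1 + |x|) * n ^ 2 := h1
      _ ≤ ((2 * C + 1) ^ 2 * (1 + x ^ 2) ^ 2) * n ^ 2 :=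
          mul_le_mul_of_nonneg_right h3 (sq_nonneg n)
      _ = _ := by ring
  have hd : ∀ x, |(k x - k₀ x) * f x| ≤
      (a * ((2 * C + 1) * n)) * ((1 + x ^ 2) * ratWeight x) := fun x => by
    rw [abs_mul]
    have := ratWeight_pos x
    calc _ ≤ (a * ratWeight x) * ((2 * C + 1) * ((1 + x ^ 2) * n)) :=
          mul_le_mul (hkk x) (hf x) (abs_nonneg _) (by positivity)
      _ = _ := by ring
  have i1 : Integrable fun x => (k x - k₀ x) * f x := integrable_of_le_ratWeight
    ((hk.sub hk₀).mul h.continuous).aestronglyMeasurable hd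
  have i2 : Integrable fun x => k₀ x * f x := h.integrable_mul.norm.mono'
    (hk₀.mul h.continuous).aestronglyMeasurable (.of_forall fun x => by
      rw [norm_mul, norm_mul, Real.norm_of_nonneg (eta_zero_pos x).le]
      exact mul_le_mul_of_nonneg_right (hkη x) (norm_nonneg _))
  have hb' : ∀ x, |k₀ x * b x| ≤ a * eta 0 x := fun x => by
    rw [abs_mul, mul_comm a]
    exact mul_le_mul (hkη x) (hba x) (abs_nonneg _) (eta_zero_pos x).le
  have i3 : Integrable fun x => k₀ x * b x := (integrable_eta_zero.const_mul a).mono'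
    (hk₀.mul hbc).aestronglyMeasurable (.of_forall hb')
  -- The condition for `k` leaves only `k - k₀`, whose rational decay compensates the growth of `f`.
  have e1 : ∫ x, k₀ x * f x = -∫ x, (k x - k₀ x) * f x := by
    have e := integral_lin2 i1 i2 1 1
    simp only [one_mul, ← add_mul, sub_add_cancel, h0] at e
    linarith
  have e2 : ∫ x, k₀ x * (s * f x + b x) = s * (∫ x, k₀ x * f x) + 1 * ∫ x, k₀ x * b x := by
    rw [← integral_lin2 i2 i3]
    exact integral_congr_ae (.of_forall fun x => by simp only; ring)
  have b1 : |∫ x, (k x - k₀ x) * f x| ≤ (a * ((2 * C + 1) * n)) * I := by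
    rw [hI, ← integral_const_mul]
    exact (abs_integral_le_integral_abs).trans
      (integral_mono i1.abs (integrable_one_add_sq_mul_ratWeight.const_mul _) hd)
  have b2 : |∫ x, k₀ x * b x| ≤ a * M := by
    rw [hM, ← integral_const_mul]
    exact (abs_integral_le_integral_abs).trans
      (integral_mono i3.abs (integrable_eta_zero.const_mul _) hb')
  have hs' : |s| = 1 := by
    rw [← sq_eq_sq₀ (abs_nonneg s) zero_le_one, sq_abs, hs, one_pow]
  rw [e2, e1, one_mul]
  refine (abs_add_le _ _).trans ?_
  rw [abs_mul, hs', one_mul, abs_neg]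
  have t1 : 0 ≤ a * M * n := by positivity
  have t2 : 0 ≤ a * ((2 * C + 1) * I) := by positivity
  nlinarith

/-! ### Expansion of the energy -/

theorem hasWeakDeriv_darkProfile_zero :
    HasWeakDeriv (darkProfile 0) fun x => (blackSolitonDeriv x : ℂ) := by
  have e : darkProfile 0 = fun x => (blackSoliton x : ℂ) := by
    funext x; rw [darkProfile, if_pos rfl]
  rw [e]
  exact .of_hasDerivAt (fun x => (hasDerivAt_blackSoliton x).ofReal_comp)
    (Complex.continuous_ofReal.comp continuous_blackSolitonDeriv)

theorem energyDensity_darkProfile_zero :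
    energyDensity (darkProfile 0) =ᵐ[volume] fun x =>
      blackSolitonDeriv x ^ 2
        + (2 / 3 - blackSoliton x ^ 2 + (blackSoliton x ^ 2) ^ 3 / 3) := by
  have h := hasWeakDeriv_darkProfile_zero
  filter_upwards [h.weakDeriv.ae_eq h] with x hx
  rw [energyDensity, hx, darkProfile, if_pos rfl, Complex.norm_real, Complex.norm_real,
    Real.norm_eq_abs, Real.norm_eq_abs, sq_abs, sq_abs]
  ring

/-- With `V(ρ) = 2/3 - ρ + ρ³/3`, the increment `V(φ₀² + m) - V(φ₀²)` is exactly `-η₀ m + φ₀² m² +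
m³/3`. The terms linear in `p` integrate to zero by the soliton equation. -/
theorem energy_sub_eq {p p' q q' : ℝ → ℝ} (hp : InEnergySpace p p') (hq : InEnergySpace q q')
    {u g : ℝ → ℂ} (hu : HasWeakDeriv u g) (hui : Integrable (energyDensity u))
    (hup : ∀ x, ‖u x‖ ^ 2 = blackSoliton x ^ 2 + modVar p q x)
    (hgp : ∀ x, ‖g x‖ ^ 2 = (blackSolitonDeriv x + p' x) ^ 2 + q' x ^ 2) :
    Integrable (potentialRemainder p q) ∧
      E₂ u - E₂ (darkProfile 0) =
        ((∫ x, p' x ^ 2) - ∫ x, eta 0 x * p x ^ 2) + ((∫ x, q' x ^ 2) - ∫ x, eta 0 x * q x ^ 2)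
          + ∫ x, potentialRemainder p q x := by
  have j0 : Integrable (energyDensity (darkProfile 0)) := by
    refine (memLp_blackSolitonDeriv.integrable_sq.const_mul 2).congr ?_
    filter_upwards [energyDensity_darkProfile_zero] with x hx
    rw [hx, blackSolitonDeriv_sq_eq]
    ring
  have j1 : Integrable fun x => blackSolitonDeriv x * p' x :=
    memLp_blackSolitonDeriv.integrable_mul hp.memLp
  have j2 : Integrable fun x => eta 0 x * (blackSoliton x * p x) :=
    hp.integrable_mul_mul continuous_blackSoliton abs_blackSoliton_le_one
  have key : (fun x => energyDensity u x - energyDensity (darkProfile 0) x) =ᵐ[volume] fun x =>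
      2 * (blackSolitonDeriv x * p' x - eta 0 x * (blackSoliton x * p x))
        + ((p' x ^ 2 - eta 0 x * p x ^ 2) + (q' x ^ 2 - eta 0 x * q x ^ 2))
        + potentialRemainder p q x := by
    filter_upwards [energyDensity_darkProfile_zero, hu.weakDeriv.ae_eq hu] with x hx hx'
    rw [hx, energyDensity, hx', hup, hgp, eta_zero, potentialRemainder]
    have : modVar p q x = 2 * blackSoliton x * p x + p x ^ 2 + q x ^ 2 := rfl
    linear_combination (-(1 - blackSoliton x ^ 4)) * this
  have j3 := (j1.sub j2).const_mul 2
  have j4 := (hp.memLp.integrable_sq.sub hp.integrable).add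
    (hq.memLp.integrable_sq.sub hq.integrable)
  -- Integrability comes by difference: the energy densities and all the other terms are integrable.
  have jP : Integrable (potentialRemainder p q) := by
    refine ((hui.sub j0).sub (j3.add j4)).congr ?_
    filter_upwards [key] with x hx
    simp only [Pi.sub_apply, Pi.add_apply]
    rw [hx]
    ring
  refine ⟨jP, ?_⟩
  rw [E₂, E₂, ← integral_sub hui j0, integral_congr_ae key]
  have e1 := integral_add (j3.add j4) jP
  have e2 := integral_add j3 j4
  have e3 := integral_add (hp.memLp.integrable_sq.sub hp.integrable)
    (hq.memLp.integrable_sq.sub hq.integrable)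
  have e4 := integral_sub hp.memLp.integrable_sq hp.integrable
  have e5 := integral_sub hq.memLp.integrable_sq hq.integrable
  have e6 := integral_sub j1 j2
  have e7 := integral_const_mul (μ := (volume : Measure ℝ)) (2 : ℝ)
    fun x => blackSolitonDeriv x * p' x - eta 0 x * (blackSoliton x * p x)
  have e8 := integral_blackSolitonDeriv_mul hp
  simp only [Pi.sub_apply, Pi.add_apply] at e1 e2 e3 e4 e5 e6
  linarith

/-! ### The nonlinear quantity -/

theorem normL2_sq_le {f : ℝ → ℂ} (hf : AEStronglyMeasurable f volume) {G : ℝ → ℝ}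
    (hG : Integrable G) (h : ∀ x, ‖f x‖ ^ 2 ≤ G x) : normL2 f ^ 2 ≤ ∫ x, G x := by
  have hi : Integrable fun x => ‖f x‖ ^ 2 := hG.mono' (hf.norm.pow 2)
    (.of_forall fun x => by rw [Real.norm_of_nonneg (by positivity)]; exact h x)
  have hm : MemLp f 2 volume := (memLp_two_iff_integrable_sq_norm hf).2 hi
  have e : normL2 f ^ 2 = ∫ x, ‖f x‖ ^ 2 := by
    rw [normL2, hm.eLpNorm_eq_integral_rpow_norm (by simp) (by simp),
      ENNReal.toReal_ofReal (by positivity)]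
    simp only [ENNReal.toReal_ofNat, Real.rpow_two]
    rw [← Real.rpow_mul_natCast (by positivity)]
    norm_num
  rw [e]
  exact integral_mono hi hG h

/-- Passing from `r²` to `ν²` creates the term `|θ| m²`, which is dangerous where `ν` vanishes. For
`m ≥ 0` the cubic part of `P` absorbs it; for `m ≤ 0` the constraint `|m| ≤ ν²` supplies the missing
factor. -/
theorem sq_mul_sub_sq_le {ν m θ r P : ℝ} (hν : ν ^ 2 ≤ 1) (hm : -ν ^ 2 ≤ m) (hr : r ^ 2 = ν ^ 2 + θ)
    (hr0 : 0 ≤ r) (hr1 : r ≤ 1) (hP : P = ν ^ 2 * m ^ 2 + m ^ 3 / 3) :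
    (r ^ 3 * (m - θ)) ^ 2 ≤ 12 * P + (2 * |θ| ^ 3 + 4 * |θ| ^ 2) := by
  have h0 := abs_nonneg θ
  have h1 := le_abs_self θ
  have hq : θ ^ 2 = |θ| ^ 2 := (sq_abs θ).symm
  have h2 : (r ^ 3 * (m - θ)) ^ 2 ≤ r ^ 2 * (m - θ) ^ 2 := by
    have h3 : (r ^ 2) ^ 3 ≤ r ^ 2 := by
      have h4 : r ^ 2 ≤ 1 := by nlinarith
      nlinarith [sq_nonneg r, mul_nonneg (sq_nonneg r) (by nlinarith : 0 ≤ 1 - (r ^ 2) ^ 2)]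
    calc _ = (r ^ 2) ^ 3 * (m - θ) ^ 2 := by ring
      _ ≤ _ := mul_le_mul_of_nonneg_right h3 (sq_nonneg _)
  have h3 : r ^ 2 * (m - θ) ^ 2 ≤ 2 * (r ^ 2 * m ^ 2) + 2 * |θ| ^ 2 := by
    have h4 : r ^ 2 ≤ 1 := by nlinarith
    have h5 : r ^ 2 * (m - θ) ^ 2 ≤ r ^ 2 * (2 * m ^ 2 + 2 * θ ^ 2) :=
      mul_le_mul_of_nonneg_left (by nlinarith [sq_nonneg (m + θ)]) (sq_nonneg r)
    nlinarith [mul_le_mul_of_nonneg_right h4 (sq_nonneg θ)]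
  have h4 : r ^ 2 * m ^ 2 ≤ ν ^ 2 * m ^ 2 + |θ| * m ^ 2 := by
    rw [hr]; nlinarith [sq_nonneg m]
  have h5 : |θ| * m ^ 2 ≤ |θ| ^ 3 + |θ| ^ 2 + (6 * P - ν ^ 2 * m ^ 2) := by
    have h7 : 0 ≤ ν ^ 2 * m ^ 2 := by positivity
    have h9 : 0 ≤ |θ| ^ 3 := by positivity
    have h10 : 0 ≤ |θ| ^ 2 := by positivity
    rcases le_total 0 m with hm0 | hm0
    · have h8 : 0 ≤ m ^ 3 := by positivity
      have h6 : |θ| * m ^ 2 ≤ |θ| ^ 3 + m ^ 3 := by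
        rcases le_total (|θ|) m with h | h
        · nlinarith [mul_le_mul_of_nonneg_right h (sq_nonneg m)]
        · nlinarith [mul_le_mul_of_nonneg_left (pow_le_pow_left₀ hm0 h 2) h0]
      rw [hP]; nlinarith
    · have h11 : -(ν ^ 2 * m ^ 2) ≤ m ^ 3 := by
        nlinarith [mul_nonneg (sq_nonneg m) (by linarith : 0 ≤ m + ν ^ 2)]
      have h12 : |θ| * m ^ 2 ≤ |θ| ^ 2 + ν ^ 2 * m ^ 2 := by
        have h13 : m ^ 2 ≤ ν ^ 2 * (-m) := by nlinarith
        have h14 : |θ| * m ^ 2 ≤ |θ| * (ν ^ 2 * (-m)) := mul_le_mul_of_nonneg_left h13 h0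
        have h15 : ν ^ 2 * (|θ| * (-m)) ≤ ν ^ 2 * (|θ| ^ 2 + m ^ 2) :=
          mul_le_mul_of_nonneg_left (by nlinarith [sq_nonneg (|θ| + m)]) (sq_nonneg ν)
        nlinarith [mul_le_mul_of_nonneg_right hν h10]
      rw [hP]; nlinarith
  linarith

/-! ### Dark profiles close to the black soliton -/

/-- `Φ` is a profile with derivative `d`, within `a` of the black soliton up to the sign `s`. -/
structure IsNearSoliton (a s : ℝ) (Φ d : ℝ → ℂ) : Prop where
  sign_sq : s ^ 2 = 1
  hasDerivAt : ∀ x, HasDerivAt Φ (d x) x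
  continuous_deriv : Continuous d
  norm_le_one : ∀ x, ‖Φ x‖ ≤ 1
  abs_re_le : ∀ x, |s * (Φ x).re - blackSoliton x| ≤ a
  abs_im_le : ∀ x, |(Φ x).im| ≤ a
  abs_re_deriv_le : ∀ x, |s * (d x).re - blackSolitonDeriv x| ≤ a * ratWeight x
  abs_im_deriv_le : ∀ x, |(d x).im| ≤ a * ratWeight x
  abs_norm_sq_le : ∀ x, |‖Φ x‖ ^ 2 - blackSoliton x ^ 2| ≤ a * ratWeight x

theorem exists_isNearSoliton : ∃ C : ℝ, 0 < C ∧ ∀ c : ℝ, |c| ≤ 1 →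
    ∃ s d, IsNearSoliton (C * |c|) s (darkProfile c) d := by
  obtain ⟨C, hC, h⟩ := exists_profile_estimates
  refine ⟨C, hC, fun c hc1 => ?_⟩
  -- At zero speed the profile is the black soliton itself and every difference vanishes.
  by_cases hc : c = 0
  · subst hc
    have e : ∀ x, darkProfile 0 x = blackSoliton x := fun x => by rw [darkProfile, if_pos rfl]
    refine ⟨1, fun x => (blackSolitonDeriv x : ℂ), by norm_num, fun x => ?_,
      Complex.continuous_ofReal.comp continuous_blackSolitonDeriv, fun x => ?_, ?_, ?_, ?_, ?_, ?_⟩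
    · rw [show darkProfile 0 = _ from funext e]
      exact (hasDerivAt_blackSoliton x).ofReal_comp
    · rw [e, Complex.norm_real]
      exact abs_blackSoliton_le_one x
    all_goals intro x; simp [e]
  · have hs := profileSign_sq c
    have hsub : ∀ a b : ℝ, |profileSign c * a - b| = |a - profileSign c * b| := fun a b => by
      rw [show profileSign c * a - b = profileSign c * (a - profileSign c * b) by
        linear_combination b * hs, abs_mul, abs_profileSign, one_mul]
    have h' := fun x => h c hc hc1 x
    refine ⟨profileSign c, darkProfileDeriv c, hs, hasDerivAt_darkProfile hc hc1,
      continuous_darkProfileDeriv hc hc1, norm_darkProfile_le_one hc hc1,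
      fun x => ?_, fun x => (h' x).2.1, fun x => ?_, fun x => ?_, fun x => ?_⟩
    · rw [hsub]; exact (h' x).1
    · rw [hsub, mul_assoc]; exact (h' x).2.2.1
    · rw [mul_assoc]; exact (h' x).2.2.2.1
    · rw [mul_assoc]; exact (h' x).2.2.2.2

theorem IsNearSoliton.continuous {a s : ℝ} {Φ d : ℝ → ℂ} (h : IsNearSoliton a s Φ d) :
    Continuous Φ := continuous_iff_continuousAt.2 fun x => (h.hasDerivAt x).continuousAt

theorem IsNearSoliton.inEnergySpace_re {a s : ℝ} {Φ d : ℝ → ℂ} (h : IsNearSoliton a s Φ d) :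
    InEnergySpace (fun x => s * (Φ x).re - blackSoliton x)
        (fun x => s * (d x).re - blackSolitonDeriv x) ∧
      energyNormSq (fun x => s * (Φ x).re - blackSoliton x)
        (fun x => s * (d x).re - blackSolitonDeriv x) ≤
        a ^ 2 * ((∫ x, ratWeight x) + ∫ x, eta 0 x) :=
  inEnergySpace_of_le
    (fun x => ((Complex.reCLM.hasFDerivAt.comp_hasDerivAt x (h.hasDerivAt x)).const_mul s).sub (hasDerivAt_blackSoliton x))
    (((Complex.continuous_re.comp h.continuous_deriv).const_mul s).sub continuous_blackSolitonDeriv)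
    h.abs_re_le h.abs_re_deriv_le

theorem IsNearSoliton.inEnergySpace_im {a s : ℝ} {Φ d : ℝ → ℂ} (h : IsNearSoliton a s Φ d) :
    InEnergySpace (fun x => (Φ x).im) (fun x => (d x).im) ∧
      energyNormSq (fun x => (Φ x).im) (fun x => (d x).im) ≤
        a ^ 2 * ((∫ x, ratWeight x) + ∫ x, eta 0 x) :=
  inEnergySpace_of_le (fun x => Complex.imCLM.hasFDerivAt.comp_hasDerivAt x (h.hasDerivAt x))
    (Complex.continuous_im.comp h.continuous_deriv) h.abs_im_le h.abs_im_deriv_le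

theorem IsNearSoliton.abs_norm_pow_four_le {a s : ℝ} {Φ d : ℝ → ℂ} (h : IsNearSoliton a s Φ d)
    (x : ℝ) : |‖Φ x‖ ^ 4 - blackSoliton x ^ 4| ≤ 2 * a * ratWeight x := by
  have h1 := h.abs_norm_sq_le x
  have h2 : ‖Φ x‖ ^ 2 ≤ 1 := pow_le_one₀ (norm_nonneg _) (h.norm_le_one x)
  have h3 := blackSoliton_sq_le_one x
  rw [show ‖Φ x‖ ^ 4 - blackSoliton x ^ 4 =
    (‖Φ x‖ ^ 2 + blackSoliton x ^ 2) * (‖Φ x‖ ^ 2 - blackSoliton x ^ 2) by ring, abs_mul,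
    abs_of_nonneg (by positivity)]
  nlinarith [abs_nonneg (‖Φ x‖ ^ 2 - blackSoliton x ^ 2)]

/-! ### The complex energy space -/

section

variable {z : ℝ → ℂ}

theorem hasWeakDeriv_of_mem_spaceH (hz : z ∈ spaceH 0) : HasWeakDeriv z (weakDeriv z) := by
  obtain ⟨-, ⟨g, hg, -⟩, -⟩ := hz
  exact hg.weakDeriv

theorem memLp_weakDeriv (hz : z ∈ spaceH 0) : MemLp (weakDeriv z) 2 volume := by
  obtain ⟨-, ⟨g, hg, hg2⟩, -⟩ := hz
  exact (memLp_congr_ae (hg.weakDeriv.ae_eq hg)).2 hg2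

theorem integrable_eta_mul_norm_sq (hz : z ∈ spaceH 0) :
    Integrable fun x => eta 0 x * ‖z x‖ ^ 2 := by
  refine ((memLp_two_iff_integrable_sq_norm hz.2.2.aestronglyMeasurable).1 hz.2.2).congr
    (.of_forall fun x => ?_)
  simp only [norm_mul, Complex.norm_real, Real.norm_eq_abs, mul_pow, sq_abs,
    Real.sq_sqrt (eta_zero_pos x).le]

theorem inEnergySpace_re_of_mem_spaceH (hz : z ∈ spaceH 0) :
    InEnergySpace (fun x => (z x).re) (fun x => (weakDeriv z x).re) where
  isPrimitive := (hasWeakDeriv_of_mem_spaceH hz).isPrimitive_re hz.1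
  memLp := (memLp_weakDeriv hz).re
  integrable := (integrable_eta_mul_norm_sq hz).mono'
    (continuous_eta_zero.mul ((Complex.continuous_re.comp hz.1).pow 2)).aestronglyMeasurable
    (.of_forall fun x => by
      rw [Real.norm_of_nonneg (mul_nonneg (eta_zero_pos x).le (sq_nonneg _)), Complex.sq_norm,
        Complex.normSq_apply]
      exact mul_le_mul_of_nonneg_left (by nlinarith [mul_self_nonneg (z x).im])
        (eta_zero_pos x).le)

theorem inEnergySpace_im_of_mem_spaceH (hz : z ∈ spaceH 0) :
    InEnergySpace (fun x => (z x).im) (fun x => (weakDeriv z x).im) where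
  isPrimitive := (hasWeakDeriv_of_mem_spaceH hz).isPrimitive_im hz.1
  memLp := (memLp_weakDeriv hz).im
  integrable := (integrable_eta_mul_norm_sq hz).mono'
    (continuous_eta_zero.mul ((Complex.continuous_im.comp hz.1).pow 2)).aestronglyMeasurable
    (.of_forall fun x => by
      rw [Real.norm_of_nonneg (mul_nonneg (eta_zero_pos x).le (sq_nonneg _)), Complex.sq_norm,
        Complex.normSq_apply]
      exact mul_le_mul_of_nonneg_left (by nlinarith [mul_self_nonneg (z x).re])
        (eta_zero_pos x).le)

theorem normH_sq_eq (hz : z ∈ spaceH 0) :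
    normH 0 z ^ 2 = energyNormSq (fun x => (z x).re) (fun x => (weakDeriv z x).re)
      + energyNormSq (fun x => (z x).im) (fun x => (weakDeriv z x).im) := by
  have h1 := inEnergySpace_re_of_mem_spaceH hz
  have h2 := inEnergySpace_im_of_mem_spaceH hz
  rw [normH, Real.sq_sqrt (integral_nonneg fun x =>
    add_nonneg (sq_nonneg _) (mul_nonneg (eta_zero_pos x).le (sq_nonneg _)))]
  have e1 := integral_add h1.memLp.integrable_sq h1.integrable
  have e2 := integral_add h2.memLp.integrable_sq h2.integrable
  have e3 := integral_add (h1.memLp.integrable_sq.add h1.integrable)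
    (h2.memLp.integrable_sq.add h2.integrable)
  simp only [Pi.add_apply] at e3
  rw [energyNormSq, energyNormSq, ← e1, ← e2, ← e3]
  refine integral_congr_ae (.of_forall fun x => ?_)
  simp only [Complex.sq_norm, Complex.normSq_apply]
  ring

end

/-! ### Coercivity around a nearby profile -/

/-- Here `S` and `n²` are the squared norms of the shifted perturbation and of `z`, comparable up to
`c²`. Orthogonality errors cost `c²` plus `c² n²`, and `hcs` makes the latter at most `δ/4 · n²`;
the cubic term becomes `n³` plus `c²`. -/
theorem coercivity_arith {δ C L K K' n S c E P Q : ℝ} (hδ : 0 < δ) (hC : 0 ≤ C)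
    (hK : 0 ≤ K) (hK' : 0 ≤ K') (hn : 0 ≤ n) (hS : 0 ≤ S) (hc : 0 ≤ c) (hc1 : c ≤ 1)
    (hcs : c * (4 * (6 * C * L ^ 2 + 1)) ≤ δ) {X : ℝ} (hX : X ≤ 3 * (L * (c * (1 + n))) ^ 2)
    (h1 : n ^ 2 ≤ 2 * S + K ^ 2 * c ^ 2) (h2 : S ≤ 2 * n ^ 2 + K ^ 2 * c ^ 2)
    (hQ : Q ≤ 12 * P + K' * c ^ 2) (hQ0 : 0 ≤ Q)
    (hE : δ * (S + P) - C * (X + √S ^ 3) ≤ E) {Γ : ℝ} (hΓ : 0 < Γ) (hΓ1 : Γ ≤ δ / 12)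
    (hΓ2 : Γ * (δ * K ^ 2 + δ * K' + 6 * C * L ^ 2 + 32 * C + 4 * C * K ^ 3) ≤ 1) :
    Γ * (n ^ 2 + Q) - 1 / Γ * (c ^ 2 + n ^ 3) ≤ E := by
  obtain ⟨N, hN, rfl⟩ : ∃ N, 0 ≤ N ∧ N ^ 2 = S := ⟨√S, Real.sqrt_nonneg S, Real.sq_sqrt hS⟩
  rw [Real.sqrt_sq hN] at hE
  have hc2 : c ^ 2 ≤ c := by nlinarith
  have hc0 : 0 ≤ c ^ 2 := sq_nonneg c
  have hn2 : 0 ≤ n ^ 2 := sq_nonneg n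
  have hn3 : 0 ≤ n ^ 3 := by positivity
  have hKc : 0 ≤ K * c := by positivity
  have hN' : N ≤ 2 * n + K * c :=
    le_of_sq_le_sq (by nlinarith [mul_nonneg hn hKc]) (by positivity)
  have hN3 : N ^ 3 ≤ 32 * n ^ 3 + 4 * K ^ 3 * c ^ 2 := by
    have e1 : N ^ 3 ≤ (2 * n + K * c) ^ 3 := pow_le_pow_left₀ hN hN' 3
    have e2 : (2 * n + K * c) ^ 3 ≤ 4 * ((2 * n) ^ 3 + (K * c) ^ 3) := by
      nlinarith [mul_nonneg (by positivity : 0 ≤ 2 * n + K * c) (sq_nonneg (2 * n - K * c))]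
    have e3 : (K * c) ^ 3 ≤ K ^ 3 * c ^ 2 := by
      rw [mul_pow]
      exact mul_le_mul_of_nonneg_left (by nlinarith) (by positivity)
    linarith
  have hX' : X ≤ 6 * L ^ 2 * c ^ 2 + 6 * L ^ 2 * (c ^ 2 * n ^ 2) := by
    have : 0 ≤ (L * c) ^ 2 * (1 - n) ^ 2 := by positivity
    linarith
  have hX2 : C * X ≤ 6 * C * L ^ 2 * c ^ 2 + δ / 4 * n ^ 2 := by
    have e1 := mul_le_mul_of_nonneg_left hX' hC
    have hCL : 0 ≤ 6 * C * L ^ 2 := by positivity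
    have e2 : 6 * C * L ^ 2 * c ^ 2 ≤ δ / 4 := by
      have e3 := mul_le_mul_of_nonneg_left hc2 hCL
      linarith
    have e4 := mul_le_mul_of_nonneg_right e2 hn2
    linarith
  have hCN := mul_le_mul_of_nonneg_left hN3 hC
  set B := δ * K ^ 2 + δ * K' + 6 * C * L ^ 2 + 32 * C + 4 * C * K ^ 3 with hB
  have hBΓ : B ≤ 1 / Γ := by rw [le_div_iff₀ hΓ]; linarith
  have t1 := mul_le_mul_of_nonneg_right hBΓ (add_nonneg hc0 hn3)
  have t2 := mul_le_mul_of_nonneg_right hΓ1 (add_nonneg hn2 hQ0)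
  have t3 : 0 ≤ (δ * K ^ 2 + δ * K' + 6 * C * L ^ 2 + 4 * C * K ^ 3) * n ^ 3 := by positivity
  have t4 : 0 ≤ 32 * C * c ^ 2 := by positivity
  have t5 : 0 ≤ δ * K ^ 2 * c ^ 2 := by positivity
  have t6 : 0 ≤ δ * K' * c ^ 2 := by positivity
  have t7 := mul_le_mul_of_nonneg_left h1 hδ.le
  have t8 := mul_le_mul_of_nonneg_left hQ hδ.le
  have t9 : 0 ≤ δ * n ^ 2 := by positivity
  rw [hB] at t1
  linarith

section

variable {a s c : ℝ} {d z : ℝ → ℂ}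

theorem norm_add_sq_eq (hs : s ^ 2 = 1) (w v : ℂ) (b : ℝ) :
    ‖w + v‖ ^ 2 = (b + (s * v.re + (s * w.re - b))) ^ 2 + (v.im + w.im) ^ 2 := by
  rw [Complex.sq_norm, Complex.normSq_apply, Complex.add_re, Complex.add_im]
  linear_combination (-(w.re + v.re) ^ 2) * hs

theorem norm_add_sq_eq_modVar (hs : s ^ 2 = 1) (Φ : ℝ → ℂ) (x : ℝ) :
    ‖Φ x + z x‖ ^ 2 = blackSoliton x ^ 2 +
      modVar (fun x => s * (z x).re + (s * (Φ x).re - blackSoliton x))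
        (fun x => (z x).im + (Φ x).im) x := by
  rw [norm_add_sq_eq hs _ _ (blackSoliton x), modVar]
  ring

/-- Both sides compute `|φ_c + z|² - |φ_c|²`; the right side takes `φ₀²` as reference. -/
theorem rho_eq (hs : s ^ 2 = 1) (x : ℝ) :
    rho c z x = modVar (fun x => s * (z x).re + (s * (darkProfile c x).re - blackSoliton x))
        (fun x => (z x).im + (darkProfile c x).im) x
      - (‖darkProfile c x‖ ^ 2 - blackSoliton x ^ 2) := by
  have h := norm_add_sq_eq_modVar (z := z) hs (darkProfile c) x
  rw [sub_sub_eq_add_sub, add_comm (modVar _ _ _), ← h]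
  simp only [rho, cinner, Complex.sq_norm, Complex.normSq_apply, Complex.add_re, Complex.add_im,
    Complex.mul_re, Complex.conj_re, Complex.conj_im]
  ring

theorem continuous_rho (hΦ : Continuous (darkProfile c)) (hz : Continuous z) :
    Continuous (rho c z) := by
  unfold rho cinner
  fun_prop

theorem IsNearSoliton.normL2_sq_le (h : IsNearSoliton a s (darkProfile c) d) (hz : Continuous z)
    (hP : Integrable (potentialRemainder
      (fun x => s * (z x).re + (s * (darkProfile c x).re - blackSoliton x))
      (fun x => (z x).im + (darkProfile c x).im))) :
    normL2 (fun x => darkProfile c x ^ 3 * (rho c z x : ℂ)) ^ 2 ≤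
      12 * (∫ x, potentialRemainder
        (fun x => s * (z x).re + (s * (darkProfile c x).re - blackSoliton x))
        (fun x => (z x).im + (darkProfile c x).im) x)
        + (2 * a ^ 3 + 4 * a ^ 2) * ∫ x, ratWeight x := by
  have ha : 0 ≤ a := (abs_nonneg _).trans (h.abs_im_le 0)
  rw [← integral_lin2 hP integrable_ratWeight]
  refine QuinticGP.normL2_sq_le ((h.continuous.pow 3).mul (Complex.continuous_ofReal.comp
    (continuous_rho h.continuous hz))).aestronglyMeasurable
    ((hP.const_mul 12).add (integrable_ratWeight.const_mul _)) fun x => ?_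
  have h1 := sq_mul_sub_sq_le (blackSoliton_sq_le_one x)
    (neg_sq_le_modVar (fun x => s * (z x).re + (s * (darkProfile c x).re - blackSoliton x))
      (fun x => (z x).im + (darkProfile c x).im) x)
    (add_sub_cancel (blackSoliton x ^ 2) (‖darkProfile c x‖ ^ 2)).symm (norm_nonneg _)
    (h.norm_le_one x) rfl
  rw [← rho_eq h.sign_sq] at h1
  change ‖darkProfile c x ^ 3 * (rho c z x : ℂ)‖ ^ 2 ≤ _
  rw [norm_mul, norm_pow, Complex.norm_real, Real.norm_eq_abs, mul_pow, sq_abs, ← mul_pow]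
  refine h1.trans ?_
  have h2 := h.abs_norm_sq_le x
  have hw := ratWeight_pos x
  have hw1 := ratWeight_le_one x
  have h3 : |‖darkProfile c x‖ ^ 2 - blackSoliton x ^ 2| ^ 2 ≤ a ^ 2 * ratWeight x := by
    refine (pow_le_pow_left₀ (abs_nonneg _) h2 2).trans ?_
    rw [mul_pow]
    exact mul_le_mul_of_nonneg_left (pow_le_of_le_one hw.le hw1 two_ne_zero) (by positivity)
  have h4 : |‖darkProfile c x‖ ^ 2 - blackSoliton x ^ 2| ^ 3 ≤ a ^ 3 * ratWeight x := by
    refine (pow_le_pow_left₀ (abs_nonneg _) h2 3).trans ?_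
    rw [mul_pow]
    exact mul_le_mul_of_nonneg_left (pow_le_of_le_one hw.le hw1 three_ne_zero) (by positivity)
  unfold potentialRemainder
  linarith

theorem continuous_eta (hΦ : Continuous (darkProfile c)) : Continuous (eta c) := by
  unfold eta
  fun_prop

theorem IsNearSoliton.abs_eta_sub_le (h : IsNearSoliton a s (darkProfile c) d) (x : ℝ) :
    |eta c x - eta 0 x| ≤ 200 * a * ratWeight x := by
  have ha : 0 ≤ a := (abs_nonneg _).trans (h.abs_im_le 0)
  have h1 := h.abs_norm_pow_four_le x
  have h2 : 0 ≤ a * ratWeight x := mul_nonneg ha (ratWeight_pos x).le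
  rw [eta_zero, eta, sub_sub_sub_cancel_left, abs_sub_comm]
  linarith

/-- Telescoping costs `2` for the weight and `3 · 64 = 192` for the soliton factor, which decays
only through `eta 0`. The rounded value 200 is shared with `abs_eta_sub_le` so that one constant
serves all three conditions. -/
theorem IsNearSoliton.abs_R_mul_eta_sub_le (h : IsNearSoliton a s (darkProfile c) d) (x : ℝ) :
    |s * (R c x * eta c x) - blackSoliton x * eta 0 x| ≤ 200 * a * ratWeight x := by
  have ha : 0 ≤ a := (abs_nonneg _).trans (h.abs_im_le 0)
  have h1 : |eta c x - eta 0 x| ≤ 2 * a * ratWeight x := by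
    rw [eta_zero, eta, sub_sub_sub_cancel_left, abs_sub_comm]
    exact h.abs_norm_pow_four_le x
  have hs : |s| = 1 := by
    rw [← sq_eq_sq₀ (abs_nonneg s) zero_le_one, sq_abs, h.sign_sq, one_pow]
  have hR : |s * R c x| ≤ 1 := by
    rw [abs_mul, hs, one_mul]
    exact (Complex.abs_re_le_norm _).trans (h.norm_le_one x)
  have h2 : |s * R c x - blackSoliton x| ≤ a := h.abs_re_le x
  have h3 : eta 0 x ≤ 192 * ratWeight x := by
    linarith [eta_zero_le x, sechSq_le_ratWeight x]
  have h4 : 0 ≤ a * ratWeight x := mul_nonneg ha (ratWeight_pos x).le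
  have h5 : |s * R c x| * |eta c x - eta 0 x| ≤ 2 * a * ratWeight x :=
    (mul_le_of_le_one_left (abs_nonneg _) hR).trans h1
  have h6 : |s * R c x - blackSoliton x| * eta 0 x ≤ a * (192 * ratWeight x) :=
    mul_le_mul h2 h3 (eta_zero_pos x).le ha
  rw [show s * (R c x * eta c x) - blackSoliton x * eta 0 x =
    s * R c x * (eta c x - eta 0 x) + (s * R c x - blackSoliton x) * eta 0 x by ring]
  refine (abs_add_le _ _).trans ?_
  rw [abs_mul, abs_mul _ (eta 0 x), abs_of_pos (eta_zero_pos x)]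
  linarith

end

/-! ### Assembly of the estimates and choice of the constants. -/

theorem pseudo_coercivity :
    ∃ c₀ : ℝ, c₀ ∈ Set.Ioo (0 : ℝ) 2 ∧ ∃ Γ : ℝ, 0 < Γ ∧
      ∀ c : ℝ, |c| ≤ c₀ → ∀ z : ℝ → ℂ, z ∈ spaceH 0 →
        (fun x => darkProfile c x + z x) ∈ spaceZ →
        (∫ x, eta c x * (z x).re) = 0 → (∫ x, eta c x * (z x).im) = 0 →
        (∫ x, R c x * eta c x * (z x).im) = 0 →
        Γ * (normH 0 z ^ 2 + normL2 (fun x => darkProfile c x ^ 3 * (rho c z x : ℂ)) ^ 2) -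
            1 / Γ * (c ^ 2 + normH 0 z ^ 3) ≤
          E₂ (fun x => darkProfile c x + z x) - E₂ (darkProfile 0) := by
  obtain ⟨C₁, hC₁, hnear⟩ := exists_isNearSoliton
  obtain ⟨δ, C, hδ, hC, hcoer⟩ := exists_coercivity
  obtain ⟨K₁, hK₁, horth⟩ := exists_abs_integral_mul_le
  set W := ∫ x, ratWeight x with hW
  have hW0 : 0 ≤ W := integral_nonneg fun x => (ratWeight_pos x).le
  set M := W + ∫ x, eta 0 x with hM
  have hM0 : 0 ≤ M := add_nonneg hW0 integral_eta_zero_pos.le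
  set L := K₁ * (200 * C₁) with hL
  -- Real and imaginary parts of the profile difference each contribute `2 C₁² M c²` to the squared
  -- norm, whence `K² = 4 C₁² M`.
  set K := 2 * C₁ * √M with hK
  have hK0 : 0 ≤ K := by positivity
  have hKsq : K ^ 2 = 4 * C₁ ^ 2 * M := by rw [hK, mul_pow, Real.sq_sqrt hM0]; ring
  set K' := (2 * C₁ ^ 3 + 4 * C₁ ^ 2) * W with hK'
  have hK'0 : 0 ≤ K' := by positivity
  set D := 4 * (6 * C * L ^ 2 + 1) with hD
  have hD0 : 0 < D := by positivity
  set B := δ * K ^ 2 + δ * K' + 6 * C * L ^ 2 + 32 * C + 4 * C * K ^ 3 with hB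
  have hB0 : 0 ≤ B := by positivity
  -- The bound `δ / D` is the smallness that absorbs `c² ‖z‖²`; the `+ 1` in `B + 1` avoids dividing
  -- by zero.
  refine ⟨min 1 (δ / D), ⟨lt_min one_pos (by positivity), (min_le_left _ _).trans_lt (by norm_num)⟩,
    min (δ / 12) (1 / (B + 1)), lt_min (by positivity) (by positivity), ?_⟩
  intro c hc z hz hu o1 o2 o3
  have hc1 : |c| ≤ 1 := hc.trans (min_le_left _ _)
  have hcD : |c| * D ≤ δ := (le_div_iff₀ hD0).1 (hc.trans (min_le_right _ _))
  obtain ⟨s, d, h⟩ := hnear c hc1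
  have hs := h.sign_sq
  have hzr := inEnergySpace_re_of_mem_spaceH hz
  have hzi := inEnergySpace_im_of_mem_spaceH hz
  obtain ⟨hA, hAn⟩ := h.inEnergySpace_re
  obtain ⟨hB', hBn⟩ := h.inEnergySpace_im
  have hp := (hzr.const_mul s).add hA
  have hq := hzi.add hB'
  have hn := normH_sq_eq hz
  have hn0 : 0 ≤ normH 0 z := Real.sqrt_nonneg _
  obtain ⟨hP, hE⟩ := energy_sub_eq hp hq
    ((HasWeakDeriv.of_hasDerivAt h.hasDerivAt h.continuous_deriv).add
      (hasWeakDeriv_of_mem_spaceH hz) h.continuous hz.1)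
    (integrable_energyDensity hu) (norm_add_sq_eq_modVar hs _) (fun x => norm_add_sq_eq hs _ _ _)
  have hco := hcoer _ _ _ _ hp hq hP
  rw [← hE] at hco
  have hQ := h.normL2_sq_le hz.1 hP
  have hη := continuous_eta h.continuous
  have hη0 : ∀ x, |eta 0 x| ≤ eta 0 x := fun x => (abs_of_pos (eta_zero_pos x)).le
  have nr : energyNormSq (fun x => (z x).re) (fun x => (weakDeriv z x).re) ≤ normH 0 z ^ 2 := by
    rw [hn]; exact le_add_of_nonneg_right (energyNormSq_nonneg _ _)
  have ni : energyNormSq (fun x => (z x).im) (fun x => (weakDeriv z x).im) ≤ normH 0 z ^ 2 := by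
    rw [hn]; exact le_add_of_nonneg_left (energyNormSq_nonneg _ _)
  have ha0 : 0 ≤ C₁ * |c| := by positivity
  have ha : C₁ * |c| ≤ 200 * (C₁ * |c|) := by linarith
  have b1 := horth _ _ (eta c) (eta 0) _ (200 * (C₁ * |c|)) s _ hzr hη continuous_eta_zero
    hA.continuous hs hn0 nr h.abs_eta_sub_le hη0 (fun x => (h.abs_re_le x).trans ha) o1
  have b2 := horth _ _ (eta c) (eta 0) _ (200 * (C₁ * |c|)) 1 _ hzi hη continuous_eta_zero
    hB'.continuous (one_pow 2) hn0 ni h.abs_eta_sub_le hη0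
    (fun x => (h.abs_im_le x).trans ha) o2
  -- The weight is multiplied by `s` so that it approaches `φ₀ η₀`; the vanishing of the integral is
  -- unaffected.
  have b3 := horth _ _ (fun x => s * (R c x * eta c x)) (fun x => blackSoliton x * eta 0 x) _
    (200 * (C₁ * |c|)) 1 _ hzi
    (((Complex.continuous_re.comp h.continuous).mul hη).const_mul s)
    (continuous_blackSoliton.mul continuous_eta_zero) hB'.continuous (one_pow 2) hn0 ni
    h.abs_R_mul_eta_sub_le
    (fun x => by
      rw [abs_mul, abs_of_pos (eta_zero_pos x)]
      exact mul_le_of_le_one_left (eta_zero_pos x).le (abs_blackSoliton_le_one x))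
    (fun x => (h.abs_im_le x).trans ha)
    (by simp only [mul_assoc s]; rw [integral_const_mul, o3, mul_zero])
  simp only [one_mul] at b2 b3
  have e3 : ∀ x, blackSoliton x * eta 0 x * ((z x).im + (darkProfile c x).im) =
      eta 0 x * (blackSoliton x * ((z x).im + (darkProfile c x).im)) := fun x => by ring
  simp only [e3] at b3
  have eL : K₁ * (200 * (C₁ * |c|) * (1 + normH 0 z)) = L * (|c| * (1 + normH 0 z)) := by
    rw [hL]; ring
  rw [eL] at b1 b2 b3
  have hX := add_le_add (add_le_add (sq_le_sq' (abs_le.1 b1).1 (abs_le.1 b1).2)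
    (sq_le_sq' (abs_le.1 b2).1 (abs_le.1 b2).2)) (sq_le_sq' (abs_le.1 b3).1 (abs_le.1 b3).2)
  have u1 := energyNormSq_add_le (hzr.const_mul s) hA
  have u2 := energyNormSq_add_le hzi hB'
  have l1 := energyNormSq_le_add (hzr.const_mul s) hA
  have l2 := energyNormSq_le_add hzi hB'
  rw [energyNormSq_const_mul hs (fun x => (z x).re)] at u1 l1
  have hN0 := add_nonneg
    (energyNormSq_nonneg (fun x => s * (z x).re + (s * (darkProfile c x).re - blackSoliton x))
      (fun x => s * (weakDeriv z x).re + (s * (d x).re - blackSolitonDeriv x)))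
    (energyNormSq_nonneg (fun x => (z x).im + (darkProfile c x).im)
      (fun x => (weakDeriv z x).im + (d x).im))
  have hc2 : (C₁ * |c|) ^ 2 * M = C₁ ^ 2 * M * |c| ^ 2 := by ring
  rw [hc2] at hAn hBn
  have hc3 : |c| ^ 3 ≤ |c| ^ 2 := pow_le_pow_of_le_one (abs_nonneg c) hc1 (by norm_num)
  rw [← sq_abs c]
  refine coercivity_arith (L := L) (K := K) (K' := K') hδ hC hK0 hK'0 hn0 hN0
    (abs_nonneg c) hc1 hcD (hX.trans_eq (by ring)) ?_ ?_ (hQ.trans ?_) (sq_nonneg _) hco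
    (lt_min (by positivity) (by positivity)) (min_le_left _ _) ?_
  · rw [hn, hKsq]; linarith
  · rw [hn, hKsq]; linarith
  · have t : (2 * C₁ ^ 3 * W) * |c| ^ 3 ≤ (2 * C₁ ^ 3 * W) * |c| ^ 2 :=
      mul_le_mul_of_nonneg_left hc3 (by positivity)
    rw [hK']
    linarith
  · calc _ ≤ 1 / (B + 1) * B := mul_le_mul_of_nonneg_right (min_le_right _ _) hB0
      _ ≤ 1 := by rw [one_div_mul_eq_div, div_le_one (by positivity)]; linarith

end QuinticGP

theorem proposition3p3 :
    ∃ c₀ : ℝ, c₀ ∈ Set.Ioo (0 : ℝ) 2 ∧ ∃ Γ : ℝ, 0 < Γ ∧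
      ∀ c : ℝ, |c| ≤ c₀ → ∀ z : ℝ → ℂ, z ∈ QuinticGP.spaceH 0 →
        (fun x => QuinticGP.darkProfile c x + z x) ∈ QuinticGP.spaceZ →
        (∫ x, QuinticGP.cinner (QuinticGP.eta c x : ℂ) (z x)) = 0 →
        (∫ x, QuinticGP.cinner (Complex.I * (QuinticGP.eta c x : ℂ)) (z x)) = 0 →
        (∫ x, QuinticGP.cinner
          (Complex.I * (QuinticGP.R c x : ℂ) * (QuinticGP.eta c x : ℂ)) (z x)) = 0 →
        QuinticGP.E₂ (fun x => QuinticGP.darkProfile c x + z x) -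
            QuinticGP.E₂ (QuinticGP.darkProfile 0) ≥
          Γ * (QuinticGP.normH 0 z ^ 2 +
              QuinticGP.normL2
                (fun x => QuinticGP.darkProfile c x ^ 3 * (QuinticGP.rho c z x : ℂ)) ^ 2) -
            1 / Γ * (c ^ 2 + QuinticGP.normH 0 z ^ 3) := by
  obtain ⟨c₀, hc₀, Γ, hΓ, h⟩ := QuinticGP.pseudo_coercivity
  refine ⟨c₀, hc₀, Γ, hΓ, fun c hc z hz hu o1 o2 o3 => h c hc z hz hu ?_ ?_ ?_⟩
  · rw [← o1]
    exact integral_congr_ae (.of_forall fun x => by simp [QuinticGP.cinner])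
  · rw [← o2]
    exact integral_congr_ae (.of_forall fun x => by simp [QuinticGP.cinner])
  · rw [← o3]
    exact integral_congr_ae (.of_forall fun x => by simp [QuinticGP.cinner])
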